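/- Let $H$ be a complex Hilbert space, $\mathcal D\subset H$ a subspace, $J\subset\mathbb R$ a non-empty open interval, and $(A(a))_{a\in J}$ a family of self-adjoint operators in $H$ with fixed domain $\mathcal D$ such that, for each $a\in J$, $(A(a)+i)^{-1}$ lies in the Schatten--von Neumann class $C_p(H)$ for some $p>0$. Let $P_0(a)$ be the orthogonal projection onto $\ker A(a)$ and put $\tilde A(a)=(I-P_0(a))A(a)+P_0(a)$. Assume that $\dim\ker A(a)$ is constant on $J$ and that $a\mapsto A(a)x$ is $C^1$ on $J$, with derivative $A'(a)x$, for each $x\in\mathcal D$. For an operator $B:\mathcal D\to H$ put $$\eta(A,B;s)=\frac1{\Gamma(\frac{s+1}2)}\int_0^\infty t^{\frac{s-1}2}\,\mathrm{tr}_H\big(Be^{-tA^2}\big)\,dt ,\qquad \eta(A;s)=\eta(A,A;s).$$ (1) Let $(B(a))_{a\in J}$ be a family of operators $\mathcal D\to H$, bounded for the graph norm of $A(a)$, such that $P_0(a)B(a)P_0(a)=0$, $[B(a),(A(a)^2-\zeta)^{-1}]=0$ for all $a\in J$ and $\zeta\notin\mathrm{spec}\,A(a)^2$, and $a\mapsto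 B(a)x$ is $C^1$ on $J$, with derivative $B'(a)x$, for each $x\in\mathcal D$. Let $a\in J$, $p>0$ with $(A(a)+i)^{-1}\in C_p(H)$, and $\mathrm{Re}\,s>p$. Then all the functions $\eta$ below are defined (the operators under the traces are trace class and the integrals converge absolutely), $b\mapsto\eta(A(b),B(b);s)$ is differentiable at $a$, and $$\frac{\partial}{\partial a}\eta(A(a),B(a);s)=\eta(A(a),B'(a);s)-\frac{s+1}2\,\eta\Big(A(a),B(a)\big(\tfrac{d}{da}A(a)^2\big)\tilde A(a)^{-2};s\Big).$$ Here $C=B(a)\big(\frac d{da}A(a)^2\big)\tilde A(a)^{-2}$ is understood weakly: $\frac d{da}A(a)^2$ is the form $(u,w)\mapsto\frac d{da}\langle A(a)u,A(a)w\rangle$ on $\mathcal D$, the matrix element $\langle y,Cx\rangle$ is the value of this form at $(B(a)^*y,\tilde A(a)^{-2}x)$ for $x,y$ in the ranges of the operators $e^{-tA(a)^2}$, $t>0$, and $\mathrm{tr}_H(Ce^{-tA^2})$ means $\mathrm{tr}_H(e^{-tA^2/2}Ce^{-tA^2/2})$. If $B(a)(A'(a)A(a)+A(a)A'(a))\tilde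 A(a)^{-2}$ is defined on all of $\mathcal D$ as a composition of operators, then the last term is $\eta$ of this operator in the original sense. If in addition $[B(b),(A(b)-\zeta)^{-1}]=0$ for all $b\in J$ and $\zeta\notin\mathrm{spec}\,A(b)$, then $$\frac{\partial}{\partial a}\eta(A(a),B(a);s)=\eta(A(a),B'(a);s)-(s+1)\,\eta\big(A(a),A'(a)B(a)A(a)\tilde A(a)^{-2};s\big).$$ (2) For $a\in J$, $p>0$ with $(A(a)+i)^{-1}\in C_p(H)$, and $\mathrm{Re}\,s>p$, the functions $\eta(A(a);s)$ and $\eta(A(a),A'(a);s)$ are defined, $b\mapsto\eta(A(b);s)$ is differentiable at $a$, and $$\frac{\partial}{\partial a}\eta(A(a);s)=-s\,\eta(A(a),A'(a);s).$$ -/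

import Mathlib

open scoped InnerProductSpace LinearPMap

noncomputable section

namespace EtaVar

variable {H : Type*} [NormedAddCommGroup H] [InnerProductSpace ℂ H] [CompleteSpace H]

/-! ### Schatten classes and the trace -/

/-- The `n`-th approximation number of a bounded operator on a Hilbert space: its distance, in
operator norm, to the operators of rank at most `n`. For a compact operator these are the
singular values in decreasing order, repeated according to multiplicity. -/
def approxNumber (T : H →L[ℂ] H) (n : ℕ) : ℝ :=
  sInf {r : ℝ | ∃ F : H →L[ℂ] H, LinearMap.rank (F : H →ₗ[ℂ] H) ≤ (n : Cardinal) ∧ r = ‖T - F‖}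

/-- The Schatten--von Neumann class `C_p(H)`: the singular values are `p`-summable. -/
def MemSchatten (p : ℝ) (T : H →L[ℂ] H) : Prop :=
  Summable fun n : ℕ => approxNumber T n ^ p

/-- A map `H → H` is a trace class operator. -/
def IsTraceClass (T : H → H) : Prop :=
  ∃ L : H →L[ℂ] H, (∀ x, L x = T x) ∧ MemSchatten 1 L

variable (H) in
/-- Index set of a fixed Hilbert basis of `H`. -/
def basisIndex : Set H := (exists_hilbertBasis ℂ H).choose

variable (H) in
/-- A fixed Hilbert basis of `H`. -/
def basis : HilbertBasis (basisIndex H) ℂ H := (exists_hilbertBasis ℂ H).choose_spec.choose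

/-- The trace, computed in a fixed Hilbert basis (for trace class operators the choice of the
basis does not matter). -/
def trace (T : H → H) : ℂ := ∑' i, ⟪basis H i, T (basis H i)⟫_ℂ

/-! ### Unbounded operators -/

open Classical in
/-- An unbounded operator as a map on all of `H`, with the value `0` off its domain. It serves to
write compositions of unbounded operators. -/
def app (T : H →ₗ.[ℂ] H) (x : H) : H := if h : x ∈ T.domain then T ⟨x, h⟩ else 0

/-- `T²` on its natural domain `{x ∈ 𝓓(T) | T x ∈ 𝓓(T)}`. -/
def sq (T : H →ₗ.[ℂ] H) : H →ₗ.[ℂ] H where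
  domain := (T.domain.comap T.toFun).map T.domain.subtype
  toFun :=
    { toFun := fun x => T ⟨T ⟨x, by
          obtain ⟨y, _, hy⟩ := x.2
          exact hy ▸ y.2⟩, by
          obtain ⟨x, y, hy, rfl⟩ := x
          exact hy⟩
      map_add' := fun x y => by
        rw [← LinearPMap.map_add]
        congr 1
        ext
        exact T.map_add ⟨x, _⟩ ⟨y, _⟩
      map_smul' := fun c x => by
        rw [RingHom.id_apply, ← LinearPMap.map_smul]
        congr 1
        ext
        exact T.map_smul c ⟨x, _⟩ }

/-- `R` is the bounded inverse `(T - ζ)⁻¹`; such an `R` exists if and only if `ζ ∉ spec T`. -/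
def IsResolventAt (T : H →ₗ.[ℂ] H) (ζ : ℂ) (R : H →L[ℂ] H) : Prop :=
  (∀ y : H, ∃ h : R y ∈ T.domain, T ⟨R y, h⟩ - ζ • R y = y) ∧
    ∀ x : T.domain, R (T x - ζ • (x : H)) = x

/-- `(A + i)⁻¹ ∈ C_p(H)`. -/
def ResolventMemSchatten (p : ℝ) (A : H →ₗ.[ℂ] H) : Prop :=
  ∃ R : H →L[ℂ] H, IsResolventAt A (-Complex.I) R ∧ MemSchatten p R

/-- `B` is defined on the domain of `A` and bounded for the graph norm of `A`. -/
def IsRelBounded (A B : H →ₗ.[ℂ] H) : Prop :=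
  B.domain = A.domain ∧ ∃ C : ℝ, ∀ x ∈ A.domain, ‖app B x‖ ≤ C * (‖x‖ + ‖app A x‖)

/-- `[B, (T - ζ)⁻¹] = 0` on the domain of `B`, for all `ζ ∉ spec T`. -/
def CommutesWithResolvents (B T : H →ₗ.[ℂ] H) : Prop :=
  ∀ (ζ : ℂ) (R : H →L[ℂ] H), IsResolventAt T ζ R →
    ∀ x : B.domain, ∃ h : R x ∈ B.domain, B ⟨R x, h⟩ = R (B x)

/-- The eigenspace `ker (A - r)`. -/
def eigenspace (A : H →ₗ.[ℂ] H) (r : ℝ) : Submodule ℂ H :=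
  (LinearMap.ker (A.toFun - (r : ℂ) • A.domain.subtype)).map A.domain.subtype

/-- The orthogonal projection onto `ker (A - r)`; this eigenspace is closed for closed `A`, so that
taking its closure changes nothing. -/
def eigenproj (A : H →ₗ.[ℂ] H) (r : ℝ) : H →L[ℂ] H :=
  (eigenspace A r).topologicalClosure.starProjection

/-- The heat operator `e^{-tA²}`, by the spectral theorem for a self-adjoint operator `A` with
compact resolvent. -/
def heat (A : H →ₗ.[ℂ] H) (t : ℝ) (x : H) : H :=
  ∑' r : ℝ, ((Real.exp (-t * r ^ 2) : ℝ) : ℂ) • eigenproj A r x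

/-- `Ã = (I - P₀) A + P₀`. -/
def tilde (A : H →ₗ.[ℂ] H) (x : A.domain) : H :=
  (A x - eigenproj A 0 (A x)) + eigenproj A 0 (x : H)

/-- `Ã⁻¹ : H → 𝓓(A)`. -/
def tildeInv (A : H →ₗ.[ℂ] H) : H → A.domain := Function.invFun (tilde A)

/-- `Ã⁻² : H → 𝓓(A)`. -/
def tildeInvSq (A : H →ₗ.[ℂ] H) (x : H) : A.domain := tildeInv A (tildeInv A x : H)

/-! ### Eta functions -/

/-- The Mellin transform `Γ((s+1)/2)⁻¹ ∫₀^∞ t^{(s-1)/2} f(t) dt`. -/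
def etaMellin (f : ℝ → ℂ) (s : ℂ) : ℂ :=
  1 / Complex.Gamma ((s + 1) / 2) * ∫ t in Set.Ioi (0 : ℝ), (t : ℂ) ^ ((s - 1) / 2) * f t

/-- Absolute convergence of the integral in `etaMellin`. -/
def EtaMellinConvergent (f : ℝ → ℂ) (s : ℂ) : Prop :=
  MeasureTheory.IntegrableOn (fun t : ℝ => (t : ℂ) ^ ((s - 1) / 2) * f t) (Set.Ioi (0 : ℝ))

/-- `η(A, B; s) = Γ((s+1)/2)⁻¹ ∫₀^∞ t^{(s-1)/2} tr_H (B e^{-tA²}) dt`. -/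
def eta (A : H →ₗ.[ℂ] H) (B : H → H) (s : ℂ) : ℂ :=
  etaMellin (fun t => trace fun x => B (heat A t x)) s

/-- The operators `B e^{-tA²}` are trace class and the integral for `η(A, B; s)` converges
absolutely. -/
def EtaDefined (A : H →ₗ.[ℂ] H) (B : H → H) (s : ℂ) : Prop :=
  (∀ t : ℝ, 0 < t → IsTraceClass fun x => B (heat A t x)) ∧
    EtaMellinConvergent (fun t => trace fun x => B (heat A t x)) s

/-- `η(A; s) = η(A, A; s)`. -/
def etaSelf (A : H →ₗ.[ℂ] H) (s : ℂ) : ℂ := eta A (app A) s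

/-- `η(A, C; s)` for an operator `C` that is only given weakly, through its matrix elements
`c y x = ⟪y, C x⟫` for `x, y` in the range of the operators `e^{-tA²}`, `t > 0`. The trace of
`C e^{-tA²}` is read as the trace of `e^{-(t/2)A²} C e^{-(t/2)A²}`, which is the same number if
`C` is an operator from `𝓓(A)` to `H`, by cyclicity of the trace. -/
def etaWeak (A : H →ₗ.[ℂ] H) (c : H → H → ℂ) (s : ℂ) : ℂ :=
  etaMellin
    (fun t => ∑' i, c (heat A (t / 2) (basis H i)) (heat A (t / 2) (basis H i))) s

/-- The forms `(y, x) ↦ c (e^{-(t/2)A²} y) (e^{-(t/2)A²} x)` are those of trace class operators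
and the integral in `etaWeak` converges absolutely. -/
def EtaWeakDefined (A : H →ₗ.[ℂ] H) (c : H → H → ℂ) (s : ℂ) : Prop :=
  (∀ t : ℝ, 0 < t → ∃ L : H →L[ℂ] H, MemSchatten 1 L ∧
      ∀ y x : H, ⟪y, L x⟫_ℂ = c (heat A (t / 2) y) (heat A (t / 2) x)) ∧
    EtaMellinConvergent
      (fun t => ∑' i, c (heat A (t / 2) (basis H i)) (heat A (t / 2) (basis H i))) s

/-! ### Families with a fixed domain -/

/-- The unbounded operator with domain `D` given by a linear map on `D`. -/
def op {D : Submodule ℂ H} (T : D →ₗ[ℂ] H) : H →ₗ.[ℂ] H := ⟨D, T⟩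

/-- `d/da A(a)²` as a form on the fixed domain: the derivative of
`⟪u, A(a)² w⟫ = ⟪A(a) u, A(a) w⟫`. (The domain of `A(a)²` itself varies with `a`.) -/
def sqDeriv {D : Submodule ℂ H} (A : ℝ → D →ₗ[ℂ] H) (a : ℝ) (u w : D) : ℂ :=
  deriv (fun b : ℝ => ⟪A b u, A b w⟫_ℂ) a

open Classical in
/-- Matrix elements `⟪y, C x⟫ = ⟪B(a)† y, (d/da A(a)²) Ã(a)⁻² x⟫` of the operator
`C = B(a) (d/da A(a)²) Ã(a)⁻²`, for `y` in the domain of `B(a)†` with `B(a)† y ∈ D`. -/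
def variationForm {D : Submodule ℂ H} (A B : ℝ → D →ₗ[ℂ] H) (a : ℝ) (y x : H) : ℂ :=
  if h : app (op (B a))† y ∈ D then
    sqDeriv A a ⟨app (op (B a))† y, h⟩ (tildeInvSq (op (A a)) x)
  else 0

/-- The family `T` is strongly differentiable on `J`, with strongly continuous derivative `T'`. -/
def HasStrongDeriv {D : Submodule ℂ H} (J : Set ℝ) (T T' : ℝ → D →ₗ[ℂ] H) : Prop :=
  ∀ x : D, (∀ a ∈ J, HasDerivAt (fun b => T b x) (T' a x) a) ∧ ContinuousOn (fun b => T' b x) J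

end EtaVar

end

open scoped InnerProductSpace LinearPMap

set_option linter.unusedSectionVars false

noncomputable section

namespace EtaVar

variable {H : Type*} [NormedAddCommGroup H] [InnerProductSpace ℂ H] [CompleteSpace H]

/-! ### Diagonal operators -/

section Diag

variable {ι : Type*} (f : HilbertBasis ι ℂ H)

/-! Write q = (s+1)/2. An operator in a Schatten class is compact, so each A(a) has a Hilbert basis
of eigenvectors f_i with real eigenvalues μ_i (`exists_eigenbasis`), and Σ (1+μ_i²)^(-p/2) is
finite. Since B commutes with the resolvents of A², B f_i only has components with the same value of
μ². Expanding the traces in this basis turns η(A,B;s) into the Dirichlet series Σ ⟨f_i, B f_i⟩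
(μ_i²)^(-q). Kernel terms drop out: B vanishes on ker A, and P₀B'P₀ = 0 by a second-order estimate
(`inner_deriv_ker`). As B and B' have order one relative to A, the series converges absolutely for
Re s > p.

The heat operator is not differentiated directly: the domain of A(a)² moves with a. Instead, the
same series equals, up to the constant Β(k-q, q), the integral over z > 0 of z^(k-1-q) tr(B
(A²+z)^(-k)) (`hasSum_integral_resolvent`), and resolvents obey an algebraic difference identity
that only uses the fixed domain (`sqRes_sub`). With R = (A²+z)^(-1), the derivative of tr(B R^k) is
tr(B' R^k) - k Σ c_i (μ_i²+z)^(-k-1), where c_i is the form (d/da)A² evaluated at (f_i, B f_i)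
(`hasDerivAt_resTrace`). Derivatives exist only strongly, so the limit of the traces is taken by
telescoping R_b^n - R_a^n and always keeping a nuclear power of the fixed operator R_a next to
strongly convergent bounded factors (`tendsto_trace_step`). Integrating over z, the identity k
Β(k-q, q+1) = q Β(k-q, q) produces the factor (s+1)/2 and one more power of μ_i^(-2), that is,
Ã^(-2) (`integral_coef`).

Differentiation under the z-integral needs bounds uniform in b near a (`exists_local`). Constancy of
dim ker A keeps a spectral gap around 0 (`gap_of_perturb`); factoring (A(b)+i)^(-1) through
(A(a)+i)^(-1) bounds the Schatten sums (`summable_of_perturb`); Banach-Steinhaus and the mean value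
inequality give uniform relative bounds (`exists_bound`).

The weak operator C = B (d/da A²) Ã^(-2) is handled by multiplying A, A' and B by (1+A²)^(-1/2),
which makes each of them bounded (`weak_traceClass`). The simplified formulas come from comparing
Dirichlet coefficients: if B commutes with A, the two halves of the form coincide, and for B = A the
coefficient becomes 1 - (s+1) = -s. -/

theorem hilbertBasis_ext {x y : H} (h : ∀ i, ⟪f i, x⟫_ℂ = ⟪f i, y⟫_ℂ) : x = y := by
  apply f.repr.injective
  ext i
  simpa only [f.repr_apply_apply] using h i

theorem hasSum_norm_sq_coeff (x : H) : HasSum (fun i => ‖⟪f i, x⟫_ℂ‖ ^ 2) (‖x‖ ^ 2) := by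
  have h := f.hasSum_inner_mul_inner x x
  have h2 := Complex.reCLM.hasSum h
  convert h2 using 1
  · ext i
    simp only [Complex.reCLM_apply]
    rw [← inner_conj_symm x (f i), mul_comm, Complex.mul_conj, Complex.ofReal_re,
      Complex.normSq_eq_norm_sq]
  · rw [Complex.reCLM_apply, inner_self_eq_norm_sq_to_K]
    norm_cast

/-- By Parseval. Norm bounds for functions of a diagonalized operator are reduced through this to
bounds on the eigenvalues. -/
theorem norm_le_of_coeff_le {C : ℝ} (hC : 0 ≤ C) {x y : H}
    (h : ∀ i, ‖⟪f i, x⟫_ℂ‖ ≤ C * ‖⟪f i, y⟫_ℂ‖) : ‖x‖ ≤ C * ‖y‖ := by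
  have h1 := hasSum_norm_sq_coeff f x
  have h2 := (hasSum_norm_sq_coeff f y).mul_left (C ^ 2)
  have h3 : ‖x‖ ^ 2 ≤ C ^ 2 * ‖y‖ ^ 2 := hasSum_le (fun i => by
    rw [← mul_pow]; exact pow_le_pow_left₀ (norm_nonneg _) (h i) 2) h1 h2
  rw [← mul_pow] at h3
  exact le_of_sq_le_sq h3 (by positivity)

theorem exists_of_coeff_le {C : ℝ} {c : ι → ℂ} {y : H}
    (h : ∀ i, ‖c i‖ ≤ C * ‖⟪f i, y⟫_ℂ‖) : ∃ x : H, ∀ i, ⟪f i, x⟫_ℂ = c i := by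
  have hc : Memℓp c 2 := by
    apply memℓp_gen
    have := (hasSum_norm_sq_coeff f y).summable.mul_left (C ^ 2)
    refine Summable.of_nonneg_of_le (fun i => by positivity) (fun i => ?_) this
    simp only [ENNReal.toReal_ofNat, Real.rpow_ofNat]
    rw [← mul_pow]
    exact pow_le_pow_left₀ (norm_nonneg _) (h i) 2
  refine ⟨f.repr.symm ⟨c, hc⟩, fun i => ?_⟩
  rw [← f.repr_apply_apply, LinearIsometryEquiv.apply_symm_apply]

/-- `g` is a bounded family. -/
def IsBdd (g : ι → ℂ) : Prop := ∃ C, ∀ i, ‖g i‖ ≤ C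

theorem IsBdd.mul {g h : ι → ℂ} (hg : IsBdd g) (hh : IsBdd h) : IsBdd fun i => g i * h i := by
  obtain ⟨C, hC⟩ := hg
  obtain ⟨C', hC'⟩ := hh
  refine ⟨C * C', fun i => ?_⟩
  rw [norm_mul]
  exact mul_le_mul (hC i) (hC' i) (norm_nonneg _) ((norm_nonneg _).trans (hC i))

theorem exists_diag {g : ι → ℂ} (hg : IsBdd g) :
    ∃ T : H →L[ℂ] H, ∀ x i, ⟪f i, T x⟫_ℂ = g i * ⟪f i, x⟫_ℂ := by
  obtain ⟨C, hC⟩ := hg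
  have hb : ∀ i, ‖g i‖ ≤ max C 0 := fun i => (hC i).trans (le_max_left _ _)
  have (x : H) : ∃ y : H, ∀ i, ⟪f i, y⟫_ℂ = g i * ⟪f i, x⟫_ℂ :=
    exists_of_coeff_le f (C := max C 0) (y := x) fun i => by
      rw [norm_mul]; exact mul_le_mul_of_nonneg_right (hb i) (norm_nonneg _)
  choose T hT using this
  let L : H →ₗ[ℂ] H :=
    { toFun := T
      map_add' := fun x y => hilbertBasis_ext f fun i => by
        simp only [inner_add_right, hT, mul_add]
      map_smul' := fun c x => hilbertBasis_ext f fun i => by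
        simp only [inner_smul_right, hT, RingHom.id_apply]; ring }
  refine ⟨L.mkContinuous (max C 0) fun x => norm_le_of_coeff_le f (le_max_right _ _) fun i => ?_,
    hT⟩
  change ‖⟪f i, T x⟫_ℂ‖ ≤ _
  rw [hT, norm_mul]
  exact mul_le_mul_of_nonneg_right (hb i) (norm_nonneg _)

open Classical in
/-- The operator with eigenvectors `f i` and eigenvalues `g i`, for a bounded family `g`. -/
def diag (g : ι → ℂ) : H →L[ℂ] H := if h : IsBdd g then (exists_diag f h).choose else 0

variable {f}

theorem inner_diag {g : ι → ℂ} (hg : IsBdd g) (x : H) (i : ι) :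
    ⟪f i, diag f g x⟫_ℂ = g i * ⟪f i, x⟫_ℂ := by
  rw [diag, dif_pos hg]
  exact (exists_diag f hg).choose_spec x i

theorem inner_basis_self (i : ι) : ⟪f i, f i⟫_ℂ = 1 := by
  rw [inner_self_eq_norm_sq_to_K, f.orthonormal.1 i]; simp

theorem inner_basis_ne {i j : ι} (h : i ≠ j) : ⟪f i, f j⟫_ℂ = 0 := f.orthonormal.2 h

theorem diag_basis {g : ι → ℂ} (hg : IsBdd g) (j : ι) : diag f g (f j) = g j • f j := by
  refine hilbertBasis_ext f fun i => ?_
  rw [inner_diag hg, inner_smul_right]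
  by_cases h : i = j
  · rw [h]
  · rw [inner_basis_ne h, mul_zero, mul_zero]

theorem diag_mul_diag {g h : ι → ℂ} (hg : IsBdd g) (hh : IsBdd h) :
    diag f g * diag f h = diag f fun i => g i * h i := by
  ext x
  refine hilbertBasis_ext f fun i => ?_
  rw [mul_apply_eq_comp, inner_diag hg, inner_diag hh, inner_diag (hg.mul hh)]
  ring

theorem diag_diag {g h : ι → ℂ} (hg : IsBdd g) (hh : IsBdd h) (x : H) :
    diag f g (diag f h x) = diag f (fun i => g i * h i) x := by
  rw [← diag_mul_diag hg hh]; rfl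

theorem norm_diag_apply_le {g : ι → ℂ} {C : ℝ} (hC0 : 0 ≤ C) (hC : ∀ i, ‖g i‖ ≤ C) (x : H) :
    ‖diag f g x‖ ≤ C * ‖x‖ := norm_le_of_coeff_le f hC0 fun i => by
  rw [inner_diag ⟨C, hC⟩, norm_mul]
  exact mul_le_mul_of_nonneg_right (hC i) (norm_nonneg _)

theorem inner_diag_left {g : ι → ℂ} (hg : IsBdd g) (x y : H) :
    ⟪diag f g x, y⟫_ℂ = ⟪x, diag f (fun i => (starRingEnd ℂ) (g i)) y⟫_ℂ := by
  have hg' : IsBdd fun i => (starRingEnd ℂ) (g i) := by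
    obtain ⟨C, hC⟩ := hg
    exact ⟨C, fun i => by simpa using hC i⟩
  rw [← f.tsum_inner_mul_inner, ← f.tsum_inner_mul_inner]
  congr 1
  ext i
  rw [← inner_conj_symm, inner_diag hg, inner_diag hg', map_mul, inner_conj_symm]
  ring

theorem hasSum_diag {g : ι → ℂ} (hg : IsBdd g) (x : H) :
    HasSum (fun i => (g i * ⟪f i, x⟫_ℂ) • f i) (diag f g x) := by
  have := f.hasSum_repr (diag f g x)
  simpa only [f.repr_apply_apply, inner_diag hg] using this

end Diag

/-! ### Nuclear operators and the trace -/

/-- `K` has a nuclear representation of total weight at most `c`. -/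
def IsNuclear (K : H →L[ℂ] H) (c : ℝ) : Prop :=
  ∃ (ι : Type) (u v : ι → H), Summable (fun i => ‖u i‖ * ‖v i‖) ∧
    ∑' i, ‖u i‖ * ‖v i‖ ≤ c ∧ ∀ x, HasSum (fun i => ⟪v i, x⟫_ℂ • u i) (K x)

/-- Cauchy-Schwarz and Parseval. The absolute bound is what allows the double series of a trace to
be summed in either order. -/
theorem summable_norm_inner_mul_inner {κ : Type*} (e : HilbertBasis κ ℂ H) (x y : H) :
    Summable (fun j => ‖⟪x, e j⟫_ℂ‖ * ‖⟪e j, y⟫_ℂ‖) ∧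
      ∑' j, ‖⟪x, e j⟫_ℂ‖ * ‖⟪e j, y⟫_ℂ‖ ≤ ‖x‖ * ‖y‖ := by
  have hx := hasSum_norm_sq_coeff e x
  have hy := hasSum_norm_sq_coeff e y
  have hs : ∀ s : Finset κ, ∑ j ∈ s, ‖⟪x, e j⟫_ℂ‖ * ‖⟪e j, y⟫_ℂ‖ ≤ ‖x‖ * ‖y‖ := fun s => by
    refine (Real.sum_mul_le_sqrt_mul_sqrt s _ _).trans ?_
    refine mul_le_mul ?_ ?_ (Real.sqrt_nonneg _) (norm_nonneg _)
    · rw [Real.sqrt_le_left (norm_nonneg _)]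
      simp_rw [norm_inner_symm x]
      exact sum_le_hasSum s (fun _ _ => by positivity) hx
    · rw [Real.sqrt_le_left (norm_nonneg _)]
      exact sum_le_hasSum s (fun _ _ => by positivity) hy
  have h0 : ∀ j, 0 ≤ ‖⟪x, e j⟫_ℂ‖ * ‖⟪e j, y⟫_ℂ‖ := fun j => by positivity
  exact ⟨summable_of_sum_le h0 hs, Real.tsum_le_of_sum_le h0 hs⟩

/-- The double series ⟨v_i, e_j⟩⟨e_j, u_i⟩ converges absolutely; summing over j first gives ⟨v_i,
u_i⟩, summing over i first gives the diagonal of K. The value does not involve the basis, so the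
trace may be computed in any eigenbasis. -/
theorem hasSum_trace_of_hasSum {κ ι : Type*} (e : HilbertBasis κ ℂ H) {u v : ι → H} {K : H → H}
    (hs : Summable (fun i => ‖u i‖ * ‖v i‖)) (hK : ∀ x, HasSum (fun i => ⟪v i, x⟫_ℂ • u i) (K x)) :
    HasSum (fun j => ⟪e j, K (e j)⟫_ℂ) (∑' i, ⟪v i, u i⟫_ℂ) := by
  set F : ι × κ → ℂ := fun q => ⟪v q.1, e q.2⟫_ℂ * ⟪e q.2, u q.1⟫_ℂ
  have hF : Summable F := by
    apply Summable.of_norm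
    have h0 : ∀ q, 0 ≤ ‖F q‖ := fun q => norm_nonneg _
    rw [summable_prod_of_nonneg h0]
    have hn : ∀ i j, ‖F (i, j)‖ = ‖⟪v i, e j⟫_ℂ‖ * ‖⟪e j, u i⟫_ℂ‖ := fun i j => norm_mul _ _
    simp_rw [hn]
    refine ⟨fun i => (summable_norm_inner_mul_inner e _ _).1, ?_⟩
    refine Summable.of_nonneg_of_le (fun i => tsum_nonneg fun j => by positivity) (fun i => ?_) hs
    rw [mul_comm ‖u i‖]
    exact (summable_norm_inner_mul_inner e _ _).2
  have h1 : ∑' q, F q = ∑' i, ⟪v i, u i⟫_ℂ := by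
    rw [hF.tsum_prod]
    congr 1
    ext i
    exact (e.hasSum_inner_mul_inner (v i) (u i)).tsum_eq
  rw [← h1]
  have h2 : HasSum (F ∘ Prod.swap) (∑' q, F q) :=
    (Equiv.prodComm κ ι).hasSum_iff.mpr hF.hasSum
  refine h2.prod_fiberwise fun j => ?_
  have := (innerSL ℂ (e j)).hasSum (hK (e j))
  simpa [F, Function.comp_def, inner_smul_right] using this

theorem trace_eq_of_hasSum {ι : Type*} {u v : ι → H} {K : H → H}
    (hs : Summable (fun i => ‖u i‖ * ‖v i‖)) (hK : ∀ x, HasSum (fun i => ⟪v i, x⟫_ℂ • u i) (K x)) :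
    trace K = ∑' i, ⟪v i, u i⟫_ℂ := (hasSum_trace_of_hasSum (basis H) hs hK).tsum_eq

namespace IsNuclear

variable {K L X : H →L[ℂ] H} {c d : ℝ}

theorem mono (h : IsNuclear K c) (hcd : c ≤ d) : IsNuclear K d := by
  obtain ⟨ι, u, v, hs, hc, hK⟩ := h
  exact ⟨ι, u, v, hs, hc.trans hcd, hK⟩

theorem mul_left (h : IsNuclear K c) (X : H →L[ℂ] H) : IsNuclear (X * K) (‖X‖ * c) := by
  obtain ⟨ι, u, v, hs, hc, hK⟩ := h
  have hb : ∀ i, ‖X (u i)‖ * ‖v i‖ ≤ ‖X‖ * (‖u i‖ * ‖v i‖) := fun i => by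
    rw [← mul_assoc]; exact mul_le_mul_of_nonneg_right (X.le_opNorm _) (norm_nonneg _)
  have hs' : Summable fun i => ‖X (u i)‖ * ‖v i‖ :=
    Summable.of_nonneg_of_le (fun i => by positivity) hb (hs.mul_left _)
  refine ⟨ι, fun i => X (u i), v, hs', ?_, fun x => ?_⟩
  · refine (hs'.tsum_le_tsum hb (hs.mul_left _)).trans ?_
    rw [tsum_mul_left]
    exact mul_le_mul_of_nonneg_left hc (norm_nonneg _)
  · simpa [Function.comp_def] using X.hasSum (hK x)

theorem mul_right (h : IsNuclear K c) (X : H →L[ℂ] H) : IsNuclear (K * X) (‖X‖ * c) := by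
  obtain ⟨ι, u, v, hs, hc, hK⟩ := h
  have hb : ∀ i, ‖u i‖ * ‖X.adjoint (v i)‖ ≤ ‖X‖ * (‖u i‖ * ‖v i‖) := fun i => by
    have h1 := X.adjoint.le_opNorm (v i)
    rw [LinearIsometryEquiv.norm_map] at h1
    have := mul_le_mul_of_nonneg_left h1 (norm_nonneg (u i))
    linarith
  have hs' : Summable fun i => ‖u i‖ * ‖X.adjoint (v i)‖ :=
    Summable.of_nonneg_of_le (fun i => by positivity) hb (hs.mul_left _)
  refine ⟨ι, u, fun i => X.adjoint (v i), hs', ?_, fun x => ?_⟩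
  · refine (hs'.tsum_le_tsum hb (hs.mul_left _)).trans ?_
    rw [tsum_mul_left]
    exact mul_le_mul_of_nonneg_left hc (norm_nonneg _)
  · simpa [ContinuousLinearMap.adjoint_inner_left] using hK (X x)

theorem hasSum_trace (h : IsNuclear K c) :
    HasSum (fun j => ⟪basis H j, K (basis H j)⟫_ℂ) (trace K) := by
  obtain ⟨ι, u, v, hs, hc, hK⟩ := h
  rw [trace_eq_of_hasSum hs hK]
  exact hasSum_trace_of_hasSum _ hs hK

theorem norm_trace_le (h : IsNuclear K c) : ‖trace K‖ ≤ c := by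
  obtain ⟨ι, u, v, hs, hc, hK⟩ := h
  rw [trace_eq_of_hasSum hs hK]
  refine le_trans (tsum_of_norm_bounded hs.hasSum fun i => ?_) hc
  rw [mul_comm]
  exact norm_inner_le_norm _ _

theorem trace_add (hK : IsNuclear K c) (hL : IsNuclear L d) :
    trace (K + L : H →L[ℂ] H) = trace K + trace L := by
  have := hK.hasSum_trace.add hL.hasSum_trace
  rw [trace, ← this.tsum_eq]
  simp

theorem trace_smul (z : ℂ) (K : H →L[ℂ] H) : trace (z • K : H →L[ℂ] H) = z * trace K := by
  rw [trace, trace, ← tsum_mul_left]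
  simp

/-- If K is represented by (u_i, v_i), then XK is represented by (X u_i, v_i) and KX by (u_i, X*
v_i); both traces are Σ ⟨v_i, X u_i⟩. -/
theorem trace_mul_comm (h : IsNuclear K c) (X : H →L[ℂ] H) :
    trace (X * K : H →L[ℂ] H) = trace (K * X : H →L[ℂ] H) := by
  obtain ⟨ι, u, v, hs, hc, hK⟩ := h
  have hs1 : Summable fun i => ‖X (u i)‖ * ‖v i‖ := by
    refine Summable.of_nonneg_of_le (fun i => by positivity) (fun i => ?_) (hs.mul_left ‖X‖)
    rw [← mul_assoc]; exact mul_le_mul_of_nonneg_right (X.le_opNorm _) (norm_nonneg _)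
  have hs2 : Summable fun i => ‖u i‖ * ‖X.adjoint (v i)‖ := by
    refine Summable.of_nonneg_of_le (fun i => by positivity) (fun i => ?_) (hs.mul_left ‖X‖)
    have h1 := X.adjoint.le_opNorm (v i)
    rw [LinearIsometryEquiv.norm_map] at h1
    have := mul_le_mul_of_nonneg_left h1 (norm_nonneg (u i))
    linarith
  rw [trace_eq_of_hasSum (u := fun i => X (u i)) (v := v) hs1 fun x => by
      simpa [Function.comp_def] using X.hasSum (hK x),
    trace_eq_of_hasSum (u := u) (v := fun i => X.adjoint (v i)) hs2 fun x => by
      simpa [ContinuousLinearMap.adjoint_inner_left] using hK (X x)]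
  simp [ContinuousLinearMap.adjoint_inner_left]

end IsNuclear

/-- `X b → Y` strongly, and the `X b` are eventually bounded. -/
def STendsto {α : Type*} (X : α → H →L[ℂ] H) (l : Filter α) (Y : H →L[ℂ] H) : Prop :=
  (∃ C, ∀ᶠ b in l, ‖X b‖ ≤ C) ∧ ∀ x, Filter.Tendsto (fun b => X b x) l (nhds (Y x))

namespace STendsto

variable {α : Type*} {l : Filter α} {X X' : α → H →L[ℂ] H} {Y Y' : H →L[ℂ] H}

theorem const (Y : H →L[ℂ] H) : STendsto (fun _ : α => Y) l Y :=
  ⟨⟨‖Y‖, Filter.Eventually.of_forall fun _ => le_rfl⟩, fun _ => tendsto_const_nhds⟩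

theorem add (h : STendsto X l Y) (h' : STendsto X' l Y') :
    STendsto (fun b => X b + X' b) l (Y + Y') := by
  obtain ⟨⟨C, hC⟩, h⟩ := h
  obtain ⟨⟨C', hC'⟩, h'⟩ := h'
  refine ⟨⟨C + C', ?_⟩, fun x => (h x).add (h' x)⟩
  filter_upwards [hC, hC'] with b h1 h2
  exact (norm_add_le _ _).trans (add_le_add h1 h2)

theorem neg (h : STendsto X l Y) : STendsto (fun b => - X b) l (-Y) := by
  obtain ⟨⟨C, hC⟩, h⟩ := h
  refine ⟨⟨C, ?_⟩, fun x => (h x).neg⟩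
  filter_upwards [hC] with b h1
  rwa [norm_neg]

/-- Strong convergence is compatible with products only on bounded sets: in X_b(X'_b x - Y'x) +
X_b(Y'x) the first term is controlled by the bound on X_b. -/
theorem mul (h : STendsto X l Y) (h' : STendsto X' l Y') :
    STendsto (fun b => X b * X' b) l (Y * Y') := by
  obtain ⟨⟨C, hC⟩, h⟩ := h
  obtain ⟨⟨C', hC'⟩, h'⟩ := h'
  refine ⟨⟨C * C', ?_⟩, fun x => ?_⟩
  · filter_upwards [hC, hC'] with b h1 h2
    exact (norm_mul_le _ _).trans
      (mul_le_mul h1 h2 (norm_nonneg _) ((norm_nonneg _).trans h1))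
  · have h1 : Filter.Tendsto (fun b => X b (X' b x - Y' x)) l (nhds 0) := by
      have h2 : Filter.Tendsto (fun b => C * ‖X' b x - Y' x‖) l (nhds 0) := by
        have := ((h' x).sub_const (Y' x)).norm.const_mul C
        simpa using this
      refine squeeze_zero_norm' ?_ h2
      filter_upwards [hC] with b hb
      exact (X b).le_of_opNorm_le hb _
    have h3 := h1.add (h (Y' x))
    simpa using h3

theorem congr' (h : STendsto X l Y) (hX : ∀ᶠ b in l, X b = X' b) : STendsto X' l Y := by
  obtain ⟨⟨C, hC⟩, h⟩ := h
  refine ⟨⟨C, ?_⟩, fun x => (h x).congr' ?_⟩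
  · filter_upwards [hC, hX] with b h1 h2
    rwa [← h2]
  · filter_upwards [hX] with b h2
    rw [h2]

theorem of_tendsto (h : Filter.Tendsto X l (nhds Y)) : STendsto X l Y := by
  refine ⟨⟨‖Y‖ + 1, ?_⟩, fun x => ?_⟩
  · filter_upwards [h.norm.eventually (gt_mem_nhds (lt_add_one ‖Y‖))] with b hb using hb.le
  · exact ((ContinuousLinearMap.apply ℂ H x).continuous.tendsto Y).comp h

/-- Bounded families converging strongly on a dense subset converge strongly. -/
theorem of_dense {s : Set H} (hs : Dense s) {C : ℝ} (hC : ∀ᶠ b in l, ‖X b‖ ≤ C)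
    (h : ∀ x ∈ s, Filter.Tendsto (fun b => X b x) l (nhds (Y x))) : STendsto X l Y := by
  refine ⟨⟨C, hC⟩, fun x => ?_⟩
  rw [Metric.tendsto_nhds]
  intro ε hε
  set M := max C 0 + ‖Y‖ + 1
  have hM : 0 < M := by positivity
  -- M exceeds the sum of the bounds for `X b` and `Y`, so replacing x by y costs less than ε/2 in
  -- total; the other ε/2 is the convergence at y.
  obtain ⟨y, hy, hxy⟩ := hs.exists_dist_lt x (show 0 < ε / (2 * M) by positivity)
  have h2 := (Metric.tendsto_nhds.mp (h y hy)) (ε / 2) (by positivity)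
  filter_upwards [hC, h2] with b h3 h4
  rw [dist_eq_norm] at *
  have e : X b x - Y x = X b (x - y) + (X b y - Y y) - Y (x - y) := by
    simp only [map_sub]; abel
  rw [e]
  have h5 : ‖X b (x - y)‖ ≤ max C 0 * ‖x - y‖ :=
    (X b).le_of_opNorm_le (h3.trans (le_max_left _ _)) _
  have h6 := Y.le_opNorm (x - y)
  have h7 : M * ‖x - y‖ < ε / 2 := by
    have := (lt_div_iff₀ (by positivity)).mp hxy
    linarith
  have h8 : 0 ≤ ‖x - y‖ := norm_nonneg _
  calc _ ≤ ‖X b (x - y)‖ + ‖X b y - Y y‖ + ‖Y (x - y)‖ :=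
        (norm_sub_le _ _).trans (add_le_add_left (norm_add_le _ _) _)
    _ < ε := by
        have : (max C 0 + ‖Y‖) * ‖x - y‖ ≤ M * ‖x - y‖ :=
          mul_le_mul_of_nonneg_right (by simp [M]) h8
        nlinarith

/-- Dominated convergence in Σ ⟨v_i, X_b u_i⟩ with majorant C‖u_i‖‖v_i‖. This is why a fixed nuclear
factor suffices for traces of merely strongly convergent families to converge. -/
theorem tendsto_trace_mul {K : H →L[ℂ] H} {c : ℝ} (h : STendsto X l Y) (hK : IsNuclear K c) :
    Filter.Tendsto (fun b => trace (X b * K : H →L[ℂ] H)) l (nhds (trace (Y * K : H →L[ℂ] H))) := by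
  obtain ⟨ι, u, v, hs, hc, hK⟩ := hK
  obtain ⟨⟨C, hC⟩, h⟩ := h
  have key : ∀ Z : H →L[ℂ] H, trace (Z * K : H →L[ℂ] H) = ∑' i, ⟪v i, Z (u i)⟫_ℂ := fun Z => by
    refine trace_eq_of_hasSum (u := fun i => Z (u i)) (v := v) ?_ fun x => by
      simpa [Function.comp_def] using Z.hasSum (hK x)
    refine Summable.of_nonneg_of_le (fun i => by positivity) (fun i => ?_) (hs.mul_left ‖Z‖)
    rw [← mul_assoc]; exact mul_le_mul_of_nonneg_right (Z.le_opNorm _) (norm_nonneg _)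
  simp_rw [key]
  refine tendsto_tsum_of_dominated_convergence (hs.mul_left C) (fun i => ?_) ?_
  · exact Filter.Tendsto.inner (𝕜 := ℂ) tendsto_const_nhds (h (u i))
  · filter_upwards [hC] with b hb i
    refine (norm_inner_le_norm _ _).trans ?_
    have := mul_le_mul_of_nonneg_left ((X b).le_of_opNorm_le hb (u i)) (norm_nonneg (v i))
    linarith

end STendsto

section DiagNuclear

variable {ι : Type} {f : HilbertBasis ι ℂ H} {g : ι → ℂ}

theorem isBdd_of_summable {ι : Type*} {g : ι → ℂ} (hg : Summable fun i => ‖g i‖) : IsBdd g :=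
  ⟨∑' i, ‖g i‖, fun i => hg.le_tsum i fun _ _ => norm_nonneg _⟩

theorem isNuclear_diag (hg : Summable fun i => ‖g i‖) :
    IsNuclear (diag f g) (∑' i, ‖g i‖) := by
  have e : (fun i => ‖g i • f i‖ * ‖f i‖) = fun i => ‖g i‖ := by
    ext i; rw [norm_smul, f.orthonormal.1 i, mul_one, mul_one]
  refine ⟨ι, fun i => g i • f i, f, e ▸ hg, by rw [e], fun x => ?_⟩
  simpa [smul_smul, mul_comm] using hasSum_diag (f := f) (isBdd_of_summable hg) x

/-- The trace is read off from the nuclear expansion along f, whatever basis defines it. All series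
over the spectrum below originate here. -/
theorem hasSum_trace_mul_diag (hg : Summable fun i => ‖g i‖) (X : H →L[ℂ] H) :
    HasSum (fun i => g i * ⟪f i, X (f i)⟫_ℂ) (trace (X * diag f g : H →L[ℂ] H)) := by
  have hb := isBdd_of_summable hg
  have hs : Summable fun i => ‖g i * ⟪f i, X (f i)⟫_ℂ‖ := by
    refine Summable.of_nonneg_of_le (fun i => norm_nonneg _) (fun i => ?_) (hg.mul_right ‖X‖)
    rw [norm_mul]
    refine mul_le_mul_of_nonneg_left ((norm_inner_le_norm _ _).trans ?_) (norm_nonneg _)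
    have := X.le_opNorm (f i)
    rwa [f.orthonormal.1 i, one_mul, ← mul_one ‖X‖, ← f.orthonormal.1 i]
  have e : (fun i => g i * ⟪f i, X (f i)⟫_ℂ) = fun i => ⟪f i, g i • X (f i)⟫_ℂ := by
    ext i; rw [inner_smul_right]
  rw [trace_eq_of_hasSum (u := fun i => g i • X (f i)) (v := f), ← e]
  · exact hs.of_norm.hasSum
  · refine Summable.of_nonneg_of_le (fun i => by positivity) (fun i => ?_) (hg.mul_right ‖X‖)
    rw [f.orthonormal.1 i, mul_one, norm_smul]
    refine mul_le_mul_of_nonneg_left ?_ (norm_nonneg _)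
    have := X.le_opNorm (f i)
    rwa [f.orthonormal.1 i, mul_one] at this
  · intro x
    have := X.hasSum (hasSum_diag (f := f) hb x)
    simpa [Function.comp_def, smul_smul, mul_comm] using this

end DiagNuclear

end EtaVar

namespace EtaVar

variable {H : Type*} [NormedAddCommGroup H] [InnerProductSpace ℂ H] [CompleteSpace H]

/-! ### Approximation numbers -/

theorem approxNumber_bddBelow (T : H →L[ℂ] H) (n : ℕ) : BddBelow {r : ℝ | ∃ F : H →L[ℂ] H,
    LinearMap.rank (F : H →ₗ[ℂ] H) ≤ (n : Cardinal) ∧ r = ‖T - F‖} :=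
  ⟨0, by rintro _ ⟨F, -, rfl⟩; exact norm_nonneg _⟩

theorem approxNumber_nonempty (T : H →L[ℂ] H) (n : ℕ) : {r : ℝ | ∃ F : H →L[ℂ] H,
    LinearMap.rank (F : H →ₗ[ℂ] H) ≤ (n : Cardinal) ∧ r = ‖T - F‖}.Nonempty :=
  ⟨‖T - 0‖, 0, by simp [LinearMap.rank_zero], rfl⟩

theorem approxNumber_le (T F : H →L[ℂ] H) (n : ℕ)
    (hF : LinearMap.rank (F : H →ₗ[ℂ] H) ≤ (n : Cardinal)) : approxNumber T n ≤ ‖T - F‖ :=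
  csInf_le (approxNumber_bddBelow T n) ⟨F, hF, rfl⟩

theorem approxNumber_nonneg (T : H →L[ℂ] H) (n : ℕ) : 0 ≤ approxNumber T n :=
  Real.sInf_nonneg (by rintro _ ⟨F, -, rfl⟩; exact norm_nonneg _)

theorem le_approxNumber (T : H →L[ℂ] H) (n : ℕ) {r : ℝ} (h : ∀ F : H →L[ℂ] H,
    LinearMap.rank (F : H →ₗ[ℂ] H) ≤ (n : Cardinal) → r ≤ ‖T - F‖) : r ≤ approxNumber T n :=
  le_csInf (approxNumber_nonempty T n) (by rintro _ ⟨F, hF, rfl⟩; exact h F hF)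

theorem exists_norm_sub_lt (T : H →L[ℂ] H) (n : ℕ) {r : ℝ} (h : approxNumber T n < r) :
    ∃ F : H →L[ℂ] H, LinearMap.rank (F : H →ₗ[ℂ] H) ≤ (n : Cardinal) ∧ ‖T - F‖ < r := by
  obtain ⟨_, ⟨F, hF, rfl⟩, h2⟩ := exists_lt_of_csInf_lt (approxNumber_nonempty T n) h
  exact ⟨F, hF, h2⟩

theorem approxNumber_mul_left_le (X T : H →L[ℂ] H) (n : ℕ) :
    approxNumber (X * T) n ≤ ‖X‖ * approxNumber T n := by
  refine le_of_forall_pos_lt_add fun ε hε => ?_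
  obtain ⟨F, hF, h⟩ := exists_norm_sub_lt T n
    (lt_add_of_pos_right (approxNumber T n) (show 0 < ε / (‖X‖ + 1) by positivity))
  have h1 : LinearMap.rank ((X * F : H →L[ℂ] H) : H →ₗ[ℂ] H) ≤ (n : Cardinal) := by
    refine le_trans ?_ hF
    exact LinearMap.rank_comp_le_right _ _
  refine (approxNumber_le _ _ n h1).trans_lt ?_
  rw [← mul_sub]
  have h2 : ‖X‖ * (ε / (‖X‖ + 1)) < ε := by
    rw [mul_div_assoc', div_lt_iff₀ (by positivity)]
    nlinarith [norm_nonneg X]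
  have := mul_le_mul_of_nonneg_left h.le (norm_nonneg X)
  linarith [norm_mul_le X (T - F)]

theorem approxNumber_mul_right_le (X T : H →L[ℂ] H) (n : ℕ) :
    approxNumber (T * X) n ≤ ‖X‖ * approxNumber T n := by
  refine le_of_forall_pos_lt_add fun ε hε => ?_
  obtain ⟨F, hF, h⟩ := exists_norm_sub_lt T n
    (lt_add_of_pos_right (approxNumber T n) (show 0 < ε / (‖X‖ + 1) by positivity))
  have h1 : LinearMap.rank ((F * X : H →L[ℂ] H) : H →ₗ[ℂ] H) ≤ (n : Cardinal) := by
    refine le_trans ?_ hF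
    exact LinearMap.rank_comp_le_left _ _
  refine (approxNumber_le _ _ n h1).trans_lt ?_
  rw [← sub_mul]
  have h2 : ‖X‖ * (ε / (‖X‖ + 1)) < ε := by
    rw [mul_div_assoc', div_lt_iff₀ (by positivity)]
    nlinarith [norm_nonneg X]
  have := mul_le_mul_of_nonneg_left h.le (norm_nonneg X)
  linarith [norm_mul_le (T - F) X]

theorem MemSchatten.one_mul_left {T : H →L[ℂ] H} (hT : MemSchatten 1 T) (X : H →L[ℂ] H) :
    MemSchatten 1 (X * T) := by
  unfold MemSchatten at *
  simp only [Real.rpow_one] at *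
  exact Summable.of_nonneg_of_le (fun n => approxNumber_nonneg _ _)
    (fun n => approxNumber_mul_left_le X T n) (hT.mul_left _)

section Diag

variable {ι : Type*} {f : HilbertBasis ι ℂ H} {g : ι → ℂ}

theorem rank_diag_le (s : Finset ι) (hg : IsBdd g) (hs : ∀ i ∉ s, g i = 0) :
    LinearMap.rank (diag f g : H →ₗ[ℂ] H) ≤ (s.card : Cardinal) := by
  classical
  have h : LinearMap.range (diag f g : H →ₗ[ℂ] H) ≤ Submodule.span ℂ (s.image f : Set H) := by
    rintro _ ⟨x, rfl⟩
    have h1 := hasSum_diag (f := f) hg x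
    have h2 : HasSum (fun i => (g i * ⟪f i, x⟫_ℂ) • f i) (∑ i ∈ s, (g i * ⟪f i, x⟫_ℂ) • f i) :=
      hasSum_sum_of_ne_finset_zero fun i hi => by rw [hs i hi, zero_mul, zero_smul]
    change diag f g x ∈ _
    rw [h1.unique h2]
    exact Submodule.sum_mem _ fun i hi => Submodule.smul_mem _ _
      (Submodule.subset_span (Finset.mem_coe.mpr (Finset.mem_image_of_mem f hi)))
  refine (Submodule.rank_mono h).trans ((rank_span_finset_le _).trans ?_)
  exact_mod_cast Finset.card_image_le

theorem diag_sub_diag {h : ι → ℂ} (hg : IsBdd g) (hh : IsBdd h) :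
    diag f g - diag f h = diag f fun i => g i - h i := by
  ext x
  refine hilbertBasis_ext f fun i => ?_
  have hgh : IsBdd fun i => g i - h i := by
    obtain ⟨C, hC⟩ := hg
    obtain ⟨C', hC'⟩ := hh
    exact ⟨C + C', fun i => (norm_sub_le _ _).trans (add_le_add (hC i) (hC' i))⟩
  rw [sub_apply, inner_sub_right, inner_diag hg, inner_diag hh, inner_diag hgh]
  ring

/-- A diagonal operator is approximated by its finite sections. -/
theorem approxNumber_diag_le (s : Finset ι) {n : ℕ} (hn : s.card ≤ n) (hg : IsBdd g) {r : ℝ}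
    (hr : 0 ≤ r) (h : ∀ i ∉ s, ‖g i‖ ≤ r) : approxNumber (diag f g) n ≤ r := by
  classical
  have hb : IsBdd fun i => if i ∈ s then g i else 0 := by
    obtain ⟨C, hC⟩ := hg
    refine ⟨C, fun i => ?_⟩
    dsimp only
    split_ifs
    · exact hC i
    · simpa using (norm_nonneg _).trans (hC i)
  refine (approxNumber_le _ (diag f fun i => if i ∈ s then g i else 0) n ?_).trans ?_
  · refine (rank_diag_le s hb fun i hi => by simp [hi]).trans ?_
    exact_mod_cast hn
  · rw [diag_sub_diag hg hb]
    refine ContinuousLinearMap.opNorm_le_bound _ hr fun x => norm_diag_apply_le hr (fun i => ?_) x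
    by_cases hi : i ∈ s
    · simp [hi, hr]
    · simpa [hi] using h i hi

/-- Greedy choice: s collects at most n entries, so cutting the operator down to s bounds the n-th
approximation number by the largest entry outside s, which is then added to s. Nothing is added once
the remaining entries vanish. -/
theorem exists_sum_approxNumber_le (hg : Summable fun i => ‖g i‖) (n : ℕ) : ∃ s : Finset ι,
    s.card ≤ n ∧ ∑ k ∈ Finset.range n, approxNumber (diag f g) k ≤ ∑ i ∈ s, ‖g i‖ := by
  classical
  induction n with
  | zero => exact ⟨∅, by simp⟩
  | succ n ih =>
    obtain ⟨s, hs, h⟩ := ih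
    by_cases hz : ∀ i ∉ s, ‖g i‖ ≤ 0
    · refine ⟨s, by lia, ?_⟩
      rw [Finset.sum_range_succ]
      have := approxNumber_diag_le (f := f) s hs (isBdd_of_summable hg) le_rfl hz
      linarith
    · push Not at hz
      obtain ⟨j, hj, hj0⟩ := hz
      -- Summability leaves only finitely many entries as large as the nonzero one at j, so a
      -- largest entry outside s exists.
      have hfin : {i | ‖g j‖ ≤ ‖g i‖}.Finite := by
        have := hg.tendsto_cofinite_zero.eventually (gt_mem_nhds hj0)
        rw [Filter.eventually_cofinite] at this
        simpa using this
      obtain ⟨i, hi, him⟩ := (hfin.toFinset.filter (· ∉ s)).exists_max_image (fun i => ‖g i‖)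
        ⟨j, by simp [hj]⟩
      simp only [Finset.mem_filter, Set.Finite.mem_toFinset, Set.mem_ofPred_eq] at hi him
      refine ⟨insert i s, (Finset.card_insert_le _ _).trans (by lia), ?_⟩
      rw [Finset.sum_range_succ, Finset.sum_insert hi.2]
      have := approxNumber_diag_le (f := f) s hs (isBdd_of_summable hg) (norm_nonneg (g i))
        fun l hl => by
          by_cases hjl : ‖g j‖ ≤ ‖g l‖
          · exact him l ⟨hjl, hl⟩
          · exact (not_le.mp hjl).le.trans hi.1
      linarith

/-- Diagonal operators with summable entries are trace class. -/
theorem memSchatten_one_diag (hg : Summable fun i => ‖g i‖) : MemSchatten 1 (diag f g) := by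
  unfold MemSchatten
  simp only [Real.rpow_one]
  refine summable_of_sum_range_le (c := ∑' i, ‖g i‖) (fun n => approxNumber_nonneg _ _) fun n => ?_
  obtain ⟨s, -, h⟩ := exists_sum_approxNumber_le (f := f) hg n
  exact h.trans (hg.sum_le_tsum _ fun _ _ => norm_nonneg _)

/-- If `n + 1` of the entries of a diagonal operator are at least `r`, so is its `n`-th
approximation number. -/
theorem le_approxNumber_diag (hg : IsBdd g) (s : Finset ι) {n : ℕ} (hn : n < s.card) {r : ℝ}
    (hr : 0 ≤ r) (h : ∀ i ∈ s, r ≤ ‖g i‖) : r ≤ approxNumber (diag f g) n := by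
  classical
  refine le_approxNumber _ _ fun F hF => ?_
  let V : Submodule ℂ H := Submodule.span ℂ (Set.range fun i : s => f i)
  have hli : LinearIndependent ℂ fun i : s => f i :=
    f.orthonormal.linearIndependent.comp _ Subtype.val_injective
  have hV : Module.rank ℂ V = s.card := by
    have := FiniteDimensional.span_of_finite ℂ (Set.finite_range fun i : s => f i)
    rw [← Module.finrank_eq_rank, finrank_span_eq_card hli, Fintype.card_coe]
  -- V has dimension greater than n, hence greater than the rank of F, so F kills some nonzero x in
  -- V. On V the diagonal operator expands norms by at least r, and F does not help at x.
  have hex : ∃ x ∈ V, x ≠ 0 ∧ F x = 0 := by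
    by_contra hc
    push Not at hc
    have hinj : Function.Injective ((F : H →ₗ[ℂ] H).domRestrict V) := by
      rw [← LinearMap.ker_eq_bot, LinearMap.ker_eq_bot']
      rintro ⟨x, hx⟩ hx0
      by_contra hne
      exact hc x hx (fun h0 => hne (Subtype.ext h0)) hx0
    have h1 := rank_range_of_injective _ hinj
    have h2 : LinearMap.range ((F : H →ₗ[ℂ] H).domRestrict V) ≤ LinearMap.range (F : H →ₗ[ℂ] H) := by
      rintro _ ⟨x, rfl⟩
      exact ⟨x, rfl⟩
    have h3 := (Submodule.rank_mono h2).trans hF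
    rw [h1, hV] at h3
    exact absurd (by exact_mod_cast h3 : s.card ≤ n) (by lia)
  obtain ⟨x, hxV, hx0, hFx⟩ := hex
  have hcoef : ∀ i ∉ s, ⟪f i, x⟫_ℂ = 0 := fun i hi => by
    have : V ≤ LinearMap.ker (innerₛₗ ℂ (f i)) := by
      rw [Submodule.span_le]
      rintro _ ⟨j, rfl⟩
      exact inner_basis_ne (by rintro rfl; exact hi j.2)
    exact this hxV
  have hle : r * ‖x‖ ≤ ‖diag f g x‖ := by
    rcases hr.eq_or_lt with rfl | hr
    · simp
    have := norm_le_of_coeff_le f (C := r⁻¹) (x := x) (y := diag f g x) (by positivity) fun i => by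
      rw [inner_diag hg, norm_mul]
      by_cases hi : i ∈ s
      · have := mul_le_mul_of_nonneg_right (h i hi) (norm_nonneg ⟪f i, x⟫_ℂ)
        rw [inv_mul_eq_div, le_div_iff₀ hr]
        linarith
      · rw [hcoef i hi]; simp
    rw [inv_mul_eq_div, le_div_iff₀ hr] at this
    linarith
  have h1 : ‖diag f g x‖ ≤ ‖diag f g - F‖ * ‖x‖ := by
    have := (diag f g - F).le_opNorm x
    rwa [sub_apply, hFx, sub_zero] at this
  exact le_of_mul_le_mul_right (hle.trans h1) (norm_pos_iff.mpr hx0)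

/-- Remove a smallest entry: the n+1 entries of s are all at least as large, so it is bounded by the
n-th approximation number. Induction treats the rest. -/
theorem sum_rpow_le_sum_approxNumber {p : ℝ} (hp : 0 < p) (hg : IsBdd g) (n : ℕ) (s : Finset ι)
    (hs : s.card = n) :
    ∑ i ∈ s, ‖g i‖ ^ p ≤ ∑ k ∈ Finset.range n, approxNumber (diag f g) k ^ p := by
  classical
  induction n generalizing s with
  | zero => rw [Finset.card_eq_zero.mp hs]; simp
  | succ n ih =>
    obtain ⟨i, hi, him⟩ := s.exists_min_image (fun i => ‖g i‖) (Finset.card_pos.mp (by lia))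
    rw [← Finset.add_sum_erase s _ hi, Finset.sum_range_succ, add_comm]
    refine add_le_add (ih _ (by rw [Finset.card_erase_of_mem hi, hs]; rfl)) ?_
    exact Real.rpow_le_rpow (norm_nonneg _)
      (le_approxNumber_diag hg s (by lia) (norm_nonneg _) him) hp.le

theorem summable_rpow_of_memSchatten {p : ℝ} (hp : 0 < p) (hg : IsBdd g)
    (h : MemSchatten p (diag f g)) : Summable (fun i => ‖g i‖ ^ p) ∧
      ∑' i, ‖g i‖ ^ p ≤ ∑' n, approxNumber (diag f g) n ^ p := by
  have h0 : ∀ i, 0 ≤ ‖g i‖ ^ p := fun i => Real.rpow_nonneg (norm_nonneg _) _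
  have hs : ∀ s : Finset ι, ∑ i ∈ s, ‖g i‖ ^ p ≤ ∑' n, approxNumber (diag f g) n ^ p := fun s =>
    (sum_rpow_le_sum_approxNumber hp hg _ s rfl).trans
      (Summable.sum_le_tsum _ (fun _ _ => Real.rpow_nonneg (approxNumber_nonneg _ _) _) h)
  exact ⟨summable_of_sum_le h0 hs, Real.tsum_le_of_sum_le h0 hs⟩

end Diag

theorem isCompactOperator_of_rank_le (F : H →L[ℂ] H) (n : ℕ)
    (hF : LinearMap.rank (F : H →ₗ[ℂ] H) ≤ (n : Cardinal)) : IsCompactOperator F := by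
  have : FiniteDimensional ℂ (LinearMap.range (F : H →ₗ[ℂ] H)) :=
    Module.rank_lt_aleph0_iff.mp (hF.trans_lt (Cardinal.natCast_lt_aleph0))
  have := FiniteDimensional.proper ℂ (LinearMap.range (F : H →ₗ[ℂ] H))
  have h : IsCompactOperator (F.rangeRestrict) :=
    isCompactOperator_of_locallyCompactSpace_dom F.rangeRestrict
  exact h.clm_comp (LinearMap.range (F : H →ₗ[ℂ] H)).subtypeL

/-- Summability of the p-th powers forces the approximation numbers to tend to 0, so T is a norm
limit of finite rank operators. -/
theorem MemSchatten.isCompactOperator {p : ℝ} (hp : 0 < p) {T : H →L[ℂ] H}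
    (hT : MemSchatten p T) : IsCompactOperator T := by
  have h0 : Filter.Tendsto (fun n => approxNumber T n) Filter.atTop (nhds 0) := by
    have h1 := hT.tendsto_atTop_zero
    have h2 := h1.rpow_const (p := p⁻¹) (Or.inr (by positivity))
    rw [Real.zero_rpow (by positivity)] at h2
    refine h2.congr fun n => ?_
    rw [← Real.rpow_mul (approxNumber_nonneg _ _), mul_inv_cancel₀ hp.ne', Real.rpow_one]
  have h1 : ∀ n : ℕ, ∃ F : H →L[ℂ] H, LinearMap.rank (F : H →ₗ[ℂ] H) ≤ (n : Cardinal) ∧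
      ‖T - F‖ < approxNumber T n + 1 / ((n : ℝ) + 1) := fun n =>
    exists_norm_sub_lt T n (lt_add_of_pos_right _ Nat.one_div_pos_of_nat)
  choose F hF hn using h1
  refine isCompactOperator_of_tendsto (l := Filter.atTop) (F := F) ?_
    (Filter.Eventually.of_forall fun n => isCompactOperator_of_rank_le _ n (hF n))
  rw [tendsto_iff_norm_sub_tendsto_zero]
  refine squeeze_zero (fun n => norm_nonneg _) (fun n => ?_)
    (by simpa using h0.add tendsto_one_div_add_atTop_nhds_zero_nat)
  rw [norm_sub_rev]
  simpa using (hn n).le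

end EtaVar

namespace EtaVar

variable {H : Type*} [NormedAddCommGroup H] [InnerProductSpace ℂ H] [CompleteSpace H]

/-! ### Diagonalization of self-adjoint operators with resolvent in a Schatten class -/

/-- `f` is a Hilbert basis of eigenvectors of `T` with eigenvalues `μ`, and `T` has its maximal
domain. -/
structure IsEigenbasis {ι : Type*} {D : Submodule ℂ H} (T : D →ₗ[ℂ] H) (f : HilbertBasis ι ℂ H)
    (μ : ι → ℝ) : Prop where
  mem : ∀ i, f i ∈ D
  inner_apply : ∀ (x : D) i, ⟪f i, T x⟫_ℂ = μ i * ⟪f i, (x : H)⟫_ℂ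
  mem_of_coeff : ∀ x y : H, (∀ i, ⟪f i, y⟫_ℂ = μ i * ⟪f i, x⟫_ℂ) → x ∈ D

variable {D : Submodule ℂ H} {T : D →ₗ[ℂ] H}

theorem inner_apply_of_isSelfAdjoint (h : IsSelfAdjoint (op T)) (x y : D) :
    ⟪T x, (y : H)⟫_ℂ = ⟪(x : H), T y⟫_ℂ := by
  have h1 := LinearPMap.adjoint_isFormalAdjoint h.dense_domain
  rw [LinearPMap.isSelfAdjoint_def.mp h] at h1
  exact h1 x y

theorem mem_of_isSelfAdjoint (h : IsSelfAdjoint (op T)) {y w : H}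
    (hw : ∀ x : D, ⟪w, (x : H)⟫_ℂ = ⟪y, T x⟫_ℂ) : ∃ hy : y ∈ D, T ⟨y, hy⟩ = w := by
  have h1 := LinearPMap.mem_adjoint_domain_of_exists (T := op T) y ⟨w, hw⟩
  rw [LinearPMap.isSelfAdjoint_def.mp h] at h1
  refine ⟨h1, ?_⟩
  refine h.dense_domain.eq_of_inner_left ℂ fun x hx => ?_
  have := inner_apply_of_isSelfAdjoint h ⟨y, h1⟩ ⟨x, hx⟩
  rw [this]
  exact (hw ⟨x, hx⟩).symm

theorem mem_eigenspace_iff {r : ℝ} {x : H} :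
    x ∈ eigenspace (op T) r ↔ ∃ h : x ∈ D, T ⟨x, h⟩ = (r : ℂ) • x := by
  constructor
  · rintro ⟨y, hy, rfl⟩
    refine ⟨y.2, ?_⟩
    have : T y - (r : ℂ) • (y : H) = 0 := hy
    exact sub_eq_zero.mp this
  · rintro ⟨h, hx⟩
    refine ⟨⟨x, h⟩, ?_, rfl⟩
    change T ⟨x, h⟩ - (r : ℂ) • x = 0
    rw [hx, sub_self]

/-- R = (T+i)^(-1) is normal with adjoint S = (T-i)^(-1). The compact symmetric operator K = SR is
injective, so its eigenspaces for nonzero κ are finite dimensional and span. Each is invariant under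
the symmetric operator R+S; since S-R = 2iSR acts there as 2iκ, an eigenvector of R+S is an
eigenvector of R and therefore of T. -/
theorem exists_eigenbasis (h : IsSelfAdjoint (op T)) {R : H →L[ℂ] H}
    (hR : IsResolventAt (op T) (-Complex.I) R) (hRc : IsCompactOperator R) :
    ∃ (ι : Type) (f : HilbertBasis ι ℂ H) (μ : ι → ℝ), IsEigenbasis T f μ := by
  have hR1 : ∀ y, ∃ hy : R y ∈ D, T ⟨R y, hy⟩ = y - Complex.I • R y := fun y => by
    obtain ⟨hy, e⟩ := hR.1 y
    refine ⟨hy, ?_⟩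
    change T ⟨R y, hy⟩ - (-Complex.I) • R y = y at e
    rw [neg_smul, sub_neg_eq_add] at e
    exact eq_sub_of_add_eq e
  have hR2 : ∀ x : D, R (T x + Complex.I • (x : H)) = x := fun x => by
    have := hR.2 x
    rwa [neg_smul, sub_neg_eq_add] at this
  set S := R.adjoint with hS
  have hS1 : ∀ y, ∃ hy : S y ∈ D, T ⟨S y, hy⟩ = y + Complex.I • S y := fun y => by
    refine mem_of_isSelfAdjoint h fun x => ?_
    have e1 : ⟪S y, T x + Complex.I • (x : H)⟫_ℂ = ⟪y, (x : H)⟫_ℂ := by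
      rw [hS, ContinuousLinearMap.adjoint_inner_left, hR2]
    rw [inner_add_right, inner_smul_right] at e1
    rw [inner_add_left, inner_smul_left, Complex.conj_I, ← e1]
    ring
  have hS2 : ∀ x : D, S (T x - Complex.I • (x : H)) = x := fun x => by
    refine ext_inner_right ℂ fun y => ?_
    obtain ⟨hy, e⟩ := hR1 y
    rw [hS, ContinuousLinearMap.adjoint_inner_left, inner_sub_left,
      inner_apply_of_isSelfAdjoint h x ⟨R y, hy⟩, e, inner_sub_right, inner_smul_left,
      inner_smul_right, Complex.conj_I]
    ring
  -- The resolvent identity between i and -i, in this and the opposite order; comparing the two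
  -- shows that R and S commute.
  have hRS : ∀ y, S y - R y = (2 * Complex.I) • R (S y) := fun y => by
    obtain ⟨hy, e⟩ := hS1 y
    have := hR2 ⟨S y, hy⟩
    rw [e, map_add, map_add, map_smul] at this
    change R y + Complex.I • R (S y) + Complex.I • R (S y) = S y at this
    rw [add_assoc, ← add_smul, ← two_mul] at this
    exact sub_eq_of_eq_add' this.symm
  have hSR : ∀ y, S y - R y = (2 * Complex.I) • S (R y) := fun y => by
    obtain ⟨hy, e⟩ := hR1 y
    have := hS2 ⟨R y, hy⟩
    rw [e, map_sub, map_sub, map_smul] at this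
    change S y - Complex.I • S (R y) - Complex.I • S (R y) = R y at this
    rw [sub_sub, ← add_smul, ← two_mul] at this
    rw [sub_eq_iff_eq_add] at this ⊢
    rw [this, add_comm]
  have h2I : (2 * Complex.I) ≠ 0 := by simp
  have hcomm : ∀ y, R (S y) = S (R y) := fun y =>
    smul_right_injective H h2I ((hRS y).symm.trans (hSR y))
  set K : H →L[ℂ] H := S * R with hK
  have hKc : IsCompactOperator K := hRc.clm_comp S
  have hKs : (K : H →ₗ[ℂ] H).IsSymmetric := fun x y => by
    change ⟪S (R x), y⟫_ℂ = ⟪x, S (R y)⟫_ℂ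
    rw [hS, ContinuousLinearMap.adjoint_inner_left, ContinuousLinearMap.adjoint_inner_right]
  have hRinj : ∀ x, R x = 0 → x = 0 := fun x hx => by
    obtain ⟨hy, e⟩ := hR1 x
    have e2 : (⟨R x, hy⟩ : D) = 0 := Subtype.ext hx
    rw [e2, map_zero, hx, smul_zero, sub_zero] at e
    exact e.symm
  set G : ℝ → Submodule ℂ H := fun r => eigenspace (op T) r with hG
  have hGR : ∀ r, ∀ v ∈ G r, ((r : ℂ) + Complex.I) • R v = v := fun r v hv => by
    obtain ⟨hv, e⟩ := mem_eigenspace_iff.mp hv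
    have := hR2 ⟨v, hv⟩
    rwa [e, ← add_smul, map_smul] at this
  have hGS : ∀ r, ∀ v ∈ G r, ((r : ℂ) - Complex.I) • S v = v := fun r v hv => by
    obtain ⟨hv, e⟩ := mem_eigenspace_iff.mp hv
    have := hS2 ⟨v, hv⟩
    rwa [e, ← sub_smul, map_smul] at this
  have hp : ∀ r : ℝ, (r : ℂ) + Complex.I ≠ 0 := fun r h => by
    simpa using congrArg Complex.im h
  have hm : ∀ r : ℝ, (r : ℂ) - Complex.I ≠ 0 := fun r h => by
    simpa using congrArg Complex.im h
  have hfin : ∀ r, FiniteDimensional ℂ (G r) := fun r => by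
    have h1 := ContinuousLinearMap.finite_dimensional_eigenspace hKc
      (((r : ℂ) - Complex.I) * ((r : ℂ) + Complex.I))⁻¹ (inv_ne_zero (mul_ne_zero (hm r) (hp r)))
    refine Submodule.finiteDimensional_of_le (S₂ := Module.End.eigenspace (K : H →ₗ[ℂ] H)
      (((r : ℂ) - Complex.I) * ((r : ℂ) + Complex.I))⁻¹) fun v hv => ?_
    rw [Module.End.mem_eigenspace_iff, eq_inv_smul_iff₀ (mul_ne_zero (hm r) (hp r)), mul_smul]
    change ((r : ℂ) - Complex.I) • ((r : ℂ) + Complex.I) • S (R v) = v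
    rw [← map_smul, hGR r v hv, hGS r v hv]
  have hreal : ∀ r : ℝ, ∀ v (hv : v ∈ G r), ∀ x : D, ⟪v, T x⟫_ℂ = r * ⟪v, (x : H)⟫_ℂ := by
    intro r v hv x
    obtain ⟨hv, e⟩ := mem_eigenspace_iff.mp hv
    rw [← inner_apply_of_isSelfAdjoint h ⟨v, hv⟩ x, e, inner_smul_left, Complex.conj_ofReal]
  have horth : OrthogonalFamily ℂ (fun r => G r) fun r => (G r).subtypeₗᵢ := by
    rintro r r' hrr ⟨v, hv⟩ ⟨w, hw⟩
    change ⟪v, w⟫_ℂ = 0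
    obtain ⟨hw', e⟩ := mem_eigenspace_iff.mp hw
    have := hreal r v hv ⟨w, hw'⟩
    rw [e, inner_smul_right, ← sub_eq_zero, ← sub_mul] at this
    refine (mul_eq_zero.mp this).resolve_left (sub_ne_zero.mpr ?_)
    exact_mod_cast hrr.symm
  -- the eigenvectors span a dense subspace
  have hdense : ∀ x : H, (∀ r, ∀ v ∈ G r, ⟪v, x⟫_ℂ = 0) → x = 0 := by
    intro x hx
    have hb := ContinuousLinearMap.orthogonalComplement_iSup_eigenspaces_eq_bot hKc hKs
    rw [← Submodule.mem_bot ℂ, ← hb, ← Submodule.iInf_orthogonal, Submodule.mem_iInf]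
    intro κ
    rw [Submodule.mem_orthogonal]
    intro u hu
    by_cases hκ : κ = 0
    · rw [hκ, Module.End.mem_eigenspace_iff, zero_smul] at hu
      have : R u = 0 := by
        rw [← inner_self_eq_zero (𝕜 := ℂ), ← ContinuousLinearMap.adjoint_inner_left]
        change ⟪K u, u⟫_ℂ = 0
        have hu' : K u = 0 := hu
        rw [hu', inner_zero_left]
      rw [hRinj u this, inner_zero_left]
    have hEf := ContinuousLinearMap.finite_dimensional_eigenspace hKc κ hκ
    set E := Module.End.eigenspace (K : H →ₗ[ℂ] H) κ with hE
    set X : H →ₗ[ℂ] H := ((R + S : H →L[ℂ] H) : H →ₗ[ℂ] H) with hX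
    have hXs : X.IsSymmetric := fun x y => by
      change ⟪R x + S x, y⟫_ℂ = ⟪x, R y + S y⟫_ℂ
      rw [inner_add_left, inner_add_right, hS, ContinuousLinearMap.adjoint_inner_left,
        ContinuousLinearMap.adjoint_inner_right]
      ring
    have hXE : ∀ v ∈ E, X v ∈ E := fun v hv => by
      rw [hE, Module.End.mem_eigenspace_iff] at hv ⊢
      have hv : S (R v) = κ • v := hv
      change S (R (R v + S v)) = κ • (R v + S v)
      rw [map_add, map_add, hcomm v, ← hcomm (R v), hv, map_smul, map_smul, smul_add]
    have hXs' : (X.restrict hXE).IsSymmetric := hXs.restrict_invariant hXE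
    set b := hXs'.eigenvectorBasis rfl with hbdef
    have hbi : ∀ i, ⟪((b i : E) : H), x⟫_ℂ = 0 := by
      intro i
      set v : H := ((b i : E) : H) with hv
      have hvK : S (R v) = κ • v := Module.End.mem_eigenspace_iff.mp (b i).2
      have hv0 : v ≠ 0 := fun h0 => b.toBasis.ne_zero i (by
        rw [OrthonormalBasis.coe_toBasis]; exact Subtype.ext h0)
      obtain ⟨ξ, hξ⟩ : ∃ ξ : ℂ, R v + S v = ξ • v :=
        ⟨_, congrArg Subtype.val (hXs'.apply_eigenvectorBasis rfl i)⟩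
      -- Solve (R+S)v = ξv and (S-R)v = 2iκv for Rv.
      have hRv : R v = ((ξ - 2 * Complex.I * κ) / 2) • v := by
        have h1 := hSR v
        rw [hvK, smul_smul] at h1
        have h2 : (2 : ℂ) • R v = (ξ - 2 * Complex.I * κ) • v := by
          rw [sub_smul, ← hξ, ← h1, two_smul]; abel
        rw [div_eq_inv_mul, mul_smul, ← h2, smul_smul]
        norm_num
      set ρ := (ξ - 2 * Complex.I * κ) / 2
      have hρ : ρ ≠ 0 := fun h0 => hv0 (hRinj v (by rw [hRv, h0, zero_smul]))
      have hvR : v = R (ρ⁻¹ • v) := by rw [map_smul, hRv, smul_smul, inv_mul_cancel₀ hρ, one_smul]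
      obtain ⟨hD, e⟩ := hR1 (ρ⁻¹ • v)
      have hvD : v ∈ D := hvR ▸ hD
      have e1 : T ⟨v, hvD⟩ = (ρ⁻¹ - Complex.I) • v := by
        have : (⟨R (ρ⁻¹ • v), hD⟩ : D) = ⟨v, hvD⟩ := Subtype.ext hvR.symm
        rw [this, ← hvR] at e
        rw [e, sub_smul]
      -- From Rv = ρv with R = (T+i)^(-1) follows Tv = (ρ⁻¹ - i)v; symmetry of T makes this
      -- eigenvalue real, so x is orthogonal to v by assumption.
      set τ := ρ⁻¹ - Complex.I
      have e2 := inner_apply_of_isSelfAdjoint h ⟨v, hvD⟩ ⟨v, hvD⟩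
      rw [e1, inner_smul_left, inner_smul_right] at e2
      have e3 := mul_right_cancel₀ (inner_self_ne_zero.mpr hv0) e2
      obtain ⟨r, hr⟩ := Complex.conj_eq_iff_real.mp e3
      exact hx r v (mem_eigenspace_iff.mpr ⟨hvD, by rw [e1, hr]⟩)
    have hu2 := b.sum_repr ⟨u, hu⟩
    have hu3 : u = ∑ i, b.repr ⟨u, hu⟩ i • ((b i : E) : H) := by
      have := congrArg Subtype.val hu2
      simpa using this.symm
    rw [hu3, sum_inner]
    refine Finset.sum_eq_zero fun i _ => ?_
    rw [inner_smul_left, hbi i, mul_zero]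
  -- The basis is assembled from orthonormal bases of the finite-dimensional eigenspaces; its index
  -- records the eigenvalue as first component, which becomes μ.
  set e : ∀ r, OrthonormalBasis (Fin (Module.finrank ℂ (G r))) ℂ (G r) := fun r =>
    stdOrthonormalBasis ℂ (G r)
  set v : (Σ r : ℝ, Fin (Module.finrank ℂ (G r))) → H := fun q => ((e q.1 q.2 : G q.1) : H) with hv
  have hvo : Orthonormal ℂ v := horth.orthonormal_sigma_orthonormal fun r => (e r).orthonormal
  have hvb : (Submodule.span ℂ (Set.range v))ᗮ = ⊥ := by
    rw [eq_bot_iff]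
    intro x hx
    rw [Submodule.mem_orthogonal] at hx
    rw [Submodule.mem_bot]
    refine hdense x fun r w hw => ?_
    have hw2 := (e r).sum_repr ⟨w, hw⟩
    have hw3 : w = ∑ i, (e r).repr ⟨w, hw⟩ i • ((e r i : G r) : H) := by
      have := congrArg Subtype.val hw2
      simpa using this.symm
    refine hx w ?_
    rw [hw3]
    exact Submodule.sum_mem _ fun i _ => Submodule.smul_mem _ _
      (Submodule.subset_span ⟨⟨r, i⟩, rfl⟩)
  have hfv : ∀ i, HilbertBasis.mkOfOrthogonalEqBot hvo hvb i = v i := fun i => by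
    rw [HilbertBasis.coe_mkOfOrthogonalEqBot]
  refine ⟨_, HilbertBasis.mkOfOrthogonalEqBot hvo hvb, fun q => q.1, ?_, ?_, ?_⟩
  · intro i
    rw [hfv]
    exact (mem_eigenspace_iff.mp (e i.1 i.2).2).1
  · intro x i
    rw [hfv]
    exact hreal i.1 _ (e i.1 i.2).2 x
  · intro x y hxy
    -- If y has the coefficients that Tx would have, then R(y + ix) has the same coefficients as x,
    -- so x lies in the range of R, which is contained in D.
    obtain ⟨hu, eu⟩ := hR1 (y + Complex.I • x)
    suffices R (y + Complex.I • x) = x from this ▸ hu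
    refine hilbertBasis_ext (HilbertBasis.mkOfOrthogonalEqBot hvo hvb) fun i => ?_
    have h1 := hreal i.1 _ (e i.1 i.2).2 ⟨_, hu⟩
    have h2 := hxy i
    rw [hfv] at h2 ⊢
    change ⟪v i, _⟫_ℂ = _ * ⟪v i, _⟫_ℂ at h1
    rw [eu, inner_sub_right, inner_add_right, inner_smul_right, inner_smul_right, h2] at h1
    have h3 : ((i.1 : ℂ) + Complex.I) * ⟪v i, x⟫_ℂ
        = ((i.1 : ℂ) + Complex.I) * ⟪v i, R (y + Complex.I • x)⟫_ℂ := by linear_combination h1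
    exact (mul_left_cancel₀ (hp _) h3).symm

end EtaVar

namespace EtaVar

variable {H : Type*} [NormedAddCommGroup H] [InnerProductSpace ℂ H] [CompleteSpace H]

/-! ### Functions of a diagonalized operator -/

section Elementary

theorem ofReal_add_I_ne_zero (r : ℝ) : (r : ℂ) + Complex.I ≠ 0 := fun h => by
  simpa using congrArg Complex.im h

theorem norm_ofReal_add_I (r : ℝ) : ‖(r : ℂ) + Complex.I‖ = (1 + r ^ 2) ^ (1 / 2 : ℝ) := by
  rw [Complex.norm_def, ← Real.sqrt_eq_rpow, Complex.normSq_apply]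
  simp
  ring_nf

theorem one_le_norm_ofReal_add_I (r : ℝ) : 1 ≤ ‖(r : ℂ) + Complex.I‖ := by
  have := Complex.abs_im_le_norm ((r : ℂ) + Complex.I)
  simpa using this

theorem abs_le_norm_ofReal_add_I (r : ℝ) : |r| ≤ ‖(r : ℂ) + Complex.I‖ := by
  have := Complex.abs_re_le_norm ((r : ℂ) + Complex.I)
  simpa using this

/-- Apply y^k/k! ≤ e^y to y = t(1+x²). Polynomial growth in an eigenvalue is absorbed in this way by
part of the heat operator. -/
theorem pow_mul_exp_neg_le (k : ℕ) {t : ℝ} (ht : 0 < t) (x : ℝ) :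
    (1 + x ^ 2) ^ k * Real.exp (-t * x ^ 2) ≤ k.factorial * Real.exp t / t ^ k := by
  have h := Real.pow_div_factorial_le_exp (t * (1 + x ^ 2)) (by positivity) k
  rw [div_le_iff₀ (by positivity), mul_pow] at h
  rw [le_div_iff₀ (by positivity)]
  have e : Real.exp (t * (1 + x ^ 2)) * Real.exp (-t * x ^ 2) = Real.exp t := by
    rw [← Real.exp_add]; ring_nf
  have h2 := mul_le_mul_of_nonneg_right h (Real.exp_pos (-t * x ^ 2)).le
  calc _ = t ^ k * (1 + x ^ 2) ^ k * Real.exp (-t * x ^ 2) := by ring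
    _ ≤ _ := h2
    _ = (k.factorial : ℝ) * (Real.exp (t * (1 + x ^ 2)) * Real.exp (-t * x ^ 2)) := by ring
    _ = _ := by rw [e]

theorem isBdd_of_abs_le {ι : Type*} {g : ι → ℝ} {C : ℝ} (h : ∀ i, |g i| ≤ C) :
    IsBdd fun i => (g i : ℂ) := ⟨C, fun i => by simpa using h i⟩

theorem isBdd_pow_mul_exp {ι : Type*} (μ : ι → ℝ) (k : ℕ) {t : ℝ} (ht : 0 < t) :
    IsBdd fun i => (μ i : ℂ) ^ k * (Real.exp (-t * μ i ^ 2) : ℂ) := by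
  refine ⟨k.factorial * Real.exp t / t ^ k, fun i => ?_⟩
  refine le_trans ?_ (pow_mul_exp_neg_le k ht (μ i))
  rw [norm_mul, norm_pow, Complex.norm_real, Complex.norm_real, Real.norm_eq_abs, Real.norm_eq_abs,
    Real.abs_exp]
  refine mul_le_mul_of_nonneg_right (pow_le_pow_left₀ (abs_nonneg _) ?_ k) (Real.exp_pos _).le
  nlinarith [sq_nonneg (|μ i| - 1), sq_abs (μ i)]

theorem isBdd_exp {ι : Type*} (μ : ι → ℝ) {t : ℝ} (ht : 0 < t) :
    IsBdd fun i => (Real.exp (-t * μ i ^ 2) : ℂ) := by simpa using isBdd_pow_mul_exp μ 0 ht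

theorem isBdd_res {ι : Type*} (μ : ι → ℝ) : IsBdd fun i => ((μ i : ℂ) + Complex.I)⁻¹ :=
  ⟨1, fun i => by rw [norm_inv]; exact inv_le_one_of_one_le₀ (one_le_norm_ofReal_add_I _)⟩

theorem norm_mul_res_le (r : ℝ) : ‖(r : ℂ) * ((r : ℂ) + Complex.I)⁻¹‖ ≤ 1 := by
  rw [norm_mul, norm_inv, ← div_eq_mul_inv, Complex.norm_real,
    div_le_one (by linarith [one_le_norm_ofReal_add_I r])]
  exact abs_le_norm_ofReal_add_I r

theorem isBdd_mul_res {ι : Type*} (μ : ι → ℝ) :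
    IsBdd fun i => (μ i : ℂ) * ((μ i : ℂ) + Complex.I)⁻¹ := ⟨1, fun _ => norm_mul_res_le _⟩

theorem isBdd_sqRes {ι : Type*} (μ : ι → ℝ) {z : ℝ} (hz : 0 < z) :
    IsBdd fun i => (((μ i ^ 2 + z)⁻¹ : ℝ) : ℂ) := by
  refine isBdd_of_abs_le (C := z⁻¹) fun i => ?_
  rw [abs_of_pos (by positivity)]
  exact inv_anti₀ hz (by nlinarith [sq_nonneg (μ i)])

theorem isBdd_sq_mul_sqRes {ι : Type*} (μ : ι → ℝ) {z : ℝ} (hz : 0 < z) :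
    IsBdd fun i => (μ i : ℂ) * ((μ i : ℂ) * (((μ i ^ 2 + z)⁻¹ : ℝ) : ℂ)) := by
  refine ⟨1, fun i => ?_⟩
  dsimp only
  have : (μ i : ℂ) * ((μ i : ℂ) * (((μ i ^ 2 + z)⁻¹ : ℝ) : ℂ))
      = ((μ i ^ 2 / (μ i ^ 2 + z) : ℝ) : ℂ) := by push_cast; ring
  rw [this, Complex.norm_real, Real.norm_of_nonneg (by positivity), div_le_one (by positivity)]
  linarith

theorem abs_mul_sqRes_le (r : ℝ) {z : ℝ} (hz : 0 < z) :
    ‖(r : ℂ) * (((r ^ 2 + z)⁻¹ : ℝ) : ℂ)‖ ≤ 1 + z⁻¹ := by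
  rw [norm_mul, Complex.norm_real, Complex.norm_real, Real.norm_eq_abs,
    Real.norm_of_nonneg (by positivity)]
  have h1 : |r| ≤ 1 + r ^ 2 := by nlinarith [sq_nonneg (|r| - 1), sq_abs r]
  rw [mul_inv_le_iff₀ (by positivity)]
  have : (1 + z⁻¹) * (r ^ 2 + z) = r ^ 2 + z + z⁻¹ * r ^ 2 + 1 := by field_simp; ring
  rw [this]
  have : 0 ≤ z⁻¹ * r ^ 2 := by positivity
  linarith

theorem isBdd_mul_sqRes {ι : Type*} (μ : ι → ℝ) {z : ℝ} (hz : 0 < z) :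
    IsBdd fun i => (μ i : ℂ) * (((μ i ^ 2 + z)⁻¹ : ℝ) : ℂ) := ⟨_, fun _ => abs_mul_sqRes_le _ hz⟩

end Elementary

variable {D : Submodule ℂ H} {T B : D →ₗ[ℂ] H} {ι : Type*} {f : HilbertBasis ι ℂ H} {μ : ι → ℝ}

theorem app_op (T : D →ₗ[ℂ] H) {x : H} (h : x ∈ D) : app (op T) x = T ⟨x, h⟩ := dif_pos h

theorem app_op_coe (T : D →ₗ[ℂ] H) (x : D) : app (op T) (x : H) = T x := dif_pos x.2

theorem exists_comp (R : H →L[ℂ] H) (hR : ∀ x, R x ∈ D) (B : D →ₗ[ℂ] H) {C : ℝ} (hC : 0 ≤ C)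
    (hb : ∀ x, ‖B ⟨R x, hR x⟩‖ ≤ C * ‖x‖) :
    ∃ X : H →L[ℂ] H, (∀ x, X x = B ⟨R x, hR x⟩) ∧ ‖X‖ ≤ C := by
  let L : H →ₗ[ℂ] H := B ∘ₗ (R : H →ₗ[ℂ] H).codRestrict D hR
  exact ⟨L.mkContinuous C hb, fun x => rfl, L.mkContinuous_norm_le hC hb⟩

/-- `B` is bounded for the graph norm of `T`. -/
def RelBdd (T B : D →ₗ[ℂ] H) : Prop := ∃ C, 0 ≤ C ∧ ∀ x : D, ‖B x‖ ≤ C * (‖(x : H)‖ + ‖T x‖)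

theorem relBdd_self (T : D →ₗ[ℂ] H) : RelBdd T T :=
  ⟨1, zero_le_one, fun x => by linarith [norm_nonneg (x : H)]⟩

theorem isRelBounded_iff : IsRelBounded (op T) (op B) ↔ RelBdd T B := by
  constructor
  · rintro ⟨-, C, hC⟩
    refine ⟨max C 0, le_max_right _ _, fun x => ?_⟩
    have := hC x x.2
    rw [app_op_coe, app_op_coe] at this
    exact this.trans (mul_le_mul_of_nonneg_right (le_max_left _ _) (by positivity))
  · rintro ⟨C, -, hC⟩
    refine ⟨rfl, C, fun x hx => ?_⟩
    have := hC ⟨x, hx⟩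
    rwa [← app_op_coe, ← app_op_coe] at this

namespace IsEigenbasis

theorem apply_basis (hE : IsEigenbasis T f μ) (i : ι) : T ⟨f i, hE.mem i⟩ = (μ i : ℂ) • f i := by
  refine hilbertBasis_ext f fun j => ?_
  rw [hE.inner_apply, inner_smul_right]
  by_cases h : j = i
  · rw [h]
  · rw [inner_basis_ne h, mul_zero, mul_zero]

theorem inner_symm (hE : IsEigenbasis T f μ) (x y : D) : ⟪T x, (y : H)⟫_ℂ = ⟪(x : H), T y⟫_ℂ := by
  rw [← f.tsum_inner_mul_inner, ← f.tsum_inner_mul_inner]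
  congr 1
  ext i
  rw [← inner_conj_symm, hE.inner_apply, hE.inner_apply, map_mul, Complex.conj_ofReal,
    inner_conj_symm]
  ring

theorem dense (hE : IsEigenbasis T f μ) : Dense (D : Set H) := by
  have h := f.dense_span
  have h2 : Submodule.span ℂ (Set.range f) ≤ D := by
    rw [Submodule.span_le]; rintro _ ⟨i, rfl⟩; exact hE.mem i
  rw [Submodule.dense_iff_topologicalClosure_eq_top, eq_top_iff, ← h]
  exact Submodule.topologicalClosure_mono h2

theorem diag_mem (hE : IsEigenbasis T f μ) {g : ι → ℂ} (hg : IsBdd g) (hg' : IsBdd fun i => (μ i : ℂ) * g i) (x : H) :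
    diag f g x ∈ D := hE.mem_of_coeff _ (diag f (fun i => (μ i : ℂ) * g i) x) fun i => by
  rw [inner_diag hg, inner_diag hg', mul_assoc]

theorem apply_diag (hE : IsEigenbasis T f μ) {g : ι → ℂ} (hg : IsBdd g) (hg' : IsBdd fun i => (μ i : ℂ) * g i) (x : H)
    (h : diag f g x ∈ D) : T ⟨diag f g x, h⟩ = diag f (fun i => (μ i : ℂ) * g i) x :=
  hilbertBasis_ext f fun i => by
    rw [hE.inner_apply, inner_diag hg', inner_diag hg, mul_assoc]

theorem res_mem (hE : IsEigenbasis T f μ) (x : H) : diag f (fun i => ((μ i : ℂ) + Complex.I)⁻¹) x ∈ D :=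
  hE.diag_mem (isBdd_res μ) (isBdd_mul_res μ) x

theorem res_apply (hE : IsEigenbasis T f μ) (x : D) :
    diag f (fun i => ((μ i : ℂ) + Complex.I)⁻¹) (T x + Complex.I • (x : H)) = x :=
  hilbertBasis_ext f fun i => by
    rw [inner_diag (isBdd_res μ), inner_add_right, inner_smul_right, hE.inner_apply]
    field_simp [ofReal_add_I_ne_zero (μ i)]

theorem graphNorm_res_le (hE : IsEigenbasis T f μ) (x : H) : ‖diag f (fun i => ((μ i : ℂ) + Complex.I)⁻¹) x‖ +
    ‖T ⟨diag f (fun i => ((μ i : ℂ) + Complex.I)⁻¹) x, hE.res_mem x⟩‖ ≤ 2 * ‖x‖ := by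
  rw [hE.apply_diag (isBdd_res μ) (isBdd_mul_res μ)]
  have h1 := norm_diag_apply_le (f := f) (g := fun i => ((μ i : ℂ) + Complex.I)⁻¹) zero_le_one
    (fun i => by rw [norm_inv]; exact inv_le_one_of_one_le₀ (one_le_norm_ofReal_add_I _)) x
  have h2 := norm_diag_apply_le (f := f) zero_le_one (fun i => norm_mul_res_le (μ i)) x
  linarith

theorem resolvent_eq (hE : IsEigenbasis T f μ) {R : H →L[ℂ] H} (hR : IsResolventAt (op T) (-Complex.I) R) :
    R = diag f fun i => ((μ i : ℂ) + Complex.I)⁻¹ := by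
  ext y
  obtain ⟨hy, e⟩ := hR.1 y
  change T ⟨R y, hy⟩ - (-Complex.I) • R y = y at e
  rw [neg_smul, sub_neg_eq_add] at e
  have := hE.res_apply ⟨R y, hy⟩
  rw [e] at this
  exact this.symm

theorem isResolventAt (hE : IsEigenbasis T f μ) :
    IsResolventAt (op T) (-Complex.I) (diag f fun i => ((μ i : ℂ) + Complex.I)⁻¹) := by
  refine ⟨fun y => ⟨hE.res_mem y, ?_⟩, fun x => ?_⟩
  · change T ⟨_, hE.res_mem y⟩ - (-Complex.I) • _ = y
    refine hilbertBasis_ext f fun i => ?_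
    rw [neg_smul, sub_neg_eq_add, inner_add_right, inner_smul_right, hE.inner_apply,
      inner_diag (isBdd_res μ)]
    field_simp [ofReal_add_I_ne_zero (μ i)]
  · rw [neg_smul, sub_neg_eq_add]
    exact hE.res_apply x

/-- A relatively bounded operator composed with a regularizing function of `T` is bounded. -/
theorem exists_comp_diag (hE : IsEigenbasis T f μ) (hB : RelBdd T B) {g : ι → ℂ} (hg : IsBdd g)
    (hg' : IsBdd fun i => (μ i : ℂ) * g i) :
    ∃ X : H →L[ℂ] H, ∀ x, X x = B ⟨diag f g x, hE.diag_mem hg hg' x⟩ := by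
  obtain ⟨C, hC, hB⟩ := hB
  obtain ⟨X, hX, -⟩ := exists_comp (diag f g) (hE.diag_mem hg hg') B
    (C := C * (‖diag f g‖ + ‖diag f fun i => (μ i : ℂ) * g i‖)) (by positivity) fun x => by
      refine (hB _).trans ?_
      rw [hE.apply_diag hg hg', mul_assoc]
      refine mul_le_mul_of_nonneg_left ?_ hC
      rw [add_mul]
      exact add_le_add (ContinuousLinearMap.le_opNorm _ _) (ContinuousLinearMap.le_opNorm _ _)
  exact ⟨X, hX⟩

theorem sqRes_mem (hE : IsEigenbasis T f μ) {z : ℝ} (hz : 0 < z) (x : H) :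
    diag f (fun i => (((μ i ^ 2 + z)⁻¹ : ℝ) : ℂ)) x ∈ D :=
  hE.diag_mem (isBdd_sqRes μ hz) (isBdd_mul_sqRes μ hz) x

theorem apply_sqRes_mem (hE : IsEigenbasis T f μ) {z : ℝ} (hz : 0 < z) (x : H) :
    T ⟨diag f (fun i => (((μ i ^ 2 + z)⁻¹ : ℝ) : ℂ)) x, hE.sqRes_mem hz x⟩ ∈ D := by
  rw [hE.apply_diag (isBdd_sqRes μ hz) (isBdd_mul_sqRes μ hz)]
  exact hE.diag_mem (isBdd_mul_sqRes μ hz) (isBdd_sq_mul_sqRes μ hz) x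

theorem sq_isResolventAt (hE : IsEigenbasis T f μ) {z : ℝ} (hz : 0 < z) :
    IsResolventAt (sq (op T)) (-(z : ℂ)) (diag f fun i => (((μ i ^ 2 + z)⁻¹ : ℝ) : ℂ)) := by
  have hne : ∀ i, (μ i : ℂ) ^ 2 + z ≠ 0 := fun i => by
    have : μ i ^ 2 + z ≠ 0 := by positivity
    exact_mod_cast this
  refine ⟨fun y => ⟨⟨⟨_, hE.sqRes_mem hz y⟩, hE.apply_sqRes_mem hz y, rfl⟩, ?_⟩, ?_⟩
  · change T ⟨T ⟨_, hE.sqRes_mem hz y⟩, hE.apply_sqRes_mem hz y⟩ - (-(z : ℂ)) • _ = y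
    refine hilbertBasis_ext f fun i => ?_
    rw [neg_smul, sub_neg_eq_add, inner_add_right, inner_smul_right, hE.inner_apply,
      hE.inner_apply, inner_diag (isBdd_sqRes μ hz)]
    push_cast
    have := hne i
    field_simp
  · rintro ⟨_, (x : D), (hx : T x ∈ D), rfl⟩
    change diag f _ (T ⟨T x, hx⟩ - (-(z : ℂ)) • (x : H)) = x
    refine hilbertBasis_ext f fun i => ?_
    rw [neg_smul, sub_neg_eq_add, inner_diag (isBdd_sqRes μ hz), inner_add_right,
      inner_smul_right, hE.inner_apply, hE.inner_apply]
    push_cast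
    have := hne i
    field_simp

/-! ### Spectral projections, the heat operator, and `Ã⁻²` -/

theorem eigenproj_eq (hE : IsEigenbasis T f μ) (r : ℝ) (x : H) :
    eigenproj (op T) r x = diag f (fun i => if μ i = r then 1 else 0) x := by
  have hb : IsBdd fun i => if μ i = r then (1 : ℂ) else 0 :=
    ⟨1, fun i => by dsimp only; split_ifs <;> simp⟩
  have hb' : IsBdd fun i => (μ i : ℂ) * if μ i = r then (1 : ℂ) else 0 :=
    ⟨|r|, fun i => by dsimp only; split_ifs with h <;> simp [h]⟩
  refine Submodule.eq_starProjection_of_mem_of_inner_eq_zero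
    (K := (eigenspace (op T) r).topologicalClosure) ?_ ?_
  · refine Submodule.le_topologicalClosure _ (mem_eigenspace_iff.mpr ⟨hE.diag_mem hb hb' x, ?_⟩)
    rw [hE.apply_diag hb hb']
    refine hilbertBasis_ext f fun i => ?_
    rw [inner_smul_right, inner_diag hb, inner_diag hb']
    split_ifs with h <;> simp [h]
  · intro w hw
    have h1 : ∀ w ∈ eigenspace (op T) r,
        ⟪x - diag f (fun i => if μ i = r then 1 else 0) x, w⟫_ℂ = 0 := by
      intro w hw
      obtain ⟨hw, e⟩ := mem_eigenspace_iff.mp hw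
      rw [← f.tsum_inner_mul_inner]
      have : (fun i => ⟪x - diag f (fun i => if μ i = r then 1 else 0) x, f i⟫_ℂ * ⟪f i, w⟫_ℂ)
          = fun _ => 0 := by
        ext i
        by_cases h : μ i = r
        · rw [← inner_conj_symm, inner_sub_right, inner_diag hb]
          simp [h]
        · have h2 := hE.inner_apply ⟨w, hw⟩ i
          rw [e, inner_smul_right, ← sub_eq_zero, ← sub_mul] at h2
          have h3 : ((r : ℂ) - μ i) ≠ 0 := sub_ne_zero.mpr (by exact_mod_cast Ne.symm h)
          rw [(mul_eq_zero.mp h2).resolve_left h3, mul_zero]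
      rw [this, tsum_zero]
    exact (Submodule.mem_orthogonal' _ _).mp
      ((Submodule.orthogonal_closure (eigenspace (op T) r)).symm ▸
        (Submodule.mem_orthogonal' _ _).mpr h1) w hw

/-- The definition sums spectral projections over all real r; regrouping the expansion in the
eigenbasis along the fibres of μ gives the same vector. -/
theorem heat_eq (hE : IsEigenbasis T f μ) {t : ℝ} (ht : 0 < t) (x : H) :
    heat (op T) t x = diag f (fun i => (Real.exp (-t * μ i ^ 2) : ℂ)) x := by
  have h := (hasSum_diag (f := f) (isBdd_exp μ ht) x).tsum_fiberwise μ
  rw [heat, ← h.tsum_eq]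
  congr 1
  ext r
  have hb : IsBdd fun i => if μ i = r then (1 : ℂ) else 0 :=
    ⟨1, fun i => by dsimp only; split_ifs <;> simp⟩
  rw [hE.eigenproj_eq, ← (hasSum_diag (f := f) hb x).tsum_eq, ← tsum_const_smul'']
  rw [tsum_subtype (μ ⁻¹' {r}) fun i => ((Real.exp (-t * μ i ^ 2) : ℂ) * ⟪f i, x⟫_ℂ) • f i]
  congr 1
  ext i
  by_cases hi : μ i = r
  · rw [Set.indicator_of_mem (by exact hi)]
    simp [hi, smul_smul]
  · rw [Set.indicator_of_notMem (by exact hi)]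
    simp [hi]

end IsEigenbasis

end EtaVar

namespace EtaVar

/-! ### Mellin transforms of series -/

open MeasureTheory Set

/-- Summability of the L¹ norms justifies exchanging sum and integral. The alternative c_i = 0 is
for kernel indices, where the kernels used below are not integrable. -/
theorem hasSum_setIntegral_of_kernel {ι : Type*} [Countable ι] {φ : ι → ℝ → ℂ} {c : ι → ℂ}
    {G : ℝ → ℂ} (hφ : ∀ i, c i = 0 ∨ IntegrableOn (φ i) (Ioi 0))
    (hsum : Summable fun i => ‖c i‖ * ∫ t in Ioi (0 : ℝ), ‖φ i t‖)
    (hG : ∀ t ∈ Ioi (0 : ℝ), HasSum (fun i => c i * φ i t) (G t)) :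
    IntegrableOn G (Ioi 0) ∧
      HasSum (fun i => c i * ∫ t in Ioi (0 : ℝ), φ i t) (∫ t in Ioi (0 : ℝ), G t) := by
  set F : ι → ℝ → ℂ := fun i t => c i * φ i t
  have hF : ∀ i, Integrable (F i) (volume.restrict (Ioi 0)) := fun i => by
    rcases hφ i with h | h
    · simp [F, h]
    · exact h.const_mul _
  have hFs : Summable fun i => ∫ t in Ioi (0 : ℝ), ‖F i t‖ := by
    simpa [F, norm_mul, integral_const_mul] using hsum
  have hae : ∀ᵐ t ∂(volume.restrict (Ioi (0 : ℝ))), HasSum (fun i => F i t) (G t) := by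
    filter_upwards [ae_restrict_mem measurableSet_Ioi] with t ht using hG t ht
  constructor
  · have hm : AEStronglyMeasurable G (volume.restrict (Ioi 0)) :=
      aestronglyMeasurable_of_tendsto_ae (Filter.atTop : Filter (Finset ι))
        (f := fun s t => ∑ i ∈ s, F i t)
        (fun s => Finset.aestronglyMeasurable_fun_sum s fun i _ => (hF i).1) hae
    refine ⟨hm, ?_⟩
    have h1 : ∫⁻ t in Ioi (0 : ℝ), ‖G t‖ₑ ≤ ∫⁻ t in Ioi (0 : ℝ), ∑' i, ‖F i t‖ₑ := by
      refine lintegral_mono_ae ?_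
      filter_upwards [hae] with t ht
      rw [← ht.tsum_eq]
      exact enorm_tsum_le_tsum_enorm
    refine h1.trans_lt ?_
    rw [lintegral_tsum fun i => (hF i).1.enorm]
    have h2 : ∀ i, ∫⁻ t in Ioi (0 : ℝ), ‖F i t‖ₑ = ENNReal.ofReal (∫ t in Ioi (0 : ℝ), ‖F i t‖) :=
      fun i => by
        rw [ofReal_integral_norm_eq_lintegral_enorm (hF i)]
    simp_rw [h2]
    rw [← ENNReal.ofReal_tsum_of_nonneg (fun i => integral_nonneg fun _ => norm_nonneg _) hFs]
    exact ENNReal.ofReal_lt_top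
  · have h := hasSum_integral_of_summable_integral_norm hF hFs
    have e1 : ∫ t in Ioi (0 : ℝ), ∑' i, F i t = ∫ t in Ioi (0 : ℝ), G t :=
      integral_congr_ae (by filter_upwards [hae] with t ht using ht.tsum_eq)
    rw [e1] at h
    simpa [F, integral_const_mul] using h

/-! #### The exponential kernel -/

theorem integrableOn_cpow_mul_exp {q : ℂ} (hq : 0 < q.re) {x : ℝ} (hx : 0 < x) :
    IntegrableOn (fun t : ℝ => (t : ℂ) ^ (q - 1) * (Real.exp (-t * x) : ℂ)) (Ioi 0) := by
  have := Complex.GammaIntegral_convergent hq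
  rw [← mul_zero x, ← integrableOn_Ioi_comp_mul_left_iff _ _ hx] at this
  refine IntegrableOn.congr_fun (this.const_mul (1 / (x : ℂ) ^ (q - 1)))
      (fun t (ht : 0 < t) => ?_) measurableSet_Ioi
  have e : -t * x = -(x * t) := by ring
  rw [e]
  simp_rw [mul_comm (↑(Real.exp _) : ℂ), ← mul_assoc, Complex.ofReal_mul]
  rw [Complex.mul_cpow_ofReal_nonneg hx.le ht.le, ← mul_assoc, one_div, inv_mul_cancel₀, one_mul]
  rw [Ne, Complex.cpow_eq_zero_iff, not_and_or]
  exact Or.inl (Complex.ofReal_ne_zero.mpr hx.ne')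

theorem integral_cpow_mul_exp {q : ℂ} (hq : 0 < q.re) {x : ℝ} (hx : 0 < x) :
    ∫ t in Ioi (0 : ℝ), (t : ℂ) ^ (q - 1) * (Real.exp (-t * x) : ℂ)
      = Complex.Gamma q / (x : ℂ) ^ q := by
  have h := Complex.integral_cpow_mul_exp_neg_mul_Ioi (r := x) hq (by simpa using hx)
  have e : ∀ t : ℝ, (Real.exp (-t * x) : ℂ) = Complex.exp (-(x : ℂ) * t) := fun t => by
    push_cast; ring_nf
  simp_rw [e]
  simp_rw [neg_mul]
  rw [h, one_div, Complex.inv_cpow _ _ (by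
    rw [Complex.arg_ofReal_of_nonneg hx.le]; exact Real.pi_pos.ne), div_eq_inv_mul]

theorem integral_norm_cpow_mul_exp {q : ℂ} (hq : 0 < q.re) {x : ℝ} (hx : 0 < x) :
    ∫ t in Ioi (0 : ℝ), ‖(t : ℂ) ^ (q - 1) * (Real.exp (-t * x) : ℂ)‖
      = Real.Gamma q.re / x ^ q.re := by
  have h := Real.integral_rpow_mul_exp_neg_mul_Ioi hq hx
  rw [one_div, Real.inv_rpow hx.le, mul_comm, ← div_eq_mul_inv] at h
  rw [← h]
  refine setIntegral_congr_fun measurableSet_Ioi fun t ht => ?_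
  rw [norm_mul, Complex.norm_real, Real.norm_eq_abs, Real.abs_exp,
    Complex.norm_cpow_eq_rpow_re_of_pos ht, Complex.sub_re, Complex.one_re]
  ring_nf

/-- Termwise, the Mellin transform of e^(-tμ²) is Γ(q)(μ²)^(-q) with q = (s+1)/2, and Γ(q) cancels
the normalization. Terms with μ_i = 0 have to be excluded. -/
theorem hasSum_etaMellin {ι : Type*} [Countable ι] {c : ι → ℂ} {μ : ι → ℝ} {F : ℝ → ℂ} {s : ℂ}
    (hs : 0 < s.re + 1) (hc : ∀ i, c i = 0 ∨ μ i ≠ 0)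
    (hF : ∀ t, 0 < t → HasSum (fun i => c i * (Real.exp (-t * μ i ^ 2) : ℂ)) (F t))
    (hsum : Summable fun i => ‖c i‖ / (μ i ^ 2) ^ ((s.re + 1) / 2)) :
    EtaMellinConvergent F s ∧
      HasSum (fun i => c i / ((μ i ^ 2 : ℝ) : ℂ) ^ ((s + 1) / 2)) (etaMellin F s) := by
  have hq : 0 < ((s + 1) / 2).re := by simp; linarith
  have hre : ((s + 1) / 2).re = (s.re + 1) / 2 := by simp
  have he : (s - 1) / 2 = (s + 1) / 2 - 1 := by ring
  have hpos : ∀ i, c i ≠ 0 → 0 < μ i ^ 2 := fun i hi => by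
    have := (hc i).resolve_left hi
    positivity
  have h := hasSum_setIntegral_of_kernel (c := c)
    (φ := fun i t => (t : ℂ) ^ ((s + 1) / 2 - 1) * (Real.exp (-t * μ i ^ 2) : ℂ))
    (G := fun t => (t : ℂ) ^ ((s + 1) / 2 - 1) * F t) (fun i => ?_) ?_ fun t ht => ?_
  · rw [EtaMellinConvergent, etaMellin, he]
    refine ⟨h.1, ?_⟩
    have h2 := h.2.mul_left (1 / Complex.Gamma ((s + 1) / 2))
    convert! h2 using 1
    funext i
    by_cases hi : c i = 0
    · simp [hi]
    · rw [integral_cpow_mul_exp hq (hpos i hi)]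
      have := Complex.Gamma_ne_zero_of_re_pos hq
      field_simp
  · by_cases hi : c i = 0
    · exact Or.inl hi
    · exact Or.inr (integrableOn_cpow_mul_exp hq (hpos i hi))
  · refine (hsum.mul_left (Real.Gamma ((s.re + 1) / 2))).congr fun i => ?_
    by_cases hi : c i = 0
    · simp [hi]
    · rw [integral_norm_cpow_mul_exp hq (hpos i hi), hre]
      ring
  · have := (hF t ht).mul_left ((t : ℂ) ^ ((s + 1) / 2 - 1))
    convert! this using 1
    funext i
    ring

/-! #### The kernel of the resolvent powers -/

theorem image_div_one_sub {x : ℝ} (hx : 0 < x) :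
    (fun u : ℝ => x * u / (1 - u)) '' Ioo 0 1 = Ioi 0 := by
  ext z
  constructor
  · rintro ⟨u, ⟨h0, h1⟩, rfl⟩
    exact div_pos (mul_pos hx h0) (by linarith)
  · intro (hz : 0 < z)
    refine ⟨z / (x + z), ⟨by positivity, (div_lt_one (by positivity)).mpr (by linarith)⟩, ?_⟩
    have : 1 - z / (x + z) = x / (x + z) := by field_simp; ring
    dsimp only
    rw [this]
    field_simp

theorem injOn_div_one_sub {x : ℝ} (hx : 0 < x) :
    InjOn (fun u : ℝ => x * u / (1 - u)) (Ioo 0 1) := by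
  rintro u ⟨-, hu⟩ v ⟨-, hv⟩ h
  have h1 : (1 - u) ≠ 0 := by linarith
  have h2 : (1 - v) ≠ 0 := by linarith
  dsimp only at h
  rw [div_eq_div_iff h1 h2] at h
  have : x * (u - v) = 0 := by linarith
  rcases mul_eq_zero.mp this with h | h
  · exact absurd h hx.ne'
  · linarith

theorem hasDerivAt_div_one_sub (x : ℝ) {u : ℝ} (hu : u < 1) :
    HasDerivAt (fun u : ℝ => x * u / (1 - u)) (x / (1 - u) ^ 2) u := by
  have h1 : (1 - u) ≠ 0 := by linarith
  have h := ((hasDerivAt_id u).const_mul x).div ((hasDerivAt_id u).const_sub 1) h1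
  convert! h using 1
  change x / (1 - u) ^ 2 = (x * 1 * (1 - u) - x * u * (-1)) / (1 - u) ^ 2
  ring

/-- Pullback under z = xu/(1-u): then x+z = x/(1-u) and dz = x/(1-u)² du, which turns the resolvent
kernel into the integrand of the beta function. -/
theorem cpow_mul_pow_comp {k : ℕ} {q : ℂ} {x : ℝ} (hx : 0 < x) {u : ℝ} (hu : u ∈ Ioo (0 : ℝ) 1) :
    |x / (1 - u) ^ 2| • (((x * u / (1 - u) : ℝ) : ℂ) ^ ((k : ℂ) - 1 - q) *
        ((((x + x * u / (1 - u))⁻¹) ^ k : ℝ) : ℂ))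
      = ((x : ℂ) ^ q)⁻¹ * ((u : ℂ) ^ ((k : ℂ) - q - 1) * (1 - (u : ℂ)) ^ (q - 1)) := by
  obtain ⟨h0, h1⟩ := hu
  have hv : 0 < 1 - u := by linarith
  have e1 : x + x * u / (1 - u) = x * (1 - u)⁻¹ := by field_simp; ring
  have hxc : (x : ℂ) ≠ 0 := by exact_mod_cast hx.ne'
  have hvc : ((1 - u : ℝ) : ℂ) ≠ 0 := by exact_mod_cast hv.ne'
  have e2 : (1 - (u : ℂ)) = ((1 - u : ℝ) : ℂ) := by push_cast; ring
  rw [abs_of_pos (by positivity), e1, e2, Complex.real_smul]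
  have e3 : ((x * u / (1 - u) : ℝ) : ℂ) = (x : ℂ) * ((u : ℂ) * (((1 - u)⁻¹ : ℝ) : ℂ)) := by
    push_cast; ring
  rw [e3, ← Complex.ofReal_mul, Complex.mul_cpow_ofReal_nonneg hx.le (by positivity),
    Complex.ofReal_mul, Complex.mul_cpow_ofReal_nonneg h0.le (by positivity), Complex.ofReal_inv,
    Complex.inv_cpow _ _ (by rw [Complex.arg_ofReal_of_nonneg hv.le]; exact Real.pi_pos.ne)]
  have e4 : (x : ℂ) ^ ((k : ℂ) - 1 - q) = (x : ℂ) ^ k * (x : ℂ)⁻¹ * ((x : ℂ) ^ q)⁻¹ := by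
    rw [Complex.cpow_sub _ _ hxc, Complex.cpow_sub _ _ hxc, Complex.cpow_natCast, Complex.cpow_one]
    rfl
  have e5 : ((1 - u : ℝ) : ℂ) ^ ((k : ℂ) - 1 - q)
      = ((1 - u : ℝ) : ℂ) ^ k * ((1 - u : ℝ) : ℂ)⁻¹ * (((1 - u : ℝ) : ℂ) ^ q)⁻¹ := by
    rw [Complex.cpow_sub _ _ hvc, Complex.cpow_sub _ _ hvc, Complex.cpow_natCast, Complex.cpow_one]
    rfl
  have e6 : ((1 - u : ℝ) : ℂ) ^ (q - 1) = ((1 - u : ℝ) : ℂ) ^ q * ((1 - u : ℝ) : ℂ)⁻¹ := by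
    rw [Complex.cpow_sub _ _ hvc, Complex.cpow_one]
    rfl
  have e7 : (k : ℂ) - 1 - q = k - q - 1 := by ring
  rw [e4, e5, e6, e7]
  have hxq : (x : ℂ) ^ q ≠ 0 := by simp [Complex.cpow_eq_zero_iff, hxc]
  have hvq : ((1 - u : ℝ) : ℂ) ^ q ≠ 0 := by rw [Ne, Complex.cpow_eq_zero_iff]; tauto
  push_cast at *
  field_simp
  rw [div_pow]
  field_simp

/-- `∫₀^∞ z^{k-1-q} (x + z)^{-k} dz = x^{-q} Β(k - q, q)`. -/
theorem integral_cpow_mul_inv_pow {k : ℕ} {q : ℂ} (hq : 0 < q.re) (hk : q.re < k) {x : ℝ}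
    (hx : 0 < x) :
    IntegrableOn (fun z : ℝ => (z : ℂ) ^ ((k : ℂ) - 1 - q) * ((((x + z)⁻¹) ^ k : ℝ) : ℂ)) (Ioi 0) ∧
    ∫ z in Ioi (0 : ℝ), (z : ℂ) ^ ((k : ℂ) - 1 - q) * ((((x + z)⁻¹) ^ k : ℝ) : ℂ)
      = ((x : ℂ) ^ q)⁻¹ * Complex.betaIntegral (k - q) q := by
  have hd : ∀ u ∈ Ioo (0 : ℝ) 1, HasDerivWithinAt (fun u : ℝ => x * u / (1 - u))
      (x / (1 - u) ^ 2) (Ioo 0 1) u := fun u hu => (hasDerivAt_div_one_sub x hu.2).hasDerivWithinAt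
  have hkq : 0 < ((k : ℂ) - q).re := by simpa using hk
  constructor
  · rw [← image_div_one_sub hx, integrableOn_image_iff_integrableOn_abs_deriv_smul
      measurableSet_Ioo hd (injOn_div_one_sub hx)]
    refine IntegrableOn.congr_fun ?_ (fun u hu => (cpow_mul_pow_comp hx hu).symm) measurableSet_Ioo
    have h := Complex.betaIntegral_convergent hkq hq
    rw [intervalIntegrable_iff_integrableOn_Ioo_of_le zero_le_one] at h
    exact h.const_mul _
  · conv_lhs => rw [← image_div_one_sub hx]
    rw [integral_image_eq_integral_abs_deriv_smul measurableSet_Ioo hd (injOn_div_one_sub hx),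
      setIntegral_congr_fun measurableSet_Ioo fun u hu => cpow_mul_pow_comp hx hu,
      integral_const_mul, Complex.betaIntegral, intervalIntegral.integral_of_le zero_le_one,
      integral_Ioc_eq_integral_Ioo]

/-- The Dirichlet series of the heat traces is recovered from resolvent powers, up to a beta factor
independent of i. This second representation is the one that is differentiated in the parameter. -/
theorem hasSum_integral_resolvent {ι : Type*} [Countable ι] {c : ι → ℂ} {μ : ι → ℝ} {F : ℝ → ℂ}
    {k : ℕ} {q : ℂ} (hq : 0 < q.re) (hk : q.re < k) (hc : ∀ i, c i = 0 ∨ μ i ≠ 0)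
    (hF : ∀ z, 0 < z → HasSum (fun i => c i * ((((μ i ^ 2 + z)⁻¹) ^ k : ℝ) : ℂ)) (F z))
    (hsum : Summable fun i => ‖c i‖ / (μ i ^ 2) ^ q.re) :
    IntegrableOn (fun z : ℝ => (z : ℂ) ^ ((k : ℂ) - 1 - q) * F z) (Ioi 0) ∧
      HasSum (fun i => Complex.betaIntegral (k - q) q * (c i / ((μ i ^ 2 : ℝ) : ℂ) ^ q))
        (∫ z in Ioi (0 : ℝ), (z : ℂ) ^ ((k : ℂ) - 1 - q) * F z) := by
  have hpos : ∀ i, c i ≠ 0 → 0 < μ i ^ 2 := fun i hi => by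
    have := (hc i).resolve_left hi
    positivity
  have h := hasSum_setIntegral_of_kernel (c := c)
    (φ := fun i z => (z : ℂ) ^ ((k : ℂ) - 1 - q) * ((((μ i ^ 2 + z)⁻¹) ^ k : ℝ) : ℂ))
    (G := fun z => (z : ℂ) ^ ((k : ℂ) - 1 - q) * F z) (fun i => ?_) ?_ fun z hz => ?_
  · refine ⟨h.1, ?_⟩
    convert! h.2 using 1
    funext i
    by_cases hi : c i = 0
    · simp [hi]
    · rw [(integral_cpow_mul_inv_pow hq hk (hpos i hi)).2]
      ring
  · by_cases hi : c i = 0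
    · exact Or.inl hi
    · exact Or.inr (integral_cpow_mul_inv_pow hq hk (hpos i hi)).1
  -- The modulus of the kernel is the kernel with q replaced by its real part, so the exact integral
  -- formula also evaluates the L¹ norm.
  · have hn : ∀ x : ℝ, 0 < x →
        ∫ z in Ioi (0 : ℝ), ‖(z : ℂ) ^ ((k : ℂ) - 1 - q) * ((((x + z)⁻¹) ^ k : ℝ) : ℂ)‖
          = (x ^ q.re)⁻¹ * ‖Complex.betaIntegral (k - q.re) q.re‖ := by
      intro x hx
      have h1 := (integral_cpow_mul_inv_pow (q := (q.re : ℂ)) (k := k) (by simpa using hq)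
        (by simpa using hk) hx).2
      have h2 : ∫ z in Ioi (0 : ℝ), (z : ℂ) ^ ((k : ℂ) - 1 - (q.re : ℂ)) *
          ((((x + z)⁻¹) ^ k : ℝ) : ℂ) = ∫ z in Ioi (0 : ℝ),
          ((‖(z : ℂ) ^ ((k : ℂ) - 1 - q) * ((((x + z)⁻¹) ^ k : ℝ) : ℂ)‖ : ℝ) : ℂ) := by
        refine setIntegral_congr_fun measurableSet_Ioi fun z (hz : 0 < z) => ?_
        rw [norm_mul, Complex.norm_cpow_eq_rpow_re_of_pos hz, Complex.norm_real,
          Real.norm_of_nonneg (by positivity), Complex.ofReal_mul, Complex.ofReal_cpow hz.le]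
        simp
      rw [h2, integral_complex_ofReal] at h1
      have h3 := congrArg norm h1
      rw [norm_mul, norm_inv, Complex.norm_cpow_eq_rpow_re_of_pos hx, Complex.norm_real,
        Real.norm_of_nonneg (integral_nonneg fun _ => norm_nonneg _), Complex.ofReal_re] at h3
      exact h3
    refine (hsum.mul_right ‖Complex.betaIntegral (k - q.re) q.re‖).congr fun i => ?_
    by_cases hi : c i = 0
    · simp [hi]
    · rw [hn _ (hpos i hi)]
      ring
  · have := (hF z hz).mul_left ((z : ℂ) ^ ((k : ℂ) - 1 - q))
    convert! this using 1
    funext i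
    ring

end EtaVar

namespace EtaVar

variable {H : Type*} [NormedAddCommGroup H] [InnerProductSpace ℂ H] [CompleteSpace H]

/-! ### Summability over the spectrum -/

section Summability

variable {ι : Type*} {μ : ι → ℝ} {p δ : ℝ}

theorem countable_of_summable (hs : Summable fun i => (1 + μ i ^ 2) ^ (-(p / 2))) :
    Countable ι := by
  have h := hs.countable_support
  have e : Function.support (fun i => (1 + μ i ^ 2) ^ (-(p / 2))) = Set.univ := by
    ext i
    simp only [Function.mem_support, Set.mem_univ, iff_true]
    positivity
  rw [e] at h
  exact Set.countable_univ_iff.mp h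

theorem finite_abs_le_of_summable (hp : 0 < p)
    (hs : Summable fun i => (1 + μ i ^ 2) ^ (-(p / 2))) (r : ℝ) : {i | |μ i| ≤ r}.Finite := by
  have h := hs.tendsto_cofinite_zero.eventually
    (gt_mem_nhds (show (0 : ℝ) < (1 + r ^ 2) ^ (-(p / 2)) by positivity))
  rw [Filter.eventually_cofinite] at h
  refine h.subset fun i (hi : |μ i| ≤ r) => ?_
  simp only [not_lt, Set.mem_ofPred_eq]
  refine Real.rpow_le_rpow_of_nonpos (by positivity) ?_ (by linarith)
  have : μ i ^ 2 ≤ r ^ 2 := sq_le_sq' (by linarith [(abs_le.mp hi).1]) (abs_le.mp hi).2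
  linarith

/-- Only finitely many eigenvalues lie in [-1, 1]; take the smallest nonzero modulus among them, or
1 if there is none. -/
theorem exists_gap (hp : 0 < p) (hs : Summable fun i => (1 + μ i ^ 2) ^ (-(p / 2))) :
    ∃ δ : ℝ, 0 < δ ∧ ∀ i, μ i = 0 ∨ δ ≤ |μ i| := by
  classical
  have hf := finite_abs_le_of_summable hp hs 1
  set S := hf.toFinset.filter (fun i => μ i ≠ 0)
  by_cases hS : S.Nonempty
  · obtain ⟨j, hj, hm⟩ := S.exists_min_image (fun i => |μ i|) hS
    simp only [S, Finset.mem_filter, Set.Finite.mem_toFinset, Set.mem_ofPred_eq] at hj hm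
    refine ⟨|μ j|, abs_pos.mpr hj.2, fun i => ?_⟩
    by_cases h0 : μ i = 0
    · exact Or.inl h0
    · right
      by_cases h1 : |μ i| ≤ 1
      · exact hm i ⟨h1, h0⟩
      · linarith [hj.1]
  · refine ⟨1, one_pos, fun i => ?_⟩
    by_contra hc
    push Not at hc
    exact hS ⟨i, by simp [S, hc.1, hc.2.le]⟩

theorem summable_exp (hs : Summable fun i => (1 + μ i ^ 2) ^ (-(p / 2))) {t : ℝ} (ht : 0 < t) :
    Summable fun i => ‖(Real.exp (-t * μ i ^ 2) : ℂ)‖ := by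
  obtain ⟨k, hk⟩ := exists_nat_ge (p / 2)
  refine Summable.of_nonneg_of_le (fun i => norm_nonneg _) (fun i => ?_)
    (hs.mul_left (k.factorial * Real.exp t / t ^ k))
  rw [Complex.norm_real, Real.norm_eq_abs, Real.abs_exp]
  have h1 : (1 : ℝ) ≤ 1 + μ i ^ 2 := by nlinarith [sq_nonneg (μ i)]
  have h2 := pow_mul_exp_neg_le k ht (μ i)
  have h3 : (1 + μ i ^ 2) ^ (p / 2) ≤ (1 + μ i ^ 2) ^ k := by
    have := Real.rpow_le_rpow_of_exponent_le h1 hk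
    rwa [Real.rpow_natCast] at this
  rw [Real.rpow_neg (by positivity), ← div_eq_mul_inv, le_div_iff₀ (by positivity)]
  have := mul_le_mul_of_nonneg_right h3 (Real.exp_pos (-t * μ i ^ 2)).le
  linarith

theorem sqRes_pow_le {m : ℕ} (hm : p / 2 ≤ m) {z : ℝ} (hz : 0 < z) (x : ℝ) :
    ((x ^ 2 + z)⁻¹) ^ m ≤ (1 + z⁻¹) ^ m * (1 + x ^ 2) ^ (-(p / 2)) := by
  have h1 : (1 : ℝ) ≤ 1 + x ^ 2 := by nlinarith [sq_nonneg x]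
  have h2 : (1 + x ^ 2) ^ (p / 2) ≤ (1 + x ^ 2) ^ m := by
    have := Real.rpow_le_rpow_of_exponent_le h1 hm
    rwa [Real.rpow_natCast] at this
  have h3 : 1 + x ^ 2 ≤ (1 + z⁻¹) * (x ^ 2 + z) := by
    have : (1 + z⁻¹) * (x ^ 2 + z) = x ^ 2 + z + z⁻¹ * x ^ 2 + 1 := by field_simp; ring
    rw [this]
    have : 0 ≤ z⁻¹ * x ^ 2 := by positivity
    linarith
  rw [Real.rpow_neg (by positivity), ← div_eq_mul_inv, inv_pow, le_div_iff₀ (by positivity),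
    inv_mul_le_iff₀ (by positivity), mul_comm]
  refine h2.trans ?_
  rw [← mul_pow]
  exact pow_le_pow_left₀ (by positivity) h3 m

theorem summable_sqRes_pow (hs : Summable fun i => (1 + μ i ^ 2) ^ (-(p / 2))) {m : ℕ}
    (hm : p / 2 ≤ m) {z : ℝ} (hz : 0 < z) :
    Summable (fun i => ‖((((μ i ^ 2 + z)⁻¹) ^ m : ℝ) : ℂ)‖) ∧
      ∑' i, ‖((((μ i ^ 2 + z)⁻¹) ^ m : ℝ) : ℂ)‖
        ≤ (1 + z⁻¹) ^ m * ∑' i, (1 + μ i ^ 2) ^ (-(p / 2)) := by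
  have h : ∀ i, ‖((((μ i ^ 2 + z)⁻¹) ^ m : ℝ) : ℂ)‖
      ≤ (1 + z⁻¹) ^ m * (1 + μ i ^ 2) ^ (-(p / 2)) := fun i => by
    rw [Complex.norm_real, Real.norm_of_nonneg (by positivity)]
    exact sqRes_pow_le hm hz _
  have h1 := Summable.of_nonneg_of_le (fun i => norm_nonneg _) h (hs.mul_left _)
  refine ⟨h1, ?_⟩
  rw [← tsum_mul_left]
  exact h1.tsum_le_tsum h (hs.mul_left _)

theorem one_add_sq_le_of_gap (hδ : 0 < δ) {x : ℝ} (hx : δ ≤ |x|) :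
    1 + x ^ 2 ≤ (1 + (δ ^ 2)⁻¹) * x ^ 2 := by
  have h1 : δ ^ 2 ≤ x ^ 2 := by rw [← sq_abs x]; exact pow_le_pow_left₀ hδ.le hx 2
  have h2 : 1 ≤ (δ ^ 2)⁻¹ * x ^ 2 := by
    rw [inv_mul_eq_div, le_div_iff₀ (by positivity)]; linarith
  linarith

/-- Away from 0 the gap makes μ² comparable to 1+μ². A coefficient of growth exponent r then needs
p/2 + r powers of 1+μ² for summability. -/
theorem summable_div_rpow (hs : Summable fun i => (1 + μ i ^ 2) ^ (-(p / 2))) (hδ : 0 < δ)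
    (hgap : ∀ i, μ i = 0 ∨ δ ≤ |μ i|) {c : ι → ℂ} (hc : ∀ i, c i = 0 ∨ μ i ≠ 0) {C r q : ℝ}
    (hC : ∀ i, ‖c i‖ ≤ C * (1 + μ i ^ 2) ^ r) (hq : 0 ≤ q) (hpq : p / 2 + r ≤ q) :
    Summable fun i => ‖c i‖ / (μ i ^ 2) ^ q := by
  refine Summable.of_nonneg_of_le (fun i => by positivity) (fun i => ?_)
    (hs.mul_left (|C| * (1 + (δ ^ 2)⁻¹) ^ q))
  by_cases h0 : c i = 0
  · rw [h0, norm_zero, zero_div]; positivity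
  have hμ := (hc i).resolve_left h0
  have hg := (hgap i).resolve_left hμ
  have h1 : (1 : ℝ) ≤ 1 + μ i ^ 2 := by nlinarith [sq_nonneg (μ i)]
  have h2 : (1 + μ i ^ 2) ^ q ≤ (1 + (δ ^ 2)⁻¹) ^ q * (μ i ^ 2) ^ q := by
    rw [← Real.mul_rpow (by positivity) (by positivity)]
    exact Real.rpow_le_rpow (by positivity) (one_add_sq_le_of_gap hδ hg) hq
  have h3 : (1 + μ i ^ 2) ^ (p / 2) * (1 + μ i ^ 2) ^ r ≤ (1 + μ i ^ 2) ^ q := by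
    rw [← Real.rpow_add (by positivity)]
    exact Real.rpow_le_rpow_of_exponent_le h1 hpq
  have h4 : ‖c i‖ ≤ |C| * (1 + μ i ^ 2) ^ r :=
    (hC i).trans (mul_le_mul_of_nonneg_right (le_abs_self C) (by positivity))
  rw [Real.rpow_neg (by positivity), div_le_iff₀ (by positivity), ← div_eq_mul_inv,
    div_mul_eq_mul_div, le_div_iff₀ (by positivity)]
  calc ‖c i‖ * (1 + μ i ^ 2) ^ (p / 2)
      ≤ |C| * (1 + μ i ^ 2) ^ r * (1 + μ i ^ 2) ^ (p / 2) :=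
        mul_le_mul_of_nonneg_right h4 (by positivity)
    _ = |C| * ((1 + μ i ^ 2) ^ (p / 2) * (1 + μ i ^ 2) ^ r) := by ring
    _ ≤ |C| * ((1 + (δ ^ 2)⁻¹) ^ q * (μ i ^ 2) ^ q) :=
        mul_le_mul_of_nonneg_left (h3.trans h2) (abs_nonneg C)
    _ = _ := by ring

/-- Uniform bound for the resolvent kernel, used for dominated convergence. -/
theorem tsum_mul_sqRes_pow_le (hs : Summable fun i => (1 + μ i ^ 2) ^ (-(p / 2))) (hδ : 0 < δ)
    (hgap : ∀ i, μ i = 0 ∨ δ ≤ |μ i|) {c : ι → ℂ} (hc : ∀ i, c i = 0 ∨ μ i ≠ 0) {C r : ℝ}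
    (hC0 : 0 ≤ C) (hp : 0 ≤ p) (hr : 0 ≤ r) (hC : ∀ i, ‖c i‖ ≤ C * (1 + μ i ^ 2) ^ r) {k : ℕ}
    (hk : p / 2 + r ≤ k) {z : ℝ} (hz : 0 < z) :
    Summable (fun i => ‖c i * ((((μ i ^ 2 + z)⁻¹) ^ k : ℝ) : ℂ)‖) ∧
    ∑' i, ‖c i * ((((μ i ^ 2 + z)⁻¹) ^ k : ℝ) : ℂ)‖ ≤ C * (1 + (δ ^ 2)⁻¹) ^ (p / 2 + r) *
      (δ ^ 2 + z) ^ (p / 2 + r - k) * ∑' i, (1 + μ i ^ 2) ^ (-(p / 2)) := by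
  have h : ∀ i, ‖c i * ((((μ i ^ 2 + z)⁻¹) ^ k : ℝ) : ℂ)‖ ≤ C * (1 + (δ ^ 2)⁻¹) ^ (p / 2 + r) *
      (δ ^ 2 + z) ^ (p / 2 + r - k) * (1 + μ i ^ 2) ^ (-(p / 2)) := fun i => by
    by_cases h0 : c i = 0
    · rw [h0, zero_mul, norm_zero]; positivity
    have hμ := (hc i).resolve_left h0
    have hg := (hgap i).resolve_left hμ
    have h1 : δ ^ 2 ≤ μ i ^ 2 := by rw [← sq_abs (μ i)]; exact pow_le_pow_left₀ hδ.le hg 2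
    rw [norm_mul, Complex.norm_real, Real.norm_of_nonneg (by positivity)]
    -- Of the k powers of (μ²+z)^(-1), p/2 + r absorb the growth of c_i and leave the summable
    -- weight; the remaining ones have nonpositive exponent and are largest at μ² = δ².
    have h2 : (1 + μ i ^ 2) ^ (p / 2 + r)
        ≤ (1 + (δ ^ 2)⁻¹) ^ (p / 2 + r) * (μ i ^ 2 + z) ^ (p / 2 + r) := by
      rw [← Real.mul_rpow (by positivity) (by positivity)]
      refine Real.rpow_le_rpow (by positivity) ((one_add_sq_le_of_gap hδ hg).trans ?_)
        (by positivity)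
      exact mul_le_mul_of_nonneg_left (by linarith) (by positivity)
    have h3 : (μ i ^ 2 + z) ^ (p / 2 + r - k) ≤ (δ ^ 2 + z) ^ (p / 2 + r - k) :=
      Real.rpow_le_rpow_of_nonpos (by positivity) (by linarith) (by linarith)
    have h4 : (μ i ^ 2 + z) ^ (p / 2 + r) * ((μ i ^ 2 + z)⁻¹) ^ k
        = (μ i ^ 2 + z) ^ (p / 2 + r - k) := by
      rw [Real.rpow_sub (by positivity), Real.rpow_natCast, inv_pow]
      exact (div_eq_mul_inv _ _).symm
    have h5 : (1 + μ i ^ 2) ^ r = (1 + μ i ^ 2) ^ (p / 2 + r) * (1 + μ i ^ 2) ^ (-(p / 2)) := by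
      rw [← Real.rpow_add (by positivity)]; ring_nf
    calc ‖c i‖ * ((μ i ^ 2 + z)⁻¹) ^ k
        ≤ C * (1 + μ i ^ 2) ^ r * ((μ i ^ 2 + z)⁻¹) ^ k :=
          mul_le_mul_of_nonneg_right (hC i) (by positivity)
      _ = C * ((1 + μ i ^ 2) ^ (p / 2 + r) * ((μ i ^ 2 + z)⁻¹) ^ k *
            (1 + μ i ^ 2) ^ (-(p / 2))) := by rw [h5]; ring
      _ ≤ C * (((1 + (δ ^ 2)⁻¹) ^ (p / 2 + r) * (μ i ^ 2 + z) ^ (p / 2 + r)) *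
            ((μ i ^ 2 + z)⁻¹) ^ k * (1 + μ i ^ 2) ^ (-(p / 2))) := by gcongr
      _ = C * ((1 + (δ ^ 2)⁻¹) ^ (p / 2 + r) * (μ i ^ 2 + z) ^ (p / 2 + r - k) *
            (1 + μ i ^ 2) ^ (-(p / 2))) := by rw [← h4]; ring
      _ ≤ C * ((1 + (δ ^ 2)⁻¹) ^ (p / 2 + r) * (δ ^ 2 + z) ^ (p / 2 + r - k) *
            (1 + μ i ^ 2) ^ (-(p / 2))) := by gcongr
      _ = _ := by ring
  have h1 := Summable.of_nonneg_of_le (fun i => norm_nonneg _) h (hs.mul_left _)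
  refine ⟨h1, ?_⟩
  rw [← tsum_mul_left]
  exact h1.tsum_le_tsum h (hs.mul_left _)

end Summability

/-! ### Eta functions as Dirichlet series over the spectrum -/

variable {D : Submodule ℂ H} {T B : D →ₗ[ℂ] H} {ι : Type} {f : HilbertBasis ι ℂ H} {μ : ι → ℝ}
  {p δ : ℝ}

namespace IsEigenbasis

/-- The bound by the approximation numbers of R, and not just finiteness, is what later becomes
uniform in the parameter. -/
theorem summable_of_resolventMemSchatten (hE : IsEigenbasis T f μ) (hp : 0 < p)
    {R : H →L[ℂ] H} (hR : IsResolventAt (op T) (-Complex.I) R) (hRp : MemSchatten p R) :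
    Summable (fun i => (1 + μ i ^ 2) ^ (-(p / 2))) ∧
      ∑' i, (1 + μ i ^ 2) ^ (-(p / 2)) ≤ ∑' n, approxNumber R n ^ p := by
  rw [hE.resolvent_eq hR] at hRp ⊢
  have h := summable_rpow_of_memSchatten hp (isBdd_res μ) hRp
  have e : ∀ i, ‖((μ i : ℂ) + Complex.I)⁻¹‖ ^ p = (1 + μ i ^ 2) ^ (-(p / 2)) := fun i => by
    rw [norm_inv, norm_ofReal_add_I, ← Real.rpow_neg (by positivity),
      ← Real.rpow_mul (by positivity)]
    ring_nf
  simp_rw [e] at h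
  exact h

/-- The heat operator is split into two halves: one turns Z into a bounded operator X, the other is
trace class. -/
theorem heat_traceClass (hs : Summable fun i => (1 + μ i ^ 2) ^ (-(p / 2))) {Z : H → H} {c : ι → ℂ}
    (hZ : ∀ t, 0 < t → ∃ X : H →L[ℂ] H,
      (∀ x, Z (heat (op T) t x) = X (diag f (fun i => (Real.exp (-(t / 2) * μ i ^ 2) : ℂ)) x)) ∧
      ∀ i, ⟪f i, X (f i)⟫_ℂ = c i * Real.exp (-(t / 2) * μ i ^ 2)) {t : ℝ} (ht : 0 < t) :
    IsTraceClass (fun x => Z (heat (op T) t x)) ∧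
      HasSum (fun i => c i * (Real.exp (-t * μ i ^ 2) : ℂ))
        (trace fun x => Z (heat (op T) t x)) := by
  obtain ⟨X, hX, hXc⟩ := hZ t ht
  have hsum := summable_exp hs (half_pos ht)
  refine ⟨⟨X * diag f (fun i => (Real.exp (-(t / 2) * μ i ^ 2) : ℂ)), fun x => (hX x).symm,
    (memSchatten_one_diag hsum).one_mul_left X⟩, ?_⟩
  have h := hasSum_trace_mul_diag (f := f) hsum X
  have e : (fun x => Z (heat (op T) t x))
      = (X * diag f (fun i => (Real.exp (-(t / 2) * μ i ^ 2) : ℂ)) : H →L[ℂ] H) := funext hX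
  rw [e]
  convert! h using 1
  funext i
  rw [hXc, mul_left_comm, ← Complex.ofReal_mul, ← Real.exp_add]
  ring_nf

/-- The coefficients have order one, so exponent p/2 + 1/2 suffices for summability; this is at most
(Re s + 1)/2 for Re s > p. -/
theorem etaDefined (hp : 0 < p)
    (hs : Summable fun i => (1 + μ i ^ 2) ^ (-(p / 2))) {Z : H → H} {c : ι → ℂ}
    (hZ : ∀ t, 0 < t → ∃ X : H →L[ℂ] H,
      (∀ x, Z (heat (op T) t x) = X (diag f (fun i => (Real.exp (-(t / 2) * μ i ^ 2) : ℂ)) x)) ∧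
      ∀ i, ⟪f i, X (f i)⟫_ℂ = c i * Real.exp (-(t / 2) * μ i ^ 2))
    (hc : ∀ i, c i = 0 ∨ μ i ≠ 0) {C : ℝ} (hC : ∀ i, ‖c i‖ ≤ C * (1 + μ i ^ 2) ^ (1 / 2 : ℝ))
    {s : ℂ} (hps : p < s.re) :
    EtaDefined (op T) Z s ∧
      HasSum (fun i => c i / ((μ i ^ 2 : ℝ) : ℂ) ^ ((s + 1) / 2)) (eta (op T) Z s) := by
  have := countable_of_summable hs
  obtain ⟨δ, hδ, hgap⟩ := exists_gap hp hs
  have h := hasSum_etaMellin (s := s) (by linarith) hc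
    (fun t ht => (heat_traceClass hs hZ ht).2)
    (summable_div_rpow hs hδ hgap hc hC (by linarith) (by linarith))
  exact ⟨⟨fun t ht => (heat_traceClass hs hZ ht).1, h.1⟩, h.2⟩

theorem etaWeakDefined (hp : 0 < p)
    (hs : Summable fun i => (1 + μ i ^ 2) ^ (-(p / 2))) {w : H → H → ℂ} {c : ι → ℂ}
    (hw : ∀ t, 0 < t → ∃ L : H →L[ℂ] H, MemSchatten 1 L ∧
      (∀ y x, ⟪y, L x⟫_ℂ = w (heat (op T) (t / 2) y) (heat (op T) (t / 2) x)) ∧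
      HasSum (fun i => c i * (Real.exp (-t * μ i ^ 2) : ℂ)) (trace L))
    (hc : ∀ i, c i = 0 ∨ μ i ≠ 0) {C : ℝ} (hC : ∀ i, ‖c i‖ ≤ C * (1 + μ i ^ 2) ^ (1 / 2 : ℝ))
    {s : ℂ} (hps : p < s.re) :
    EtaWeakDefined (op T) w s ∧
      HasSum (fun i => c i / ((μ i ^ 2 : ℝ) : ℂ) ^ ((s + 1) / 2)) (etaWeak (op T) w s) := by
  have := countable_of_summable hs
  obtain ⟨δ, hδ, hgap⟩ := exists_gap hp hs
  have h := hasSum_etaMellin (s := s) (by linarith) hc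
    (F := fun t => ∑' i, w (heat (op T) (t / 2) (basis H i)) (heat (op T) (t / 2) (basis H i)))
    (fun t ht => ?_)
    (summable_div_rpow hs hδ hgap hc hC (by linarith) (by linarith))
  · refine ⟨⟨fun t ht => ?_, h.1⟩, h.2⟩
    obtain ⟨L, h1, h2, -⟩ := hw t ht
    exact ⟨L, h1, h2⟩
  · obtain ⟨L, h1, h2, h3⟩ := hw t ht
    simpa only [trace, h2] using h3

/-! ### The inverse of `Ã` -/

theorem tilde_coeff (hE : IsEigenbasis T f μ) (x : D) (i : ι) :
    ⟪f i, tilde (op T) x⟫_ℂ = (if μ i = 0 then 1 else μ i : ℝ) * ⟪f i, (x : H)⟫_ℂ := by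
  have hb : IsBdd fun i => if μ i = 0 then (1 : ℂ) else 0 :=
    ⟨1, fun i => by dsimp only; split_ifs <;> simp⟩
  change ⟪f i, (T x - eigenproj (op T) 0 (T x)) + eigenproj (op T) 0 (x : H)⟫_ℂ = _
  rw [inner_add_right, inner_sub_right, hE.eigenproj_eq, hE.eigenproj_eq, inner_diag hb,
    inner_diag hb, hE.inner_apply]
  split_ifs with h <;> simp

theorem isBdd_tilde (hδ : 0 < δ) (hgap : ∀ i, μ i = 0 ∨ δ ≤ |μ i|) :
    IsBdd fun i => (((if μ i = 0 then 1 else μ i)⁻¹ : ℝ) : ℂ) := by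
  refine isBdd_of_abs_le (C := 1 + δ⁻¹) fun i => ?_
  have : 0 < δ⁻¹ := by positivity
  split_ifs with h
  · simp [this.le]
  · have h1 := (hgap i).resolve_left h
    rw [abs_inv]
    have := inv_anti₀ hδ h1
    linarith

theorem isBdd_mul_tilde (μ : ι → ℝ) :
    IsBdd fun i => (μ i : ℂ) * (((if μ i = 0 then 1 else μ i)⁻¹ : ℝ) : ℂ) := by
  refine ⟨1, fun i => ?_⟩
  dsimp only
  split_ifs with h
  · simp [h]
  · have : (μ i : ℂ) ≠ 0 := by exact_mod_cast h
    simp [this]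

theorem tildeInv_eq (hE : IsEigenbasis T f μ) (hδ : 0 < δ) (hgap : ∀ i, μ i = 0 ∨ δ ≤ |μ i|)
    (y : H) : ((tildeInv (op T) y : (op T).domain) : H)
      = diag f (fun i => (((if μ i = 0 then 1 else μ i)⁻¹ : ℝ) : ℂ)) y := by
  have hne : ∀ i, ((if μ i = 0 then 1 else μ i : ℝ) : ℂ) ≠ 0 := fun i => by
    split_ifs with h
    · simp
    · exact_mod_cast h
  -- The inverse is defined by `Function.invFun`, which is a left inverse only once injectivity is
  -- known; all eigenvalues of T̃ are nonzero.
  have hinj : Function.Injective (tilde (op T)) := fun (x : D) (x' : D) h => by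
    refine Subtype.ext (hilbertBasis_ext f fun i => ?_)
    have h1 := hE.tilde_coeff x i
    rw [h, hE.tilde_coeff x' i] at h1
    exact (mul_left_cancel₀ (hne i) h1).symm
  have hb := isBdd_tilde (μ := μ) hδ hgap
  let x : D := ⟨_, hE.diag_mem hb (isBdd_mul_tilde μ) y⟩
  have h1 : tilde (op T) x = y := hilbertBasis_ext f fun i => by
    rw [hE.tilde_coeff, inner_diag hb, Complex.ofReal_inv]
    field_simp [hne i]
  have h2 : tildeInv (op T) y = x := by
    conv_lhs => rw [← h1]
    exact Function.leftInverse_invFun hinj x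
  rw [h2]

theorem tildeInvSq_eq (hE : IsEigenbasis T f μ) (hδ : 0 < δ) (hgap : ∀ i, μ i = 0 ∨ δ ≤ |μ i|)
    (y : H) : ((tildeInvSq (op T) y : (op T).domain) : H)
      = diag f (fun i => ((((if μ i = 0 then 1 else μ i)⁻¹) ^ 2 : ℝ) : ℂ)) y := by
  have hb := isBdd_tilde (μ := μ) hδ hgap
  rw [tildeInvSq, hE.tildeInv_eq hδ hgap, hE.tildeInv_eq hδ hgap, diag_diag hb hb]
  simp only [pow_two, Complex.ofReal_mul]

end IsEigenbasis

end EtaVar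

namespace EtaVar

variable {H : Type*} [NormedAddCommGroup H] [InnerProductSpace ℂ H] [CompleteSpace H]

/-! ### Operators commuting with the square of a diagonalized operator -/

/-- `⟨r⟩ = √(1 + r²)`. -/
def jb (r : ℝ) : ℝ := Real.sqrt (1 + r ^ 2)

theorem jb_pos (r : ℝ) : 0 < jb r := Real.sqrt_pos.mpr (by positivity)

theorem jb_sq (r : ℝ) : jb r ^ 2 = 1 + r ^ 2 := Real.sq_sqrt (by positivity)

theorem one_le_jb (r : ℝ) : 1 ≤ jb r := Real.one_le_sqrt.mpr (by nlinarith [sq_nonneg r])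

theorem abs_le_jb (r : ℝ) : |r| ≤ jb r := Real.abs_le_sqrt (by linarith)

theorem jb_eq_rpow (r : ℝ) : jb r = (1 + r ^ 2) ^ (1 / 2 : ℝ) := Real.sqrt_eq_rpow _

theorem jb_ne (r : ℝ) : (jb r : ℂ) ≠ 0 := by exact_mod_cast (jb_pos r).ne'

theorem isBdd_jb_inv {ι : Type*} (μ : ι → ℝ) : IsBdd fun i => (((jb (μ i))⁻¹ : ℝ) : ℂ) :=
  isBdd_of_abs_le (C := 1) fun i => by
    rw [abs_of_pos (inv_pos.mpr (jb_pos _))]; exact inv_le_one_of_one_le₀ (one_le_jb _)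

theorem isBdd_mul_jb_inv {ι : Type*} (μ : ι → ℝ) :
    IsBdd fun i => (μ i : ℂ) * (((jb (μ i))⁻¹ : ℝ) : ℂ) := by
  refine ⟨1, fun i => ?_⟩
  rw [norm_mul, Complex.norm_real, Complex.norm_real, Real.norm_eq_abs,
    Real.norm_of_nonneg (inv_pos.mpr (jb_pos _)).le, mul_inv_le_iff₀ (jb_pos _), one_mul]
  exact abs_le_jb _

theorem isBdd_mul_exp {ι : Type*} {μ : ι → ℝ} {g : ι → ℂ} {C : ℝ} {k : ℕ}
    (hg : ∀ i, ‖g i‖ ≤ C * (1 + μ i ^ 2) ^ k) {t : ℝ} (ht : 0 < t) :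
    IsBdd fun i => g i * (Real.exp (-t * μ i ^ 2) : ℂ) := by
  refine ⟨|C| * (k.factorial * Real.exp t / t ^ k), fun i => ?_⟩
  rw [norm_mul, Complex.norm_real, Real.norm_eq_abs, Real.abs_exp]
  have h1 : ‖g i‖ ≤ |C| * (1 + μ i ^ 2) ^ k :=
    (hg i).trans (mul_le_mul_of_nonneg_right (le_abs_self C) (by positivity))
  have h2 := mul_le_mul_of_nonneg_left (pow_mul_exp_neg_le k ht (μ i)) (abs_nonneg C)
  have h3 := mul_le_mul_of_nonneg_right h1 (Real.exp_pos (-t * μ i ^ 2)).le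
  linarith

theorem exp_half_mul_exp_half (t x : ℝ) : (Real.exp (-(t / 2) * x ^ 2) : ℂ) *
    (Real.exp (-(t / 2) * x ^ 2) : ℂ) = (Real.exp (-t * x ^ 2) : ℂ) := by
  rw [← Complex.ofReal_mul, ← Real.exp_add]
  ring_nf

theorem clm_ext_basis {ι : Type*} (f : HilbertBasis ι ℂ H) {X Y : H →L[ℂ] H}
    (h : ∀ j, X (f j) = Y (f j)) : X = Y := by
  refine ContinuousLinearMap.ext_on (s := Set.range f) ?_ ?_
  · rw [Submodule.dense_iff_topologicalClosure_eq_top]; exact f.dense_span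
  · rintro _ ⟨j, rfl⟩; exact h j

variable {D : Submodule ℂ H} {T T' B : D →ₗ[ℂ] H} {ι : Type} {f : HilbertBasis ι ℂ H} {μ : ι → ℝ}
  {p δ : ℝ}

namespace IsEigenbasis

theorem diag_mem_of_mem (hE : IsEigenbasis T f μ) {g : ι → ℂ} (hg : IsBdd g) (x : D) :
    diag f g (x : H) ∈ D := hE.mem_of_coeff _ (diag f g (T x)) fun i => by
  rw [inner_diag hg, inner_diag hg, hE.inner_apply]; ring

theorem commute_sqRes (hE : IsEigenbasis T f μ)
    (hB : CommutesWithResolvents (op B) (sq (op T))) {z : ℝ} (hz : 0 < z) (x : D) :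
    B ⟨diag f (fun i => (((μ i ^ 2 + z)⁻¹ : ℝ) : ℂ)) x, hE.sqRes_mem hz x⟩
      = diag f (fun i => (((μ i ^ 2 + z)⁻¹ : ℝ) : ℂ)) (B x) := by
  obtain ⟨h, e⟩ := hB _ _ (hE.sq_isResolventAt hz) x
  exact e

/-- The single resolvent (T²+1)^(-1) already separates the values of μ², so an operator commuting
with it cannot mix eigenspaces of T². -/
theorem inner_eq_zero_of_sq_ne (hE : IsEigenbasis T f μ)
    (hB : CommutesWithResolvents (op B) (sq (op T))) {i j : ι} (hij : μ i ^ 2 ≠ μ j ^ 2) :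
    ⟪f i, B ⟨f j, hE.mem j⟩⟫_ℂ = 0 := by
  have h := hE.commute_sqRes hB one_pos ⟨f j, hE.mem j⟩
  have hb := isBdd_sqRes μ one_pos
  have e : (⟨diag f (fun i => (((μ i ^ 2 + 1)⁻¹ : ℝ) : ℂ)) (f j), hE.sqRes_mem one_pos (f j)⟩ : D)
      = (((μ j ^ 2 + 1)⁻¹ : ℝ) : ℂ) • ⟨f j, hE.mem j⟩ := Subtype.ext (diag_basis hb j)
  rw [e, map_smul] at h
  have h2 := congrArg (fun v => ⟪f i, v⟫_ℂ) h
  simp only [inner_smul_right, inner_diag hb] at h2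
  rw [← sub_eq_zero, ← sub_mul] at h2
  refine (mul_eq_zero.mp h2).resolve_left (sub_ne_zero.mpr ?_)
  intro h3
  have h4 : (μ j ^ 2 + 1)⁻¹ = (μ i ^ 2 + 1)⁻¹ := by exact_mod_cast h3
  exact hij (by linarith [inv_injective h4])

/-- If `B` commutes with the resolvents of `T²`, so do its bounded regularizations with all
functions of `T²`. -/
theorem comp_commute_diag (hE : IsEigenbasis T f μ)
    (hB : CommutesWithResolvents (op B) (sq (op T))) {h g : ι → ℂ} (hh : IsBdd h)
    (hh' : IsBdd fun i => (μ i : ℂ) * h i) (hg : IsBdd g)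
    (hgμ : ∀ i j, μ i ^ 2 = μ j ^ 2 → g i = g j) {X : H →L[ℂ] H}
    (hX : ∀ x, X x = B ⟨diag f h x, hE.diag_mem hh hh' x⟩) :
    X * diag f g = diag f g * X := by
  refine clm_ext_basis f fun j => hilbertBasis_ext f fun i => ?_
  rw [mul_apply_eq_comp, mul_apply_eq_comp, diag_basis hg, map_smul, inner_smul_right,
    inner_diag hg, hX]
  have e : (⟨diag f h (f j), hE.diag_mem hh hh' (f j)⟩ : D) = h j • ⟨f j, hE.mem j⟩ :=
    Subtype.ext (diag_basis hh j)
  rw [e, map_smul, inner_smul_right]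
  by_cases hij : μ i ^ 2 = μ j ^ 2
  · rw [hgμ i j hij]
  · rw [hE.inner_eq_zero_of_sq_ne hB hij]; simp

theorem isBdd_ofReal_tilde_sq (hδ : 0 < δ) (hgap : ∀ i, μ i = 0 ∨ δ ≤ |μ i|) (i : ι) :
    jb (μ i) ^ 2 * ((if μ i = 0 then 1 else μ i)⁻¹) ^ 2 ≤ 1 + (δ ^ 2)⁻¹ := by
  rw [jb_sq]
  split_ifs with h
  · rw [h]; simp; positivity
  · have h1 := one_add_sq_le_of_gap hδ ((hgap i).resolve_left h)
    rw [inv_pow, mul_inv_le_iff₀ (by positivity)]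
    exact h1

end IsEigenbasis

theorem IsEigenbasis.norm_inner_basis_le (hE : IsEigenbasis T f μ) {C : ℝ} (hC0 : 0 ≤ C)
    (hC : ∀ x : D, ‖B x‖ ≤ C * (‖(x : H)‖ + ‖T x‖)) (i : ι) :
    ‖⟪f i, B ⟨f i, hE.mem i⟩⟫_ℂ‖ ≤ 2 * C * (1 + μ i ^ 2) ^ (1 / 2 : ℝ) := by
  have h1 := hC ⟨f i, hE.mem i⟩
  rw [hE.apply_basis, norm_smul, f.orthonormal.1 i, Complex.norm_real, Real.norm_eq_abs] at h1
  have h2 : ‖⟪f i, B ⟨f i, hE.mem i⟩⟫_ℂ‖ ≤ ‖B ⟨f i, hE.mem i⟩‖ := by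
    have := norm_inner_le_norm (𝕜 := ℂ) (f i) (B ⟨f i, hE.mem i⟩)
    rwa [f.orthonormal.1 i, one_mul] at this
  rw [← jb_eq_rpow]
  have := mul_le_mul_of_nonneg_left (add_le_add (one_le_jb (μ i)) (abs_le_jb (μ i))) hC0
  rw [mul_one] at h1
  linarith

/-- A relatively bounded operator is trace class after multiplication with the heat operator. -/
theorem IsEigenbasis.etaDefined_of_relBdd (hE : IsEigenbasis T f μ) (hp : 0 < p)
    (hs : Summable fun i => (1 + μ i ^ 2) ^ (-(p / 2))) (hB : RelBdd T B)
    (h0 : ∀ i, μ i = 0 → ⟪f i, B ⟨f i, hE.mem i⟩⟫_ℂ = 0) {s : ℂ} (hps : p < s.re) :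
    EtaDefined (op T) (app (op B)) s ∧
      HasSum (fun i => ⟪f i, B ⟨f i, hE.mem i⟩⟫_ℂ / ((μ i ^ 2 : ℝ) : ℂ) ^ ((s + 1) / 2))
        (eta (op T) (app (op B)) s) := by
  obtain ⟨C, hC0, hC⟩ := hB
  refine IsEigenbasis.etaDefined (f := f) hp hs (fun t ht => ?_) (fun i => ?_) (C := 2 * C) (fun i => ?_) hps
  · have hb := isBdd_exp μ (half_pos ht)
    have hb' : IsBdd fun i => (μ i : ℂ) * (Real.exp (-(t / 2) * μ i ^ 2) : ℂ) := by
      simpa using isBdd_pow_mul_exp μ 1 (half_pos ht)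
    obtain ⟨X, hX⟩ := hE.exists_comp_diag ⟨C, hC0, hC⟩ hb hb'
    refine ⟨X, fun x => ?_, fun i => ?_⟩
    · have e : heat (op T) t x = diag f (fun i => (Real.exp (-(t / 2) * μ i ^ 2) : ℂ))
          (diag f (fun i => (Real.exp (-(t / 2) * μ i ^ 2) : ℂ)) x) := by
        rw [hE.heat_eq ht, diag_diag hb hb]
        simp only [exp_half_mul_exp_half]
      rw [e, hX, app_op]
    · rw [hX]
      have e : (⟨_, hE.diag_mem hb hb' (f i)⟩ : D)
          = (Real.exp (-(t / 2) * μ i ^ 2) : ℂ) • ⟨f i, hE.mem i⟩ := Subtype.ext (diag_basis hb i)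
      rw [e, map_smul, inner_smul_right, mul_comm]
  · by_cases h : μ i = 0
    · exact Or.inl (h0 i h)
    · exact Or.inr h
  · exact hE.norm_inner_basis_le hC0 hC i

/-- The data of the variation formula at a fixed parameter. -/
structure VarData (T T' B : D →ₗ[ℂ] H) (f : HilbertBasis ι ℂ H) (μ : ι → ℝ) (δ : ℝ) : Prop where
  eigen : IsEigenbasis T f μ
  relT' : RelBdd T T'
  symm : ∀ u v : D, ⟪T' u, (v : H)⟫_ℂ = ⟪(u : H), T' v⟫_ℂ
  relB : RelBdd T B
  comm : CommutesWithResolvents (op B) (sq (op T))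
  ker : ∀ i (h : f i ∈ D), μ i = 0 → B ⟨f i, h⟩ = 0
  pos : 0 < δ
  gap : ∀ i, μ i = 0 ∨ δ ≤ |μ i|

/-- `⟨T⟩⁻¹`. -/
def jbInv (f : HilbertBasis ι ℂ H) (μ : ι → ℝ) : H →L[ℂ] H :=
  diag f fun i => (((jb (μ i))⁻¹ : ℝ) : ℂ)

theorem jbInv_basis (i : ι) : jbInv f μ (f i) = (((jb (μ i))⁻¹ : ℝ) : ℂ) • f i :=
  diag_basis (isBdd_jb_inv μ) i

theorem adjoint_jbInv : (jbInv f μ).adjoint = jbInv f μ := by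
  symm
  rw [ContinuousLinearMap.eq_adjoint_iff]
  intro x y
  rw [jbInv, inner_diag_left (isBdd_jb_inv μ)]
  simp

theorem jbInv_inner (x y : H) : ⟪jbInv f μ x, y⟫_ℂ = ⟪x, jbInv f μ y⟫_ℂ := by
  rw [← ContinuousLinearMap.adjoint_inner_right, adjoint_jbInv]

theorem IsEigenbasis.jbInv_mem (hE : IsEigenbasis T f μ) (x : H) : jbInv f μ x ∈ D :=
  hE.diag_mem (isBdd_jb_inv μ) (isBdd_mul_jb_inv μ) x

theorem IsEigenbasis.exists_comp_jbInv (hE : IsEigenbasis T f μ) (hB : RelBdd T B) :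
    ∃ X : H →L[ℂ] H, ∀ x, X x = B ⟨jbInv f μ x, hE.jbInv_mem x⟩ :=
  hE.exists_comp_diag hB (isBdd_jb_inv μ) (isBdd_mul_jb_inv μ)

/-! ### Regularization of B by (1+T²)^(-1/2) -/

namespace VarData

theorem commute_jbInv (h : VarData T T' B f μ δ) {β : H →L[ℂ] H}
    (hβ : ∀ x, β x = B ⟨jbInv f μ x, h.eigen.jbInv_mem x⟩) {g : ι → ℂ} (hg : IsBdd g)
    (hgμ : ∀ i j, μ i ^ 2 = μ j ^ 2 → g i = g j) (x : H) :
    β (diag f g x) = diag f g (β x) :=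
  congrArg (fun X : H →L[ℂ] H => X x) (h.eigen.comp_commute_diag h.comm (isBdd_jb_inv μ)
    (isBdd_mul_jb_inv μ) hg hgμ hβ)

theorem jbInv_commute (h : VarData T T' B f μ δ) {β : H →L[ℂ] H}
    (hβ : ∀ x, β x = B ⟨jbInv f μ x, h.eigen.jbInv_mem x⟩) (x : H) :
    β (jbInv f μ x) = jbInv f μ (β x) :=
  h.commute_jbInv hβ (isBdd_jb_inv μ) (fun i j hij => by rw [jb, jb, hij]) x

theorem adjoint_jbInv_commute (h : VarData T T' B f μ δ) {β : H →L[ℂ] H}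
    (hβ : ∀ x, β x = B ⟨jbInv f μ x, h.eigen.jbInv_mem x⟩) (x : H) :
    β.adjoint (jbInv f μ x) = jbInv f μ (β.adjoint x) := by
  refine ext_inner_right ℂ fun y => ?_
  rw [ContinuousLinearMap.adjoint_inner_left, jbInv_inner, ← h.jbInv_commute hβ,
    ← ContinuousLinearMap.adjoint_inner_left, jbInv_inner]

/-- `B x = (B ⟨T⟩⁻¹) y` for `x = ⟨T⟩⁻¹ y`. -/
theorem apply_of_eq (h : VarData T T' B f μ δ) {β : H →L[ℂ] H}
    (hβ : ∀ x, β x = B ⟨jbInv f μ x, h.eigen.jbInv_mem x⟩) {x : H} (hx : x ∈ D) {y : H}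
    (hxy : x = jbInv f μ y) : B ⟨x, hx⟩ = β y := by
  subst hxy
  exact (hβ y).symm

/-- Moving the regularizer to the left of B makes the matrix elements of B against the range of
⟨T⟩⁻¹ continuous, which identifies B† there. -/
theorem jbInv_apply (h : VarData T T' B f μ δ) {β : H →L[ℂ] H}
    (hβ : ∀ x, β x = B ⟨jbInv f μ x, h.eigen.jbInv_mem x⟩) (x : D) :
    jbInv f μ (B x) = β x := by
  -- write `x = ⟨T⟩⁻¹ y`
  obtain ⟨y, hy⟩ : ∃ y : H, ∀ i, ⟪f i, y⟫_ℂ = (jb (μ i) : ℂ) * ⟪f i, (x : H)⟫_ℂ := by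
    refine exists_of_coeff_le f (C := 1) (y := T x + Complex.I • (x : H)) fun i => ?_
    rw [inner_add_right, inner_smul_right, h.eigen.inner_apply, ← add_mul, norm_mul, norm_mul,
      norm_ofReal_add_I, ← jb_eq_rpow, Complex.norm_real, Real.norm_of_nonneg (jb_pos _).le,
      one_mul]
  have hxy : (x : H) = jbInv f μ y := hilbertBasis_ext f fun i => by
    rw [jbInv, inner_diag (isBdd_jb_inv μ), hy, Complex.ofReal_inv]
    field_simp [jb_ne (μ i)]
  have e : B x = β y := h.apply_of_eq hβ x.2 hxy
  rw [e, ← h.jbInv_commute hβ, hxy]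

theorem inner_apply_jbInv (h : VarData T T' B f μ δ) {β : H →L[ℂ] H}
    (hβ : ∀ x, β x = B ⟨jbInv f μ x, h.eigen.jbInv_mem x⟩) (y : H) (x : D) :
    ⟪jbInv f μ y, B x⟫_ℂ = ⟪β.adjoint y, (x : H)⟫_ℂ := by
  rw [ContinuousLinearMap.adjoint_inner_left, ← h.jbInv_apply hβ x, jbInv_inner]

/-- No description of the full domain of B† is needed: on the range of ⟨T⟩⁻¹, which contains the
ranges of the heat operators, B† is given by the bounded operator β*. -/
theorem app_adjoint (h : VarData T T' B f μ δ) {β : H →L[ℂ] H}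
    (hβ : ∀ x, β x = B ⟨jbInv f μ x, h.eigen.jbInv_mem x⟩) (y : H) :
    app (op B)† (jbInv f μ y) = β.adjoint y := by
  have h1 : ∀ x : (op B).domain, ⟪β.adjoint y, (x : H)⟫_ℂ = ⟪jbInv f μ y, op B x⟫_ℂ :=
    fun x => (h.inner_apply_jbInv hβ y x).symm
  have h2 := LinearPMap.mem_adjoint_domain_of_exists (T := op B) (jbInv f μ y) ⟨_, h1⟩
  rw [app, dif_pos h2]
  exact LinearPMap.adjoint_apply_eq h.eigen.dense ⟨_, h2⟩ h1

/-- `B f i` lies in the domain. -/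
theorem apply_basis_eq (h : VarData T T' B f μ δ) {β : H →L[ℂ] H}
    (hβ : ∀ x, β x = B ⟨jbInv f μ x, h.eigen.jbInv_mem x⟩) (i : ι) :
    B ⟨f i, h.eigen.mem i⟩ = ((jb (μ i) ^ 2 : ℝ) : ℂ) • jbInv f μ (β (f i)) := by
  have hne := jb_ne (μ i)
  rw [← h.jbInv_commute hβ, jbInv_basis, map_smul, hβ]
  have e : (⟨jbInv f μ (f i), h.eigen.jbInv_mem (f i)⟩ : D)
      = (((jb (μ i))⁻¹ : ℝ) : ℂ) • ⟨f i, h.eigen.mem i⟩ := Subtype.ext (jbInv_basis i)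
  rw [e, map_smul, smul_smul, smul_smul]
  have : ((jb (μ i) ^ 2 : ℝ) : ℂ) * ((((jb (μ i))⁻¹ : ℝ) : ℂ) * (((jb (μ i))⁻¹ : ℝ) : ℂ)) = 1 := by
    push_cast; field_simp
  rw [mul_assoc, this, one_smul]

theorem apply_basis_mem (h : VarData T T' B f μ δ) (i : ι) : B ⟨f i, h.eigen.mem i⟩ ∈ D := by
  obtain ⟨β, hβ⟩ := h.eigen.exists_comp_jbInv h.relB
  rw [h.apply_basis_eq hβ]
  exact D.smul_mem _ (h.eigen.jbInv_mem _)

/-- The diagonal entries `(d/da A²)(f i, B f i)`. -/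
def coef (h : VarData T T' B f μ δ) (i : ι) : ℂ :=
  ⟪T' ⟨f i, h.eigen.mem i⟩, T ⟨B ⟨f i, h.eigen.mem i⟩, h.apply_basis_mem i⟩⟫_ℂ +
    ⟪T ⟨f i, h.eigen.mem i⟩, T' ⟨B ⟨f i, h.eigen.mem i⟩, h.apply_basis_mem i⟩⟫_ℂ

/-- B f_i lies in the eigenspace of T² for μ_i², on which T multiplies norms by |μ_i|. -/
theorem norm_apply_basis (h : VarData T T' B f μ δ) (i : ι) :
    ‖T ⟨B ⟨f i, h.eigen.mem i⟩, h.apply_basis_mem i⟩‖ = |μ i| * ‖B ⟨f i, h.eigen.mem i⟩‖ := by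
  have h1 := hasSum_norm_sq_coeff f (T ⟨B ⟨f i, h.eigen.mem i⟩, h.apply_basis_mem i⟩)
  have h2 := (hasSum_norm_sq_coeff f (B ⟨f i, h.eigen.mem i⟩)).mul_left (μ i ^ 2)
  have e : ∀ j, ‖⟪f j, T ⟨B ⟨f i, h.eigen.mem i⟩, h.apply_basis_mem i⟩⟫_ℂ‖ ^ 2
      = μ i ^ 2 * ‖⟪f j, B ⟨f i, h.eigen.mem i⟩⟫_ℂ‖ ^ 2 := fun j => by
    rw [h.eigen.inner_apply, norm_mul, mul_pow, Complex.norm_real, Real.norm_eq_abs, sq_abs]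
    by_cases hij : μ j ^ 2 = μ i ^ 2
    · rw [hij]
    · rw [h.eigen.inner_eq_zero_of_sq_ne h.comm hij]; simp
  simp_rw [e] at h1
  have h3 := h1.unique h2
  rw [← sq_abs (μ i), ← mul_pow] at h3
  exact (sq_eq_sq₀ (norm_nonneg _) (by positivity)).mp h3

/-- Each of T', T and B costs one factor ⟨μ_i⟩, hence the cube; each of the two pairings contributes
4C'C. -/
theorem norm_coef_le (h : VarData T T' B f μ δ) {C' C : ℝ} (hC'0 : 0 ≤ C')
    (hC' : ∀ x : D, ‖T' x‖ ≤ C' * (‖(x : H)‖ + ‖T x‖)) (hC0 : 0 ≤ C)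
    (hC : ∀ x : D, ‖B x‖ ≤ C * (‖(x : H)‖ + ‖T x‖)) (i : ι) :
    ‖h.coef i‖ ≤ 8 * C' * C * jb (μ i) ^ 3 := by
  have hj := jb_pos (μ i)
  have h1 := one_le_jb (μ i)
  have hμ := abs_le_jb (μ i)
  have hTf : ‖T ⟨f i, h.eigen.mem i⟩‖ = |μ i| := by
    rw [h.eigen.apply_basis, norm_smul, f.orthonormal.1 i, Complex.norm_real, Real.norm_eq_abs,
      mul_one]
  have hT'f : ‖T' ⟨f i, h.eigen.mem i⟩‖ ≤ C' * (2 * jb (μ i)) := by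
    refine (hC' _).trans (mul_le_mul_of_nonneg_left ?_ hC'0)
    rw [hTf, f.orthonormal.1 i]; linarith
  have hBf : ‖B ⟨f i, h.eigen.mem i⟩‖ ≤ C * (2 * jb (μ i)) := by
    refine (hC _).trans (mul_le_mul_of_nonneg_left ?_ hC0)
    rw [hTf, f.orthonormal.1 i]; linarith
  have hTB : ‖T ⟨B ⟨f i, h.eigen.mem i⟩, h.apply_basis_mem i⟩‖ ≤ jb (μ i) * (C * (2 * jb (μ i))) := by
    rw [h.norm_apply_basis]
    exact mul_le_mul hμ hBf (norm_nonneg _) hj.le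
  have hT'B : ‖T' ⟨B ⟨f i, h.eigen.mem i⟩, h.apply_basis_mem i⟩‖
      ≤ C' * (2 * (jb (μ i) * (C * (2 * jb (μ i))))) := by
    refine (hC' _).trans (mul_le_mul_of_nonneg_left ?_ hC'0)
    have : ‖B ⟨f i, h.eigen.mem i⟩‖ ≤ jb (μ i) * (C * (2 * jb (μ i))) :=
      hBf.trans (le_mul_of_one_le_left (by positivity) h1)
    linarith
  rw [coef]
  refine (norm_add_le _ _).trans ((add_le_add (norm_inner_le_norm _ _)
    (norm_inner_le_norm _ _)).trans ?_)
  rw [hTf]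
  have e1 := mul_le_mul hT'f hTB (norm_nonneg _) (by positivity)
  have e2 := mul_le_mul hμ hT'B (norm_nonneg _) hj.le
  calc _ ≤ _ := add_le_add e1 e2
    _ = _ := by ring

theorem coef_eq_zero (h : VarData T T' B f μ δ) (i : ι) (hi : μ i = 0) : h.coef i = 0 := by
  have e : (⟨B ⟨f i, h.eigen.mem i⟩, h.apply_basis_mem i⟩ : D) = 0 :=
    Subtype.ext (h.ker i (h.eigen.mem i) hi)
  rw [coef, e, map_zero, map_zero, inner_zero_right, inner_zero_right, add_zero]

end VarData

end EtaVar

namespace EtaVar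

variable {H : Type*} [NormedAddCommGroup H] [InnerProductSpace ℂ H] [CompleteSpace H]
variable {D : Submodule ℂ H} {T T' B : D →ₗ[ℂ] H} {ι : Type} {f : HilbertBasis ι ℂ H} {μ : ι → ℝ}
  {p δ : ℝ}

/-! ### The weak operator `B (d/da A²) Ã⁻²` -/

open Classical in
/-- The form `⟪T' B† y, T T̃⁻² x⟫ + ⟪T B† y, T' T̃⁻² x⟫`. -/
def weakForm (T T' B : D →ₗ[ℂ] H) (y x : H) : ℂ :=
  if h : app (op B)† y ∈ D then
    ⟪T' ⟨app (op B)† y, h⟩, T (tildeInvSq (op T) x)⟫_ℂ +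
      ⟪T ⟨app (op B)† y, h⟩, T' (tildeInvSq (op T) x)⟫_ℂ
  else 0

/-- The eigenvalues of `T̃⁻²`. -/
def tinv (r : ℝ) : ℝ := ((if r = 0 then 1 else r)⁻¹) ^ 2

theorem tinv_nonneg (r : ℝ) : 0 ≤ tinv r := sq_nonneg _

theorem tinv_eq_of_sq_eq {r r' : ℝ} (h : r ^ 2 = r' ^ 2) : tinv r = tinv r' := by
  have : r = 0 ↔ r' = 0 := by rw [← sq_eq_zero_iff, h, sq_eq_zero_iff]
  rw [tinv, tinv, inv_pow, inv_pow]
  simp only [this]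
  split_ifs
  · rfl
  · rw [h]

theorem sq_mul_tinv {r : ℝ} (h : r ≠ 0) : r ^ 2 * tinv r = 1 := by
  rw [tinv, if_neg h, inv_pow, mul_inv_cancel₀ (by positivity)]

theorem app_tildeInvSq (T Y : D →ₗ[ℂ] H) (x : H) :
    app (op Y) (tildeInvSq (op T) x) = Y (tildeInvSq (op T) x) := app_op_coe Y _

namespace VarData

theorem jb_sq_mul_tinv_le (h : VarData T T' B f μ δ) (i : ι) :
    jb (μ i) ^ 2 * tinv (μ i) ≤ 1 + (δ ^ 2)⁻¹ :=
  IsEigenbasis.isBdd_ofReal_tilde_sq h.pos h.gap i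

theorem tinv_le (h : VarData T T' B f μ δ) (i : ι) : tinv (μ i) ≤ 1 + (δ ^ 2)⁻¹ :=
  (le_mul_of_one_le_left (tinv_nonneg _) (by nlinarith [one_le_jb (μ i)])).trans
    (h.jb_sq_mul_tinv_le i)

theorem jb_mul_tinv_le (h : VarData T T' B f μ δ) (i : ι) :
    jb (μ i) * tinv (μ i) ≤ 1 + (δ ^ 2)⁻¹ :=
  (mul_le_mul_of_nonneg_right (by nlinarith [one_le_jb (μ i)]) (tinv_nonneg _)).trans
    (h.jb_sq_mul_tinv_le i)

theorem abs_mul_tinv_le (h : VarData T T' B f μ δ) (i : ι) :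
    |μ i| * tinv (μ i) ≤ 1 + (δ ^ 2)⁻¹ :=
  (mul_le_mul_of_nonneg_right (abs_le_jb _) (tinv_nonneg _)).trans (h.jb_mul_tinv_le i)

theorem isBdd_tinv (h : VarData T T' B f μ δ) : IsBdd fun i => ((tinv (μ i) : ℝ) : ℂ) :=
  isBdd_of_abs_le fun i => by rw [abs_of_nonneg (tinv_nonneg _)]; exact h.tinv_le i

theorem isBdd_mul_tinv (h : VarData T T' B f μ δ) :
    IsBdd fun i => (μ i : ℂ) * ((tinv (μ i) : ℝ) : ℂ) := by
  refine ⟨1 + (δ ^ 2)⁻¹, fun i => ?_⟩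
  rw [norm_mul, Complex.norm_real, Complex.norm_real, Real.norm_eq_abs,
    Real.norm_of_nonneg (tinv_nonneg _)]
  exact h.abs_mul_tinv_le i

theorem isBdd_mul_mul_tinv (μ : ι → ℝ) :
    IsBdd fun i => (μ i : ℂ) * ((μ i : ℂ) * ((tinv (μ i) : ℝ) : ℂ)) := by
  refine ⟨1, fun i => ?_⟩
  by_cases h0 : μ i = 0
  · simp [h0]
  · have := sq_mul_tinv h0
    dsimp only
    rw [← mul_assoc, ← pow_two]
    have e : (μ i : ℂ) ^ 2 * ((tinv (μ i) : ℝ) : ℂ) = 1 := by exact_mod_cast this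
    rw [e, norm_one]

theorem tildeInvSq_coe (h : VarData T T' B f μ δ) (x : H) :
    tildeInvSq (op T) x = (⟨diag f (fun i => ((tinv (μ i) : ℝ) : ℂ)) x,
      h.eigen.diag_mem h.isBdd_tinv h.isBdd_mul_tinv x⟩ : D) :=
  Subtype.ext (h.eigen.tildeInvSq_eq h.pos h.gap x)

theorem isBdd_jb_mul_tinv (h : VarData T T' B f μ δ) :
    IsBdd fun i => ((jb (μ i) * tinv (μ i) : ℝ) : ℂ) :=
  isBdd_of_abs_le fun i => by
    rw [abs_of_nonneg (mul_nonneg (jb_pos _).le (tinv_nonneg _))]; exact h.jb_mul_tinv_le i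

/-- The tilde inverse as `⟨T⟩⁻¹` times a bounded operator. -/
theorem tinv_eq_jbInv (h : VarData T T' B f μ δ) (x : H) :
    diag f (fun i => ((tinv (μ i) : ℝ) : ℂ)) x =
      jbInv f μ (diag f (fun i => ((jb (μ i) * tinv (μ i) : ℝ) : ℂ)) x) := by
  rw [jbInv, diag_diag (isBdd_jb_inv μ) h.isBdd_jb_mul_tinv]
  congr 2
  funext i
  rw [← Complex.ofReal_mul, inv_mul_cancel_left₀ (jb_pos _).ne']

theorem isBdd_jb_pow_mul_exp (μ : ι → ℝ) (k : ℕ) {t : ℝ} (ht : 0 < t) :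
    IsBdd fun i => ((jb (μ i) ^ k * Real.exp (-t * μ i ^ 2) : ℝ) : ℂ) := by
  simp only [Complex.ofReal_mul]
  refine isBdd_mul_exp (k := k) (C := 1) (fun i => ?_) ht
  rw [Complex.norm_real, Real.norm_of_nonneg (pow_nonneg (jb_pos _).le _), one_mul, ← jb_sq]
  exact pow_le_pow_left₀ (jb_pos _).le (by nlinarith [one_le_jb (μ i)]) k

theorem jbInv_pow_mul_exp (k : ℕ) {t : ℝ} (ht : 0 < t) (x : H) :
    jbInv f μ (diag f (fun i => ((jb (μ i) ^ (k + 1) * Real.exp (-t * μ i ^ 2) : ℝ) : ℂ)) x) =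
      diag f (fun i => ((jb (μ i) ^ k * Real.exp (-t * μ i ^ 2) : ℝ) : ℂ)) x := by
  rw [jbInv, diag_diag (isBdd_jb_inv μ) (isBdd_jb_pow_mul_exp μ (k + 1) ht)]
  congr 2
  funext i
  have := (jb_pos (μ i)).ne'
  rw [← Complex.ofReal_mul]
  congr 1
  field_simp
  ring

/-! ### The weak operator between heat operators -/

section Regularized

variable {β α α' : H →L[ℂ] H}

/-- `W B†E y ∈ D`, with its value. -/
theorem app_adjoint_heat (h : VarData T T' B f μ δ)
    (hβ : ∀ x, β x = B ⟨jbInv f μ x, h.eigen.jbInv_mem x⟩) {t : ℝ} (ht : 0 < t) (y : H) :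
    app (op B)† (heat (op T) t y) = jbInv f μ (β.adjoint
      (diag f (fun i => ((jb (μ i) ^ 2 * Real.exp (-t * μ i ^ 2) : ℝ) : ℂ)) y)) := by
  have e : heat (op T) t y = jbInv f μ (jbInv f μ
      (diag f (fun i => ((jb (μ i) ^ 2 * Real.exp (-t * μ i ^ 2) : ℝ) : ℂ)) y)) := by
    rw [jbInv_pow_mul_exp 1 ht, jbInv_pow_mul_exp 0 ht, h.eigen.heat_eq ht]
    simp
  rw [e, h.app_adjoint hβ, h.adjoint_jbInv_commute hβ]

/-- Two factors ⟨T⟩⁻¹ are taken out of the left heat operator: one makes B† bounded, the other puts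
the result into D so that T and T' apply. A third is taken out of T̃⁻² on the right. All that
remains is bounded. -/
theorem weakForm_heat (h : VarData T T' B f μ δ)
    (hβ : ∀ x, β x = B ⟨jbInv f μ x, h.eigen.jbInv_mem x⟩)
    (hα : ∀ x, α x = T ⟨jbInv f μ x, h.eigen.jbInv_mem x⟩)
    (hα' : ∀ x, α' x = T' ⟨jbInv f μ x, h.eigen.jbInv_mem x⟩) {t : ℝ} (ht : 0 < t) (y x : H) :
    weakForm T T' B (heat (op T) t y) (heat (op T) t x) =
      ⟪y, (diag f (fun i => ((jb (μ i) ^ 2 * Real.exp (-t * μ i ^ 2) : ℝ) : ℂ)) * β *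
        (α'.adjoint * α + α.adjoint * α') * diag f (fun i => ((jb (μ i) * tinv (μ i) : ℝ) : ℂ)) *
        diag f (fun i => (Real.exp (-t * μ i ^ 2) : ℂ))) x⟫_ℂ := by
  have hG := isBdd_jb_pow_mul_exp μ 2 ht
  have e1 := h.app_adjoint_heat hβ ht y
  have hmem : app (op B)† (heat (op T) t y) ∈ D := e1 ▸ h.eigen.jbInv_mem _
  have e2 : (⟨app (op B)† (heat (op T) t y), hmem⟩ : D) = ⟨_, h.eigen.jbInv_mem _⟩ :=
    Subtype.ext e1
  have e3 : tildeInvSq (op T) (heat (op T) t x) = (⟨_, h.eigen.jbInv_mem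
      (diag f (fun i => ((jb (μ i) * tinv (μ i) : ℝ) : ℂ)) (diag f
      (fun i => (Real.exp (-t * μ i ^ 2) : ℂ)) x))⟩ : D) := by
    rw [h.tildeInvSq_coe]
    refine Subtype.ext ?_
    rw [← h.eigen.heat_eq ht]
    exact h.tinv_eq_jbInv _
  rw [weakForm, dif_pos hmem, e2, e3]
  simp only [← hα, ← hα']
  have e4 : ∀ v : H, ⟪y, diag f (fun i => ((jb (μ i) ^ 2 * Real.exp (-t * μ i ^ 2) : ℝ) : ℂ)) v⟫_ℂ
      = ⟪diag f (fun i => ((jb (μ i) ^ 2 * Real.exp (-t * μ i ^ 2) : ℝ) : ℂ)) y, v⟫_ℂ := fun v => by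
    rw [inner_diag_left hG]
    simp only [Complex.conj_ofReal]
  simp only [mul_apply_eq_comp]
  rw [e4, ← ContinuousLinearMap.adjoint_inner_left β, add_apply, inner_add_right,
    mul_apply_eq_comp, mul_apply_eq_comp, ContinuousLinearMap.adjoint_inner_right,
    ContinuousLinearMap.adjoint_inner_right]

theorem smul_jbInv_basis (i : ι) : f i = (jb (μ i) : ℂ) • jbInv f μ (f i) := by
  rw [jbInv_basis, smul_smul, Complex.ofReal_inv, mul_inv_cancel₀ (jb_ne _), one_smul]

theorem apply_basis_of_comp (h : VarData T T' B f μ δ) {Y : D →ₗ[ℂ] H} {γ : H →L[ℂ] H}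
    (hγ : ∀ x, γ x = Y ⟨jbInv f μ x, h.eigen.jbInv_mem x⟩) (i : ι) :
    Y ⟨f i, h.eigen.mem i⟩ = (jb (μ i) : ℂ) • γ (f i) := by
  rw [hγ, ← map_smul]
  congr 1
  exact Subtype.ext (smul_jbInv_basis i)

theorem apply_apply_basis_of_comp (h : VarData T T' B f μ δ)
    (hβ : ∀ x, β x = B ⟨jbInv f μ x, h.eigen.jbInv_mem x⟩) {Y : D →ₗ[ℂ] H} {γ : H →L[ℂ] H}
    (hγ : ∀ x, γ x = Y ⟨jbInv f μ x, h.eigen.jbInv_mem x⟩) (i : ι) :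
    Y ⟨B ⟨f i, h.eigen.mem i⟩, h.apply_basis_mem i⟩ = ((jb (μ i) ^ 2 : ℝ) : ℂ) • γ (β (f i)) := by
  rw [hγ, ← map_smul]
  congr 1
  exact Subtype.ext (h.apply_basis_eq hβ i)

theorem coef_eq (h : VarData T T' B f μ δ)
    (hβ : ∀ x, β x = B ⟨jbInv f μ x, h.eigen.jbInv_mem x⟩)
    (hα : ∀ x, α x = T ⟨jbInv f μ x, h.eigen.jbInv_mem x⟩)
    (hα' : ∀ x, α' x = T' ⟨jbInv f μ x, h.eigen.jbInv_mem x⟩) (i : ι) :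
    h.coef i = ((jb (μ i) ^ 3 : ℝ) : ℂ) *
      ⟪f i, ((α'.adjoint * α + α.adjoint * α') * β) (f i)⟫_ℂ := by
  rw [coef, h.apply_apply_basis_of_comp hβ hα, h.apply_apply_basis_of_comp hβ hα',
    h.apply_basis_of_comp hα, h.apply_basis_of_comp hα', mul_apply_eq_comp,
    add_apply, inner_add_right, mul_apply_eq_comp, mul_apply_eq_comp,
    ContinuousLinearMap.adjoint_inner_right, ContinuousLinearMap.adjoint_inner_right]
  simp only [inner_smul_left, inner_smul_right, Complex.conj_ofReal]
  push_cast
  ring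

/-- `β† f i = 0` for `f i` in the kernel. -/
theorem adjoint_basis_eq_zero (h : VarData T T' B f μ δ)
    (hβ : ∀ x, β x = B ⟨jbInv f μ x, h.eigen.jbInv_mem x⟩) {i : ι} (hi : μ i = 0) :
    β.adjoint (f i) = 0 := by
  refine hilbertBasis_ext f fun j => ?_
  rw [ContinuousLinearMap.adjoint_inner_right, inner_zero_right]
  have e : β (f j) = ((jb (μ j) : ℂ))⁻¹ • B ⟨f j, h.eigen.mem j⟩ := by
    rw [h.apply_basis_of_comp hβ, smul_smul, inv_mul_cancel₀ (jb_ne _), one_smul]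
  rw [e, inner_smul_left]
  by_cases hj : μ j = 0
  · rw [h.ker j (h.eigen.mem j) hj]; simp
  · rw [← inner_conj_symm, h.eigen.inner_eq_zero_of_sq_ne h.comm]
    · simp
    · rw [hi]; simpa using (pow_ne_zero 2 hj).symm

theorem summable_weak (hs : Summable fun i => (1 + μ i ^ 2) ^ (-(p / 2))) {t : ℝ} (ht : 0 < t)
    {g : ι → ℂ} {C : ℝ} (hg : ∀ i, ‖g i‖ ≤ C * jb (μ i) ^ 2) :
    Summable fun i => ‖g i * (Real.exp (-t * μ i ^ 2) : ℂ)‖ := by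
  obtain ⟨K, hK⟩ := isBdd_mul_exp (μ := μ) (g := g) (C := C) (k := 1)
    (fun i => by rw [pow_one, ← jb_sq]; exact hg i) (half_pos ht)
  have h1 := summable_exp hs (half_pos ht)
  refine Summable.of_nonneg_of_le (fun i => norm_nonneg _) (fun i => ?_) (h1.mul_left K)
  rw [← exp_half_mul_exp_half, ← mul_assoc, norm_mul]
  exact mul_le_mul_of_nonneg_right (hK i) (norm_nonneg _)

/-- The weak operator is trace class, with its trace in two forms. -/
theorem weak_traceClass (h : VarData T T' B f μ δ)
    (hs : Summable fun i => (1 + μ i ^ 2) ^ (-(p / 2)))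
    (hβ : ∀ x, β x = B ⟨jbInv f μ x, h.eigen.jbInv_mem x⟩)
    (hα : ∀ x, α x = T ⟨jbInv f μ x, h.eigen.jbInv_mem x⟩)
    (hα' : ∀ x, α' x = T' ⟨jbInv f μ x, h.eigen.jbInv_mem x⟩) {t : ℝ} (ht : 0 < t) :
    ∃ L : H →L[ℂ] H, MemSchatten 1 L ∧
      (∀ y x, ⟪y, L x⟫_ℂ = weakForm T T' B (heat (op T) (t / 2) y) (heat (op T) (t / 2) x)) ∧
      HasSum (fun i => (((jb (μ i) ^ 3 * tinv (μ i) : ℝ) : ℂ) *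
        ⟪f i, (β * (α'.adjoint * α + α.adjoint * α')) (f i)⟫_ℂ) *
        (Real.exp (-t * μ i ^ 2) : ℂ)) (trace L) ∧
      HasSum (fun i => (((jb (μ i) ^ 3 * tinv (μ i) : ℝ) : ℂ) *
        ⟪f i, ((α'.adjoint * α + α.adjoint * α') * β) (f i)⟫_ℂ) *
        (Real.exp (-t * μ i ^ 2) : ℂ)) (trace L) := by
  have hh := half_pos ht
  set Φ := α'.adjoint * α + α.adjoint * α' with hΦ
  set G := diag f (fun i => ((jb (μ i) ^ 2 * Real.exp (-(t / 2) * μ i ^ 2) : ℝ) : ℂ)) with hG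
  set P := diag f (fun i => ((jb (μ i) * tinv (μ i) : ℝ) : ℂ)) with hP
  set E := diag f (fun i => (Real.exp (-(t / 2) * μ i ^ 2) : ℂ)) with hE
  have bG := isBdd_jb_pow_mul_exp μ 2 hh
  have bP := h.isBdd_jb_mul_tinv
  have bE := isBdd_exp μ hh
  have sE := summable_exp hs hh
  have nE := isNuclear_diag (f := f) sE
  have key : ∀ i, (Real.exp (-(t / 2) * μ i ^ 2) : ℂ) * (((jb (μ i) * tinv (μ i) : ℝ) : ℂ) *
      ((jb (μ i) ^ 2 * Real.exp (-(t / 2) * μ i ^ 2) : ℝ) : ℂ)) =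
      ((jb (μ i) ^ 3 * tinv (μ i) : ℝ) : ℂ) * (Real.exp (-t * μ i ^ 2) : ℂ) := fun i => by
    rw [← exp_half_mul_exp_half t]; push_cast; ring
  -- One trace in two expansions: the order βΦ gives the diagonal of the literal composition B(T'T +
  -- TT')T̃⁻², while the order Φβ gives the coefficients `coef` that arise from differentiation.
  refine ⟨G * β * Φ * P * E, (memSchatten_one_diag sE).one_mul_left _,
    fun y x => (h.weakForm_heat hβ hα hα' hh y x).symm, ?_, ?_⟩
  · have h1 := hasSum_trace_mul_diag (f := f) sE (G * β * Φ * P)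
    convert! h1 using 1
    funext i
    have e : ∀ v, ⟪f i, G v⟫_ℂ = _ := fun v => inner_diag bG v i
    simp only [mul_apply_eq_comp]
    rw [e, hP, diag_basis bP, map_smul, map_smul, inner_smul_right, mul_right_comm, ← key]
    ring
  · have bEGP : IsBdd fun i => (Real.exp (-(t / 2) * μ i ^ 2) : ℂ) *
        (((jb (μ i) * tinv (μ i) : ℝ) : ℂ) *
        ((jb (μ i) ^ 2 * Real.exp (-(t / 2) * μ i ^ 2) : ℝ) : ℂ)) := bE.mul (bP.mul bG)
    -- By cyclicity Gβ moves to the right of the nuclear operator ΦPE. Then EPG is a function of T²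
    -- and commutes with β.
    have hcyc : trace (G * β * Φ * P * E : H →L[ℂ] H) = trace (Φ * β *
        diag f (fun i => ((jb (μ i) ^ 3 * tinv (μ i) : ℝ) : ℂ) *
          (Real.exp (-t * μ i ^ 2) : ℂ)) : H →L[ℂ] H) := by
      have e1 : G * β * Φ * P * E = (G * β) * (Φ * P * E) := by simp only [mul_assoc]
      rw [e1, (nE.mul_left (Φ * P)).trace_mul_comm (G * β)]
      have e2 : E * (P * G) = diag f (fun i => ((jb (μ i) ^ 3 * tinv (μ i) : ℝ) : ℂ) *
          (Real.exp (-t * μ i ^ 2) : ℂ)) := by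
        rw [hP, hG, diag_mul_diag bP bG, hE, diag_mul_diag bE (bP.mul bG)]
        simp only [key]
      have e3 : P * E = E * P := by
        rw [hP, hE, diag_mul_diag bP bE, diag_mul_diag bE bP]
        simp only [mul_comm]
      rw [← e2, mul_assoc Φ P E, e3]
      have e4 : E * (P * G) * β = β * (E * (P * G)) := by
        symm
        refine h.eigen.comp_commute_diag h.comm (isBdd_jb_inv μ) (isBdd_mul_jb_inv μ)
          (g := fun i => ((jb (μ i) ^ 3 * tinv (μ i) : ℝ) : ℂ) *
          (Real.exp (-t * μ i ^ 2) : ℂ)) ?_ ?_ hβ |>.trans ?_ |> fun h => (by rw [e2]; exact h)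
        · simpa only [key] using bEGP
        · intro i j hij
          rw [jb, jb, tinv_eq_of_sq_eq hij, hij]
        · rfl
      have e5 : Φ * (E * P) * (G * β) = Φ * (E * (P * G) * β) := by simp only [mul_assoc]
      rw [e5, e4, mul_assoc Φ β]
    rw [hcyc]
    have sg : Summable fun i => ‖((jb (μ i) ^ 3 * tinv (μ i) : ℝ) : ℂ) *
          (Real.exp (-t * μ i ^ 2) : ℂ)‖ := by
      refine summable_weak hs ht (C := 1 + (δ ^ 2)⁻¹) fun i => ?_
      rw [Complex.norm_real, Real.norm_of_nonneg
        (mul_nonneg (pow_nonneg (jb_pos _).le _) (tinv_nonneg _))]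
      have h1 := h.jb_sq_mul_tinv_le i
      have h2 := one_le_jb (μ i)
      have h3 : 0 ≤ 1 + (δ ^ 2)⁻¹ := by positivity
      calc jb (μ i) ^ 3 * tinv (μ i) = (jb (μ i) ^ 2 * tinv (μ i)) * jb (μ i) := by ring
        _ ≤ (1 + (δ ^ 2)⁻¹) * jb (μ i) := by gcongr
        _ ≤ (1 + (δ ^ 2)⁻¹) * jb (μ i) ^ 2 := by gcongr; nlinarith
    have h1 := hasSum_trace_mul_diag (f := f) sg (Φ * β)
    convert! h1 using 1
    funext i
    ring

/-- By the gap, T̃⁻² compensates two of the three factors ⟨μ_i⟩, so the weak operator again has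
order one. -/
theorem norm_weak_coeff_le (h : VarData T T' B f μ δ) (X : H →L[ℂ] H) (i : ι) :
    ‖((jb (μ i) ^ 3 * tinv (μ i) : ℝ) : ℂ) * ⟪f i, X (f i)⟫_ℂ‖
      ≤ (1 + (δ ^ 2)⁻¹) * ‖X‖ * (1 + μ i ^ 2) ^ (1 / 2 : ℝ) := by
  rw [norm_mul, Complex.norm_real, Real.norm_of_nonneg
        (mul_nonneg (pow_nonneg (jb_pos _).le _) (tinv_nonneg _)), ← jb_eq_rpow]
  have h1 := h.jb_sq_mul_tinv_le i
  have h2 : ‖⟪f i, X (f i)⟫_ℂ‖ ≤ ‖X‖ := by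
    have := (norm_inner_le_norm (𝕜 := ℂ) (f i) (X (f i))).trans
      (mul_le_mul_of_nonneg_left (X.le_opNorm (f i)) (norm_nonneg _))
    simpa [f.orthonormal.1 i] using this
  have := jb_pos (μ i)
  calc jb (μ i) ^ 3 * tinv (μ i) * ‖⟪f i, X (f i)⟫_ℂ‖
      = (jb (μ i) ^ 2 * tinv (μ i)) * ‖⟪f i, X (f i)⟫_ℂ‖ * jb (μ i) := by ring
    _ ≤ _ := by gcongr

end Regularized

theorem etaWeakDefined (h : VarData T T' B f μ δ) (hp : 0 < p)
    (hs : Summable fun i => (1 + μ i ^ 2) ^ (-(p / 2))) {s : ℂ} (hps : p < s.re) :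
    EtaWeakDefined (op T) (weakForm T T' B) s ∧
      HasSum (fun i => (h.coef i * (tinv (μ i) : ℂ)) / ((μ i ^ 2 : ℝ) : ℂ) ^ ((s + 1) / 2))
        (etaWeak (op T) (weakForm T T' B) s) := by
  obtain ⟨β, hβ⟩ := h.eigen.exists_comp_jbInv h.relB
  obtain ⟨α, hα⟩ := h.eigen.exists_comp_jbInv (relBdd_self T)
  obtain ⟨α', hα'⟩ := h.eigen.exists_comp_jbInv h.relT'
  have e : ∀ i, h.coef i * (tinv (μ i) : ℂ) = ((jb (μ i) ^ 3 * tinv (μ i) : ℝ) : ℂ) *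
        ⟪f i, ((α'.adjoint * α + α.adjoint * α') * β) (f i)⟫_ℂ := fun i => by
    rw [h.coef_eq hβ hα hα']; push_cast; ring
  refine IsEigenbasis.etaWeakDefined hp hs (fun t ht => ?_) (fun i => ?_)
    (fun i => (congrArg norm (e i)).le.trans (h.norm_weak_coeff_le _ i)) hps
  · obtain ⟨L, h1, h2, -, h3⟩ := h.weak_traceClass hs hβ hα hα' ht
    exact ⟨L, h1, h2, by simpa only [e] using h3⟩
  · by_cases hi : μ i = 0
    · exact Or.inl (by rw [h.coef_eq_zero i hi, zero_mul])
    · exact Or.inr hi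

/-- The operator `T' B T T̃⁻²`. -/
theorem etaDefined_simplified (h : VarData T T' B f μ δ) (hp : 0 < p)
    (hs : Summable fun i => (1 + μ i ^ 2) ^ (-(p / 2))) {s : ℂ} (hps : p < s.re) :
    EtaDefined (op T) (fun x => app (op T') (app (op B) (app (op T) (tildeInvSq (op T) x)))) s ∧
      HasSum (fun i => ((μ i : ℂ) * (tinv (μ i) : ℂ) *
        ⟪f i, T' ⟨B ⟨f i, h.eigen.mem i⟩, h.apply_basis_mem i⟩⟫_ℂ) /
          ((μ i ^ 2 : ℝ) : ℂ) ^ ((s + 1) / 2))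
        (eta (op T) (fun x => app (op T') (app (op B) (app (op T) (tildeInvSq (op T) x)))) s) := by
  obtain ⟨β, hβ⟩ := h.eigen.exists_comp_jbInv h.relB
  obtain ⟨α', hα'⟩ := h.eigen.exists_comp_jbInv h.relT'
  have e : ∀ i, (μ i : ℂ) * (tinv (μ i) : ℂ) *
        ⟪f i, T' ⟨B ⟨f i, h.eigen.mem i⟩, h.apply_basis_mem i⟩⟫_ℂ =
        (μ i : ℂ) * ((jb (μ i) ^ 2 * tinv (μ i) : ℝ) : ℂ) * ⟪f i, (α' * β) (f i)⟫_ℂ := fun i => by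
    rw [h.apply_apply_basis_of_comp hβ hα', inner_smul_right, mul_apply_eq_comp]; push_cast; ring
  have hN : ∀ i, ‖(μ i : ℂ) * ((jb (μ i) ^ 2 * tinv (μ i) : ℝ) : ℂ)‖
      ≤ (1 + (δ ^ 2)⁻¹) * jb (μ i) := fun i => by
    rw [norm_mul, Complex.norm_real, Complex.norm_real, Real.norm_eq_abs, Real.norm_of_nonneg
        (mul_nonneg (pow_nonneg (jb_pos _).le _) (tinv_nonneg _)), mul_comm]
    exact mul_le_mul (h.jb_sq_mul_tinv_le i) (abs_le_jb _) (abs_nonneg _) (by positivity)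
  refine IsEigenbasis.etaDefined hp hs (f := f) (C := (1 + (δ ^ 2)⁻¹) * ‖α' * β‖)
    (fun t ht => ?_) (fun i => ?_) (fun i => ?_) hps
  · have hh := half_pos ht
    have bE := isBdd_exp μ hh
    have bM : IsBdd fun i => (μ i : ℂ) * ((jb (μ i) ^ 2 * tinv (μ i) : ℝ) : ℂ) *
        (Real.exp (-(t / 2) * μ i ^ 2) : ℂ) :=
      isBdd_mul_exp (k := 1) (C := 1 + (δ ^ 2)⁻¹) (fun i => (hN i).trans (by
        rw [pow_one, ← jb_sq]
        exact mul_le_mul_of_nonneg_left (by nlinarith [one_le_jb (μ i)]) (by positivity))) hh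
    refine ⟨α' * β * diag f (fun i => (μ i : ℂ) * ((jb (μ i) ^ 2 * tinv (μ i) : ℝ) : ℂ) *
        (Real.exp (-(t / 2) * μ i ^ 2) : ℂ)), fun x => ?_, fun i => ?_⟩
    -- Two factors ⟨T⟩⁻¹ are split off, one to make B bounded and one for T'. They commute with β,
    -- so the second can be moved past B.
    · set v := diag f (fun i => (μ i : ℂ) * ((jb (μ i) ^ 2 * tinv (μ i) : ℝ) : ℂ) *
        (Real.exp (-(t / 2) * μ i ^ 2) : ℂ)) (diag f
          (fun i => (Real.exp (-(t / 2) * μ i ^ 2) : ℂ)) x) with hv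
      have e1 : app (op T) (tildeInvSq (op T) (heat (op T) t x))
          = jbInv f μ (jbInv f μ v) := by
        rw [app_tildeInvSq, h.tildeInvSq_coe, h.eigen.apply_diag h.isBdd_tinv h.isBdd_mul_tinv,
          h.eigen.heat_eq ht]
        refine hilbertBasis_ext f fun i => ?_
        rw [inner_diag h.isBdd_mul_tinv, inner_diag (isBdd_exp μ ht), jbInv,
          inner_diag (isBdd_jb_inv μ), inner_diag (isBdd_jb_inv μ), hv, inner_diag bM,
          inner_diag bE, ← exp_half_mul_exp_half t]
        have := jb_ne (μ i)
        push_cast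
        field_simp
      rw [e1, app_op B (h.eigen.jbInv_mem _), ← hβ, h.jbInv_commute hβ,
        app_op T' (h.eigen.jbInv_mem _), ← hα']
      rfl
    · rw [e, mul_apply_eq_comp, diag_basis bM, map_smul, inner_smul_right]
      ring
  · by_cases hi : μ i = 0
    · exact Or.inl (by rw [hi]; simp)
    · exact Or.inr hi
  · rw [e, norm_mul, ← jb_eq_rpow]
    have h2 : ‖⟪f i, (α' * β) (f i)⟫_ℂ‖ ≤ ‖α' * β‖ := by
      have := (norm_inner_le_norm (𝕜 := ℂ) (f i) ((α' * β) (f i))).trans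
        (mul_le_mul_of_nonneg_left ((α' * β).le_opNorm (f i)) (norm_nonneg _))
      simpa [f.orthonormal.1 i] using this
    have h3 : 0 ≤ (1 + (δ ^ 2)⁻¹) * jb (μ i) := mul_nonneg (by positivity) (jb_pos _).le
    calc _ ≤ _ := mul_le_mul (hN i) h2 (norm_nonneg _) h3
      _ = _ := by ring

/-- Commuting with (T+i)^(-1) makes B f_i an eigenvector of T for μ_i itself, not only of T² for
μ_i². Symmetry of T' then makes both pairings equal. -/
theorem coef_eq_of_commute (h : VarData T T' B f μ δ)
    (hc : CommutesWithResolvents (op B) (op T)) (i : ι) :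
    h.coef i = 2 * μ i * ⟪f i, T' ⟨B ⟨f i, h.eigen.mem i⟩, h.apply_basis_mem i⟩⟫_ℂ := by
  have hb := isBdd_res μ
  obtain ⟨hm, e⟩ := hc _ _ h.eigen.isResolventAt ⟨f i, h.eigen.mem i⟩
  have e1 : (⟨diag f (fun i => ((μ i : ℂ) + Complex.I)⁻¹) (f i), hm⟩ : D)
      = ((μ i : ℂ) + Complex.I)⁻¹ • ⟨f i, h.eigen.mem i⟩ := Subtype.ext (diag_basis hb i)
  have e2 : ((μ i : ℂ) + Complex.I)⁻¹ • B ⟨f i, h.eigen.mem i⟩ =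
      diag f (fun i => ((μ i : ℂ) + Complex.I)⁻¹) (B ⟨f i, h.eigen.mem i⟩) := by
    rw [← map_smul, ← e1]; exact e
  have e3 : T ⟨B ⟨f i, h.eigen.mem i⟩, h.apply_basis_mem i⟩
      = (μ i : ℂ) • B ⟨f i, h.eigen.mem i⟩ := by
    refine hilbertBasis_ext f fun j => ?_
    rw [h.eigen.inner_apply, inner_smul_right]
    have := congrArg (fun v => ⟪f j, v⟫_ℂ) e2
    simp only [inner_smul_right, inner_diag hb] at this
    rw [← sub_eq_zero, ← sub_mul] at this
    rcases mul_eq_zero.mp this with h1 | h1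
    · have h2 := inv_injective (sub_eq_zero.mp h1)
      rw [add_left_inj] at h2
      rw [h2]
    · rw [h1, mul_zero, mul_zero]
  rw [coef, e3, h.eigen.apply_basis, inner_smul_right, inner_smul_left, Complex.conj_ofReal,
    h.symm ⟨f i, h.eigen.mem i⟩ ⟨_, h.apply_basis_mem i⟩]
  ring

end VarData

end EtaVar

namespace EtaVar

variable {H : Type*} [NormedAddCommGroup H] [InnerProductSpace ℂ H] [CompleteSpace H]
variable {D : Submodule ℂ H} {T T' B : D →ₗ[ℂ] H} {ι : Type} {f : HilbertBasis ι ℂ H} {μ : ι → ℝ}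
  {p δ : ℝ}

/-! ### The composition `B (A' A + A A') Ã⁻²` -/

/-- A linear map on `H` with continuous matrix coefficients is bounded. -/
theorem continuous_of_inner_eq (f : HilbertBasis ι ℂ H) (Y : H →ₗ[ℂ] H) (k : ι → H →L[ℂ] ℂ)
    (hk : ∀ i x, ⟪f i, Y x⟫_ℂ = k i x) : Continuous Y := by
  refine LinearMap.continuous_of_seq_closed_graph Y fun u x y hu hy => hilbertBasis_ext f fun i => ?_
  rw [hk]
  refine tendsto_nhds_unique (Filter.Tendsto.inner tendsto_const_nhds hy) ?_
  simp only [Function.comp_apply, hk]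
  exact ((k i).continuous.tendsto x).comp hu

namespace VarData

variable {β α α' : H →L[ℂ] H}

/-- Besides showing that ⟨f_i, B ·⟩ is continuous, the formula represents it by a vector of D, so
that it can be inserted into the form (d/da)T². -/
theorem inner_basis_apply (h : VarData T T' B f μ δ)
    (hβ : ∀ x, β x = B ⟨jbInv f μ x, h.eigen.jbInv_mem x⟩) (i : ι) (v : D) :
    ⟪f i, B v⟫_ℂ = ((jb (μ i) ^ 2 : ℝ) : ℂ) * ⟪jbInv f μ (β.adjoint (f i)), (v : H)⟫_ℂ := by
  have e : f i = (jb (μ i) ^ 2 : ℂ) • jbInv f μ (jbInv f μ (f i)) := by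
    rw [jbInv_basis, map_smul, jbInv_basis, smul_smul, smul_smul, Complex.ofReal_inv]
    have := jb_ne (μ i)
    rw [mul_assoc, ← mul_inv, ← pow_two, mul_inv_cancel₀ (pow_ne_zero 2 this), one_smul]
  conv_lhs => rw [e]
  rw [inner_smul_left, h.inner_apply_jbInv hβ, h.adjoint_jbInv_commute hβ]
  congr 1
  rw [map_pow, Complex.conj_ofReal, Complex.ofReal_pow]

theorem mem_apply_tinv (h : VarData T T' B f μ δ) (x : H) :
    T (tildeInvSq (op T) x) ∈ D := by
  rw [h.tildeInvSq_coe, h.eigen.apply_diag h.isBdd_tinv h.isBdd_mul_tinv]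
  exact h.eigen.diag_mem h.isBdd_mul_tinv (isBdd_mul_mul_tinv μ) x

/-- Where the composition is defined, symmetry of T and T' moves one factor of each product to the
other side; tested against D, the composition is the weak form. -/
theorem exists_literal (h : VarData T T' B f μ δ)
    (hl : ∀ x : D, T' (tildeInvSq (op T) x) ∈ D ∧
      app (op T') (app (op T) (tildeInvSq (op T) x)) +
        app (op T) (app (op T') (tildeInvSq (op T) x)) ∈ D) :
    ∃ V : D →ₗ[ℂ] D, (∀ x : D, (V x : H) = app (op T') (app (op T) (tildeInvSq (op T) x)) +
        app (op T) (app (op T') (tildeInvSq (op T) x))) ∧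
      ∀ u x : D, ⟪(u : H), (V x : H)⟫_ℂ = ⟪T' u, T (tildeInvSq (op T) x)⟫_ℂ +
        ⟪T u, T' (tildeInvSq (op T) x)⟫_ℂ := by
  let N : D →ₗ[ℂ] D := LinearMap.codRestrict D
    ((diag f (fun i => ((tinv (μ i) : ℝ) : ℂ)) : H →ₗ[ℂ] H) ∘ₗ D.subtype)
    fun x => h.eigen.diag_mem h.isBdd_tinv h.isBdd_mul_tinv x
  have hN : ∀ x : D, N x = tildeInvSq (op T) x := fun x => (h.tildeInvSq_coe x).symm
  let TN : D →ₗ[ℂ] D := LinearMap.codRestrict D (T ∘ₗ N) fun x => by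
    rw [LinearMap.comp_apply, hN]; exact h.mem_apply_tinv x
  let T'N : D →ₗ[ℂ] D := LinearMap.codRestrict D (T' ∘ₗ N) fun x => by
    rw [LinearMap.comp_apply, hN]; exact (hl x).1
  have e1 : ∀ x : D, app (op T') (app (op T) (tildeInvSq (op T) x)) = T' (TN x) := fun x => by
    rw [app_tildeInvSq, app_op T' (h.mem_apply_tinv x)]
    exact congrArg T' (Subtype.ext (congrArg T (hN x).symm))
  have e2 : ∀ x : D, app (op T) (app (op T') (tildeInvSq (op T) x)) = T (T'N x) := fun x => by
    rw [app_tildeInvSq, app_op T (hl x).1]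
    exact congrArg T (Subtype.ext (congrArg T' (hN x).symm))
  refine ⟨LinearMap.codRestrict D (T' ∘ₗ TN + T ∘ₗ T'N) fun x => ?_, fun x => ?_, fun u x => ?_⟩
  · have := (hl x).2
    rwa [e1, e2] at this
  · rw [e1, e2]; rfl
  · change ⟪(u : H), T' (TN x) + T (T'N x)⟫_ℂ = _
    rw [inner_add_right, ← h.symm, ← h.eigen.inner_symm, ← hN]
    rfl

/-- Where it is defined, the composition has the `η`-function of the weak operator. -/
theorem literal (h : VarData T T' B f μ δ) (hp : 0 < p)
    (hs : Summable fun i => (1 + μ i ^ 2) ^ (-(p / 2))) {s : ℂ} (hps : p < s.re)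
    (hl : ∀ x : D, T' (tildeInvSq (op T) x) ∈ D ∧
      app (op T') (app (op T) (tildeInvSq (op T) x)) +
        app (op T) (app (op T') (tildeInvSq (op T) x)) ∈ D) :
    EtaDefined (op T) (fun x => app (op B) (app (op T') (app (op T) (tildeInvSq (op T) x)) +
        app (op T) (app (op T') (tildeInvSq (op T) x)))) s ∧
    etaWeak (op T) (weakForm T T' B) s =
      eta (op T) (fun x => app (op B) (app (op T') (app (op T) (tildeInvSq (op T) x)) +
        app (op T) (app (op T') (tildeInvSq (op T) x)))) s := by
  obtain ⟨β, hβ⟩ := h.eigen.exists_comp_jbInv h.relB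
  obtain ⟨α, hα⟩ := h.eigen.exists_comp_jbInv (relBdd_self T)
  obtain ⟨α', hα'⟩ := h.eigen.exists_comp_jbInv h.relT'
  obtain ⟨V, hV, hVi⟩ := h.exists_literal hl
  have hin : ∀ (i : ι) (x : D), ⟪f i, B (V x)⟫_ℂ = ((jb (μ i) ^ 2 : ℝ) : ℂ) *
      (⟪α' (β.adjoint (f i)), T (tildeInvSq (op T) x)⟫_ℂ +
        ⟪α (β.adjoint (f i)), T' (tildeInvSq (op T) x)⟫_ℂ) := fun i x => by
    rw [h.inner_basis_apply hβ, hα, hα', ← hVi ⟨_, h.eigen.jbInv_mem _⟩]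
  have hNP : ∀ x : H, tildeInvSq (op T) x = (⟨_, h.eigen.jbInv_mem
      (diag f (fun i => ((jb (μ i) * tinv (μ i) : ℝ) : ℂ)) x)⟩ : D) := fun x => by
    rw [h.tildeInvSq_coe]
    exact Subtype.ext (h.tinv_eq_jbInv x)
  set P := diag f (fun i => ((jb (μ i) * tinv (μ i) : ℝ) : ℂ)) with hP
  have hTN : ∀ x : H, T (tildeInvSq (op T) x) = α (P x) := fun x => by rw [hNP, hα]
  have hT'N : ∀ x : H, T' (tildeInvSq (op T) x) = α' (P x) := fun x => by rw [hNP, hα']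
  -- relative boundedness by the closed graph theorem
  have hrel : RelBdd T (B ∘ₗ V) := by
    set S := diag f (fun i => ((μ i : ℂ) + Complex.I)⁻¹) with hS
    let SD : H →ₗ[ℂ] D := LinearMap.codRestrict D (S : H →ₗ[ℂ] H) h.eigen.res_mem
    have hcont : Continuous (B ∘ₗ V ∘ₗ SD) := by
      refine continuous_of_inner_eq f _ (fun i => ((jb (μ i) ^ 2 : ℝ) : ℂ) •
        ((innerSL ℂ (α' (β.adjoint (f i)))).comp (α * P * S) +
          (innerSL ℂ (α (β.adjoint (f i)))).comp (α' * P * S))) fun i x => ?_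
      rw [LinearMap.comp_apply, LinearMap.comp_apply, hin, hTN, hT'N]
      rfl
    let Y : H →L[ℂ] H := ⟨B ∘ₗ V ∘ₗ SD, hcont⟩
    refine ⟨‖Y‖, norm_nonneg _, fun x => ?_⟩
    have e : (B ∘ₗ V) x = Y (T x + Complex.I • (x : H)) := by
      change B (V x) = B (V (SD _))
      congr 2
      exact Subtype.ext (h.eigen.res_apply x).symm
    rw [e]
    refine (Y.le_opNorm _).trans (mul_le_mul_of_nonneg_left ?_ (norm_nonneg _))
    refine (norm_add_le _ _).trans ?_
    rw [norm_smul, Complex.norm_I, one_mul, add_comm]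
  -- diagonal entries
  have hd : ∀ i, ⟪f i, (B ∘ₗ V) ⟨f i, h.eigen.mem i⟩⟫_ℂ =
      ((jb (μ i) ^ 3 * tinv (μ i) : ℝ) : ℂ) *
        ⟪f i, (β * (α'.adjoint * α + α.adjoint * α')) (f i)⟫_ℂ := fun i => by
    rw [LinearMap.comp_apply, hin, hTN, hT'N, mul_apply_eq_comp,
      ← ContinuousLinearMap.adjoint_inner_left β, add_apply, inner_add_right, mul_apply_eq_comp,
      mul_apply_eq_comp, ContinuousLinearMap.adjoint_inner_right,
      ContinuousLinearMap.adjoint_inner_right, hP, diag_basis h.isBdd_jb_mul_tinv, map_smul,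
      map_smul, inner_smul_right, inner_smul_right]
    push_cast
    ring
  have hd0 : ∀ i, μ i = 0 → ⟪f i, (β * (α'.adjoint * α + α.adjoint * α')) (f i)⟫_ℂ = 0 :=
    fun i hi => by
      rw [mul_apply_eq_comp, ← ContinuousLinearMap.adjoint_inner_left β,
        h.adjoint_basis_eq_zero hβ hi, inner_zero_left]
  have h1 := h.eigen.etaDefined_of_relBdd hp hs hrel (fun i hi => by rw [hd, hd0 i hi, mul_zero])
    hps
  have h2 := (IsEigenbasis.etaWeakDefined hp hs (fun t ht => by
    obtain ⟨L, h1, h2, h3, -⟩ := h.weak_traceClass hs hβ hα hα' ht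
    exact ⟨L, h1, h2, h3⟩) (fun i => by
      by_cases hi : μ i = 0
      · exact Or.inl (by rw [hd0 i hi, mul_zero])
      · exact Or.inr hi) (fun i => h.norm_weak_coeff_le _ i) hps).2
  -- identification on the range of the heat operator
  have hZ : ∀ t, 0 < t → (fun x => app (op (B ∘ₗ V)) (heat (op T) t x)) = fun x =>
      app (op B) (app (op T') (app (op T) (tildeInvSq (op T) (heat (op T) t x))) +
        app (op T) (app (op T') (tildeInvSq (op T) (heat (op T) t x)))) := fun t ht => by
    funext x
    have hm : heat (op T) t x ∈ D := by
      rw [h.eigen.heat_eq ht]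
      exact h.eigen.diag_mem (isBdd_exp μ ht) (by simpa using isBdd_pow_mul_exp μ 1 ht) x
    rw [app_op _ hm, LinearMap.comp_apply, ← hV ⟨_, hm⟩, app_op_coe]
  have hI : ∀ t ∈ Set.Ioi (0 : ℝ), (t : ℂ) ^ ((s - 1) / 2) *
      (trace fun x => app (op (B ∘ₗ V)) (heat (op T) t x)) = (t : ℂ) ^ ((s - 1) / 2) * trace fun x =>
      app (op B) (app (op T') (app (op T) (tildeInvSq (op T) (heat (op T) t x))) +
        app (op T) (app (op T') (tildeInvSq (op T) (heat (op T) t x)))) := fun t ht => by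
    rw [hZ t ht]
  refine ⟨⟨fun t ht => ?_, ?_⟩, ?_⟩
  · rw [← hZ t ht]; exact h1.1.1 t ht
  · exact (MeasureTheory.integrableOn_congr_fun hI measurableSet_Ioi).mp h1.1.2
  · rw [h2.unique (by simpa only [hd] using h1.2), eta, eta, etaMellin, etaMellin,
      MeasureTheory.setIntegral_congr_fun measurableSet_Ioi hI]

end VarData

end EtaVar

namespace EtaVar

variable {H : Type*} [NormedAddCommGroup H] [InnerProductSpace ℂ H] [CompleteSpace H]
variable {D : Submodule ℂ H} {T T₂ B : D →ₗ[ℂ] H} {ι : Type} {f : HilbertBasis ι ℂ H} {μ : ι → ℝ}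
  {p δ : ℝ}

/-! ### Families with a fixed domain -/

theorem IsEigenbasis.relBdd_of_continuous (hE : IsEigenbasis T f μ) {Y : D →ₗ[ℂ] H}
    {X : H →L[ℂ] H} (hX : ∀ x, X x = Y ⟨_, hE.res_mem x⟩) : RelBdd T Y := by
  refine ⟨‖X‖, norm_nonneg _, fun x => ?_⟩
  have e : Y x = X (T x + Complex.I • (x : H)) := by
    rw [hX]
    exact congrArg Y (Subtype.ext (hE.res_apply x).symm)
  rw [e]
  refine (X.le_opNorm _).trans (mul_le_mul_of_nonneg_left ?_ (norm_nonneg _))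
  refine (norm_add_le _ _).trans ?_
  rw [norm_smul, Complex.norm_I, one_mul, add_comm]

/-- Two diagonalizable operators with the same domain are relatively bounded. -/
theorem IsEigenbasis.relBdd (hE : IsEigenbasis T f μ) {ι₂ : Type} {f₂ : HilbertBasis ι₂ ℂ H}
    {μ₂ : ι₂ → ℝ} (hE₂ : IsEigenbasis T₂ f₂ μ₂) : RelBdd T T₂ := by
  set S := diag f (fun i => ((μ i : ℂ) + Complex.I)⁻¹) with hS
  let SD : H →ₗ[ℂ] D := LinearMap.codRestrict D (S : H →ₗ[ℂ] H) hE.res_mem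
  -- In the eigenbasis of T₂ the matrix coefficients of T₂(T+i)^(-1) are those of (T+i)^(-1)
  -- multiplied by μ₂, hence continuous; the closed graph theorem applies.
  have hc : Continuous (T₂ ∘ₗ SD) := continuous_of_inner_eq f₂ _
    (fun i => (μ₂ i : ℂ) • (innerSL ℂ (f₂ i)).comp S) fun i x => by
      rw [LinearMap.comp_apply, hE₂.inner_apply]; rfl
  exact hE.relBdd_of_continuous (X := ⟨T₂ ∘ₗ SD, hc⟩) fun x => rfl

theorem RelBdd.trans {T₃ : D →ₗ[ℂ] H} (h : RelBdd T T₂) (h' : RelBdd T₂ T₃) : RelBdd T T₃ := by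
  obtain ⟨C, hC0, hC⟩ := h
  obtain ⟨C', hC'0, hC'⟩ := h'
  refine ⟨C' * (1 + C), by positivity, fun x => (hC' x).trans ?_⟩
  rw [mul_assoc]
  refine mul_le_mul_of_nonneg_left ?_ hC'0
  nlinarith [hC x, norm_nonneg (T x), norm_nonneg (x : H)]

/-! ### Locally uniform relative bounds -/

section Family

variable {J : Set ℝ} {Y Y' : ℝ → D →ₗ[ℂ] H} {a : ℝ}

theorem tendsto_slope_complex {F : ℝ → H} {F' : H} (h : HasDerivAt F F' a) :
    Filter.Tendsto (fun c => (((c - a)⁻¹ : ℝ) : ℂ) • (F c - F a)) (nhdsWithin a {a}ᶜ) (nhds F') := by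
  have := hasDerivAt_iff_tendsto_slope.mp h
  refine this.congr fun c => ?_
  rw [slope_def_module, Complex.coe_smul]

/-- After composition with (T+i)^(-1) the difference quotients are bounded operators converging
pointwise, so their limit is bounded by Banach-Steinhaus. -/
theorem HasStrongDeriv.relBdd_deriv (hJ : IsOpen J) (hY : HasStrongDeriv J Y Y')
    (hE : IsEigenbasis T f μ) (hrel : ∀ b ∈ J, RelBdd T (Y b)) (ha : a ∈ J) : RelBdd T (Y' a) := by
  have h1 : ∀ b, ∃ X : H →L[ℂ] H, b ∈ J → ∀ x, X x = Y b ⟨_, hE.res_mem x⟩ := fun b => by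
    by_cases hb : b ∈ J
    · obtain ⟨X, hX⟩ := hE.exists_comp_diag (hrel b hb) (isBdd_res μ) (isBdd_mul_res μ)
      exact ⟨X, fun _ => hX⟩
    · exact ⟨0, fun h => absurd h hb⟩
  choose X hX using h1
  have h2 : Filter.Tendsto (fun c (x : H) => ((((c - a)⁻¹ : ℝ) : ℂ) • (X c - X a)) x)
      (nhdsWithin a {a}ᶜ) (nhds fun x => Y' a ⟨_, hE.res_mem x⟩) := by
    rw [tendsto_pi_nhds]
    intro x
    refine (tendsto_slope_complex ((hY ⟨_, hE.res_mem x⟩).1 a ha)).congr' ?_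
    filter_upwards [mem_nhdsWithin_of_mem_nhds (hJ.mem_nhds ha)] with c hc
    rw [smul_apply, sub_apply, hX c hc, hX a ha]
  exact hE.relBdd_of_continuous (X := continuousLinearMapOfTendsto _ h2) fun x => rfl

/-- Locally uniform bounds for a strongly differentiable family of relatively bounded operators. -/
theorem HasStrongDeriv.exists_bound (hJ : IsOpen J) (hY : HasStrongDeriv J Y Y')
    (hE : IsEigenbasis T f μ) (hrel : ∀ b ∈ J, RelBdd T (Y b)) (ha : a ∈ J) :
    ∃ ε > 0, ∃ C, 0 ≤ C ∧ Metric.ball a ε ⊆ J ∧ ∀ b ∈ Metric.ball a ε, ∀ x : D,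
      ‖Y' b x‖ ≤ C * (‖(x : H)‖ + ‖T x‖) ∧ ‖Y b x‖ ≤ C * (‖(x : H)‖ + ‖T x‖) ∧
      ‖Y b x - Y a x‖ ≤ C * |b - a| * (‖(x : H)‖ + ‖T x‖) := by
  obtain ⟨ε, hε, hεJ⟩ := Metric.nhds_basis_closedBall.mem_iff.mp (hJ.mem_nhds ha)
  have h1 : ∀ b : Metric.closedBall a ε, ∃ X : H →L[ℂ] H, ∀ x, X x = Y' b ⟨_, hE.res_mem x⟩ :=
    fun b => hE.exists_comp_diag (hY.relBdd_deriv hJ hE hrel (hεJ b.2)) (isBdd_res μ)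
      (isBdd_mul_res μ)
  choose X hX using h1
  -- For fixed x the derivative is continuous in b, hence bounded on the compact ball; uniform
  -- boundedness makes the constant independent of x.
  obtain ⟨M, hM⟩ := banach_steinhaus (g := X) fun x => by
    obtain ⟨M, hM⟩ := (isCompact_closedBall a ε).exists_bound_of_continuousOn
      ((hY ⟨_, hE.res_mem x⟩).2.mono hεJ)
    exact ⟨M, fun b => by rw [hX]; exact hM b b.2⟩
  have hM0 : 0 ≤ M := (norm_nonneg _).trans (hM ⟨a, Metric.mem_closedBall_self hε.le⟩)
  have hb' : ∀ b ∈ Metric.ball a ε, ∀ x : D, ‖Y' b x‖ ≤ M * (‖(x : H)‖ + ‖T x‖) := fun b hb x => by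
    have e : Y' b x = X ⟨b, Metric.ball_subset_closedBall hb⟩ (T x + Complex.I • (x : H)) := by
      rw [hX]
      exact congrArg (Y' b) (Subtype.ext (hE.res_apply x).symm)
    rw [e]
    refine (ContinuousLinearMap.le_of_opNorm_le _ (hM _) _).trans
      (mul_le_mul_of_nonneg_left ?_ hM0)
    refine (norm_add_le _ _).trans ?_
    rw [norm_smul, Complex.norm_I, one_mul, add_comm]
  obtain ⟨C₀, hC₀, hC₀'⟩ := hrel a ha
  have hd : ∀ b ∈ Metric.ball a ε, ∀ x : D,
      ‖Y b x - Y a x‖ ≤ M * |b - a| * (‖(x : H)‖ + ‖T x‖) := fun b hb x => by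
    have := (convex_ball a ε).norm_image_sub_le_of_norm_hasDerivWithin_le
      (f := fun b => Y b x) (f' := fun b => Y' b x)
      (fun c hc => ((hY x).1 c (hεJ (Metric.ball_subset_closedBall hc))).hasDerivWithinAt)
      (fun c hc => hb' c hc x) (Metric.mem_ball_self hε) hb
    rw [Real.norm_eq_abs] at this
    linarith
  -- M bounds the derivative and, by the mean value inequality, the increments; C₀ + Mε bounds the
  -- operators themselves.
  refine ⟨ε, hε, M + C₀ + M * ε, by positivity, Metric.ball_subset_closedBall.trans hεJ,
    fun b hb x => ⟨?_, ?_, ?_⟩⟩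
  · refine (hb' b hb x).trans (mul_le_mul_of_nonneg_right ?_ (by positivity))
    nlinarith
  · have h2 : ‖Y b x‖ ≤ ‖Y a x‖ + ‖Y b x - Y a x‖ := by
      have := norm_add_le (Y a x) (Y b x - Y a x)
      rwa [add_sub_cancel] at this
    have h3 : |b - a| ≤ ε := by
      have := Metric.mem_ball.mp hb
      rw [Real.dist_eq] at this
      exact this.le
    have h4 : M * |b - a| * (‖(x : H)‖ + ‖T x‖) ≤ M * ε * (‖(x : H)‖ + ‖T x‖) := by gcongr
    have h5 : 0 ≤ M * (‖(x : H)‖ + ‖T x‖) := by positivity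
    nlinarith [hd b hb x, hC₀' x]
  · refine (hd b hb x).trans (mul_le_mul_of_nonneg_right ?_ (by positivity))
    refine mul_le_mul_of_nonneg_right ?_ (abs_nonneg _)
    nlinarith

theorem HasStrongDeriv.symm (hY : HasStrongDeriv J Y Y') (hJ : IsOpen J)
    (hs : ∀ b ∈ J, ∀ u v : D, ⟪Y b u, (v : H)⟫_ℂ = ⟪(u : H), Y b v⟫_ℂ) (ha : a ∈ J) (u v : D) :
    ⟪Y' a u, (v : H)⟫_ℂ = ⟪(u : H), Y' a v⟫_ℂ := by
  have h1 := ((hY u).1 a ha).inner ℂ (hasDerivAt_const a (v : H))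
  have h2 := (hasDerivAt_const a (u : H)).inner ℂ ((hY v).1 a ha)
  have h3 : (fun b => ⟪Y b u, (v : H)⟫_ℂ) =ᶠ[nhds a] fun b => ⟪(u : H), Y b v⟫_ℂ := by
    filter_upwards [hJ.mem_nhds ha] with b hb using hs b hb u v
  have h4 := h1.unique (h2.congr_of_eventuallyEq h3)
  simpa using h4

end Family

/-! ### Stability of the spectral gap and of the Schatten sums -/

/-- A vector orthogonal to the kernel. -/
theorem IsEigenbasis.le_norm_apply_of_gap (hE : IsEigenbasis T f μ) (hδ : 0 < δ)
    (hgap : ∀ i, μ i = 0 ∨ δ ≤ |μ i|) (x : D) (hx : ∀ i, μ i = 0 → ⟪f i, (x : H)⟫_ℂ = 0) :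
    δ * ‖(x : H)‖ ≤ ‖T x‖ := by
  have := norm_le_of_coeff_le f (C := δ⁻¹) (by positivity) (x := (x : H)) (y := T x) fun i => by
    rw [hE.inner_apply, norm_mul, Complex.norm_real, Real.norm_eq_abs]
    rcases hgap i with h | h
    · rw [hx i h]; simp
    · rw [← mul_assoc]
      refine le_mul_of_one_le_left (norm_nonneg _) ?_
      rw [inv_mul_eq_div, le_div_iff₀ hδ, one_mul]
      exact h
  rwa [inv_mul_eq_div, le_div_iff₀ hδ, mul_comm] at this

theorem IsEigenbasis.mem_eigenspace_zero_iff (hE : IsEigenbasis T f μ) {x : H} :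
    x ∈ eigenspace (op T) 0 ↔ ∀ i, μ i ≠ 0 → ⟪f i, x⟫_ℂ = 0 := by
  rw [mem_eigenspace_iff]
  constructor
  · rintro ⟨hx, e⟩ i hi
    have := hE.inner_apply ⟨x, hx⟩ i
    rw [e, Complex.ofReal_zero, zero_smul, inner_zero_right, eq_comm, mul_eq_zero] at this
    exact this.resolve_left (by exact_mod_cast hi)
  · intro h
    have h1 : ∀ i, (μ i : ℂ) * ⟪f i, x⟫_ℂ = 0 := fun i => by
      by_cases hi : μ i = 0
      · rw [hi]; simp
      · rw [h i hi, mul_zero]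
    have hx : x ∈ D := hE.mem_of_coeff x 0 fun i => by rw [h1, inner_zero_right]
    refine ⟨hx, hilbertBasis_ext f fun i => ?_⟩
    rw [hE.inner_apply, h1]; simp

theorem IsEigenbasis.finiteDimensional_ker (hE : IsEigenbasis T f μ) (hp : 0 < p)
    (hs : Summable fun i => (1 + μ i ^ 2) ^ (-(p / 2))) :
    FiniteDimensional ℂ (eigenspace (op T) 0) := by
  classical
  have hf := finite_abs_le_of_summable hp hs 0
  have h1 : eigenspace (op T) 0 ≤ Submodule.span ℂ (f '' {i | |μ i| ≤ 0}) := fun x hx => by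
    rw [hE.mem_eigenspace_zero_iff] at hx
    have e : x = ∑ i ∈ hf.toFinset, ⟪f i, x⟫_ℂ • f i := hilbertBasis_ext f fun j => by
      rw [inner_sum]
      simp only [inner_smul_right]
      by_cases hj : μ j = 0
      · rw [Finset.sum_eq_single j, inner_basis_self, mul_one]
        · intro i _ hij
          rw [inner_basis_ne (Ne.symm hij), mul_zero]
        · intro h; exact absurd (by simp [hj]) h
      · rw [hx j hj, eq_comm]
        refine Finset.sum_eq_zero fun i hi => ?_
        rw [Set.Finite.mem_toFinset, Set.mem_ofPred_eq, abs_nonpos_iff] at hi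
        rw [inner_basis_ne (fun h : j = i => hj (h ▸ hi)), mul_zero]
    rw [e]
    refine Submodule.sum_mem _ fun i hi => Submodule.smul_mem _ _ (Submodule.subset_span ⟨i, ?_, rfl⟩)
    exact hf.mem_toFinset.mp hi
  have : FiniteDimensional ℂ (Submodule.span ℂ (f '' {i | |μ i| ≤ 0})) :=
    FiniteDimensional.span_of_finite ℂ (hf.image _)
  exact Submodule.finiteDimensional_of_le h1

/-- Stability of the spectral gap at `0` under perturbations preserving the dimension of the
kernel. -/
theorem IsEigenbasis.gap_of_perturb (hE : IsEigenbasis T f μ) (hδ : 0 < δ)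
    (hgap : ∀ i, μ i = 0 ∨ δ ≤ |μ i|) (hfin : FiniteDimensional ℂ (eigenspace (op T) 0))
    {ι₂ : Type} {f₂ : HilbertBasis ι₂ ℂ H} {μ₂ : ι₂ → ℝ} (hE₂ : IsEigenbasis T₂ f₂ μ₂)
    (hfin₂ : FiniteDimensional ℂ (eigenspace (op T₂) 0))
    (hdim : Module.finrank ℂ (eigenspace (op T) 0) = Module.finrank ℂ (eigenspace (op T₂) 0))
    {r : ℝ} (hr : 0 ≤ r) (hpert : ∀ x : D, ‖T x‖ ≤ ‖T₂ x‖ + r * (‖(x : H)‖ + ‖T₂ x‖))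
    {δ₂ : ℝ} (hδ₂ : δ₂ + r * (1 + δ₂) ≤ δ) (i : ι₂) : μ₂ i = 0 ∨ δ₂ ≤ |μ₂ i| := by
  by_contra! hcon
  obtain ⟨h0, hlt⟩ := hcon
  -- A small nonzero eigenvalue of T₂ would enlarge its kernel to a space V on which T₂ is small and
  -- whose dimension exceeds that of ker T.
  set V := eigenspace (op T₂) 0 ⊔ Submodule.span ℂ {f₂ i} with hV
  have hfV : FiniteDimensional ℂ V := inferInstance
  have hi : f₂ i ∉ eigenspace (op T₂) 0 := fun h => by
    have := hE₂.mem_eigenspace_zero_iff.mp h i h0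
    rw [inner_basis_self] at this
    exact one_ne_zero this
  have hVlt : eigenspace (op T₂) 0 < V := by
    refine lt_of_le_of_ne le_sup_left fun h => hi ?_
    rw [h]
    exact (le_sup_right : _ ≤ V) (Submodule.mem_span_singleton_self _)
  have hrank := Submodule.finrank_lt_finrank_of_lt hVlt
  rw [← hdim] at hrank
  have hb : IsBdd fun i => if μ i = 0 then (1 : ℂ) else 0 :=
    ⟨1, fun i => by dsimp only; split_ifs <;> simp⟩
  let φ : V →ₗ[ℂ] eigenspace (op T) 0 := LinearMap.codRestrict _
    ((diag f (fun i => if μ i = 0 then (1 : ℂ) else 0) : H →ₗ[ℂ] H) ∘ₗ V.subtype) fun x => by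
      rw [hE.mem_eigenspace_zero_iff]
      intro j hj
      change ⟪f j, diag f _ (x : H)⟫_ℂ = 0
      rw [inner_diag hb, if_neg hj, zero_mul]
  -- For dimension reasons some nonzero x in V is orthogonal to ker T. There the gap of T gives ‖Tx‖
  -- ≥ δ‖x‖, while the perturbation bound gives ‖Tx‖ < (δ₂ + r(1+δ₂))‖x‖.
  obtain ⟨⟨x, hxV⟩, hxk, hx0⟩ := (Submodule.ne_bot_iff _).mp (φ.ker_ne_bot_of_finrank_lt hrank)
  have hxk' : diag f (fun i => if μ i = 0 then (1 : ℂ) else 0) x = 0 := congrArg Subtype.val hxk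
  have hx : x ≠ 0 := fun h => hx0 (Subtype.ext h)
  obtain ⟨y, hy, w, hw, rfl⟩ := Submodule.mem_sup.mp hxV
  obtain ⟨c, rfl⟩ := Submodule.mem_span_singleton.mp hw
  obtain ⟨hyD, hTy⟩ := mem_eigenspace_iff.mp hy
  set x : D := ⟨y, hyD⟩ + c • ⟨f₂ i, hE₂.mem i⟩ with hxdef
  have hxc : (x : H) = y + c • f₂ i := rfl
  rw [← hxc] at hx hxk'
  have hc : ⟪f₂ i, (x : H)⟫_ℂ = c := by
    rw [hxc, inner_add_right, hE₂.mem_eigenspace_zero_iff.mp hy i h0, inner_smul_right,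
      inner_basis_self, zero_add, mul_one]
  have hcn : ‖c‖ ≤ ‖(x : H)‖ := by
    rw [← hc]
    refine (norm_inner_le_norm _ _).trans ?_
    rw [f₂.orthonormal.1 i, one_mul]
  have hT₂ : ‖T₂ x‖ ≤ |μ₂ i| * ‖(x : H)‖ := by
    rw [hxdef, map_add, map_smul, hTy, hE₂.apply_basis, Complex.ofReal_zero, zero_smul, zero_add,
      norm_smul, norm_smul, f₂.orthonormal.1 i, Complex.norm_real, Real.norm_eq_abs, mul_one,
      mul_comm]
    exact mul_le_mul_of_nonneg_left hcn (abs_nonneg _)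
  have hlow := hE.le_norm_apply_of_gap hδ hgap x fun j hj => by
    have := congrArg (fun v => ⟪f j, v⟫_ℂ) hxk'
    simpa [inner_diag hb, hj] using this
  have hxpos : 0 < ‖(x : H)‖ := norm_pos_iff.mpr hx
  have h1 := hpert x
  have h2 : ‖T₂ x‖ < δ₂ * ‖(x : H)‖ := hT₂.trans_lt (mul_lt_mul_of_pos_right hlt hxpos)
  have h3 : r * (‖(x : H)‖ + ‖T₂ x‖) ≤ r * (‖(x : H)‖ + δ₂ * ‖(x : H)‖) :=
    mul_le_mul_of_nonneg_left (by linarith) hr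
  nlinarith

/-- Domination of the Schatten norms under perturbations. -/
theorem IsEigenbasis.summable_of_perturb (hE : IsEigenbasis T f μ) (hp : 0 < p)
    {R : H →L[ℂ] H} (hR : IsResolventAt (op T) (-Complex.I) R) (hRp : MemSchatten p R)
    {ι₂ : Type} {f₂ : HilbertBasis ι₂ ℂ H} {μ₂ : ι₂ → ℝ} (hE₂ : IsEigenbasis T₂ f₂ μ₂)
    {C : ℝ} (hC : 0 ≤ C) (hpert : ∀ x : D, ‖T x‖ ≤ C * (‖(x : H)‖ + ‖T₂ x‖)) :
    ResolventMemSchatten p (op T₂) ∧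
    Summable (fun i => (1 + μ₂ i ^ 2) ^ (-(p / 2))) ∧
      ∑' i, (1 + μ₂ i ^ 2) ^ (-(p / 2)) ≤ (1 + 2 * C) ^ p * ∑' n, approxNumber R n ^ p := by
  set S₂ := diag f₂ (fun i => ((μ₂ i : ℂ) + Complex.I)⁻¹) with hS₂
  -- X = (T+i)(T₂+i)^(-1) is bounded and (T₂+i)^(-1) = (T+i)^(-1)X, so the approximation numbers
  -- grow at most by the factor ‖X‖.
  obtain ⟨X, hX, hXn⟩ := exists_comp S₂ hE₂.res_mem (T + Complex.I • D.subtype) (C := 1 + 2 * C)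
    (by positivity) fun x => by
      have h1 := hE₂.graphNorm_res_le x
      have h2 := hpert ⟨S₂ x, hE₂.res_mem x⟩
      have h3 : ‖S₂ x‖ ≤ 1 * ‖x‖ := norm_diag_apply_le zero_le_one (fun i => by
        rw [norm_inv]; exact inv_le_one_of_one_le₀ (one_le_norm_ofReal_add_I _)) x
      have h4 : ‖(T + Complex.I • D.subtype) ⟨S₂ x, hE₂.res_mem x⟩‖ ≤
          ‖T ⟨S₂ x, hE₂.res_mem x⟩‖ + ‖S₂ x‖ := by
        refine (norm_add_le _ _).trans ?_
        have : (Complex.I • D.subtype) ⟨S₂ x, hE₂.res_mem x⟩ = Complex.I • S₂ x := rfl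
        rw [this, norm_smul, Complex.norm_I, one_mul]
      have h5 := mul_le_mul_of_nonneg_left h1 hC
      linarith
  have hR₂ : S₂ = R * X := by
    ext x
    rw [hE.resolvent_eq hR, mul_apply_eq_comp, hX]
    exact (hE.res_apply ⟨S₂ x, hE₂.res_mem x⟩).symm
  have hle : ∀ n, approxNumber S₂ n ^ p ≤ (1 + 2 * C) ^ p * approxNumber R n ^ p := fun n => by
    rw [← Real.mul_rpow (by positivity) (approxNumber_nonneg _ _)]
    refine Real.rpow_le_rpow (approxNumber_nonneg _ _) ?_ hp.le
    rw [hR₂]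
    exact (approxNumber_mul_right_le X R n).trans
      (mul_le_mul_of_nonneg_right hXn (approxNumber_nonneg _ _))
  have hmem : MemSchatten p S₂ := Summable.of_nonneg_of_le
    (fun n => Real.rpow_nonneg (approxNumber_nonneg _ _) _) hle (hRp.mul_left _)
  have h := hE₂.summable_of_resolventMemSchatten hp hE₂.isResolventAt hmem
  refine ⟨⟨S₂, hE₂.isResolventAt, hmem⟩, h.1, h.2.trans ?_⟩
  rw [← tsum_mul_left]
  exact hmem.tsum_le_tsum hle (hRp.mul_left _)

end EtaVar

/-! ### Uniform control near a parameter and vanishing on the kernel -/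

namespace EtaVar

variable {H : Type*} [NormedAddCommGroup H] [InnerProductSpace ℂ H] [CompleteSpace H]
variable {D : Submodule ℂ H}

/-- The hypotheses of the variation formula, in terms of eigenbases. -/
structure VarFamily (J : Set ℝ) (A A' B B' : ℝ → D →ₗ[ℂ] H) : Prop where
  isOpen : IsOpen J
  eigen : ∀ a ∈ J, ∃ (ι : Type) (f : HilbertBasis ι ℂ H) (μ : ι → ℝ), IsEigenbasis (A a) f μ
  finite : ∀ a ∈ J, FiniteDimensional ℂ (eigenspace (op (A a)) 0)
  finrank_ker : ∀ a ∈ J, ∀ b ∈ J, Module.finrank ℂ (eigenspace (op (A a)) 0) =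
    Module.finrank ℂ (eigenspace (op (A b)) 0)
  derivA : HasStrongDeriv J A A'
  relB : ∀ a ∈ J, RelBdd (A a) (B a)
  ker : ∀ a ∈ J, ∀ x : H, eigenproj (op (A a)) 0 (app (op (B a)) (eigenproj (op (A a)) 0 x)) = 0
  comm : ∀ a ∈ J, CommutesWithResolvents (op (B a)) (sq (op (A a)))
  derivB : HasStrongDeriv J B B'

/-- Uniform control of the operators at the parameter `b`. -/
structure Control {ι : Type} (A A' B B' : ℝ → D →ₗ[ℂ] H) (b : ℝ) (f : HilbertBasis ι ℂ H)
    (μ : ι → ℝ) (p C δ M : ℝ) : Prop where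
  var : VarData (A b) (A' b) (B b) f μ δ
  schatten : ResolventMemSchatten p (op (A b))
  summable : Summable fun i => (1 + μ i ^ 2) ^ (-(p / 2))
  tsum_le : ∑' i, (1 + μ i ^ 2) ^ (-(p / 2)) ≤ M
  bound : ∀ x : D, ‖A' b x‖ ≤ C * (‖(x : H)‖ + ‖A b x‖) ∧ ‖B b x‖ ≤ C * (‖(x : H)‖ + ‖A b x‖) ∧
    ‖B' b x‖ ≤ C * (‖(x : H)‖ + ‖A b x‖)

namespace VarFamily

variable {J : Set ℝ} {A A' B B' : ℝ → D →ₗ[ℂ] H} {a p : ℝ}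

/-- P₀BP₀ = 0 removes the component in the kernel, and commutation with A² removes all others. -/
theorem apply_ker (h : VarFamily J A A' B B') (ha : a ∈ J) {ι : Type} {f : HilbertBasis ι ℂ H}
    {μ : ι → ℝ} (hE : IsEigenbasis (A a) f μ) (i : ι) (hm : f i ∈ D) (hi : μ i = 0) :
    B a ⟨f i, hm⟩ = 0 := by
  have hb : IsBdd fun i => if μ i = 0 then (1 : ℂ) else 0 :=
    ⟨1, fun i => by dsimp only; split_ifs <;> simp⟩
  have h1 := h.ker a ha (f i)
  have e : eigenproj (op (A a)) 0 (f i) = f i := by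
    rw [hE.eigenproj_eq, diag_basis hb, if_pos hi, one_smul]
  rw [e, app_op _ hm, hE.eigenproj_eq] at h1
  refine hilbertBasis_ext f fun j => ?_
  by_cases hj : μ j = 0
  · have := congrArg (fun v => ⟪f j, v⟫_ℂ) h1
    simpa [inner_diag hb, hj] using this
  · rw [hE.inner_eq_zero_of_sq_ne (h.comm a ha), inner_zero_right]
    rw [hi]; simpa using pow_ne_zero 2 hj

/-- `P₀ B = 0`. -/
theorem inner_ker (h : VarFamily J A A' B B') (ha : a ∈ J) {ι : Type} {f : HilbertBasis ι ℂ H}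
    {μ : ι → ℝ} (hE : IsEigenbasis (A a) f μ) (i : ι) (hi : μ i = 0) (x : D) :
    ⟪f i, B a x⟫_ℂ = 0 := by
  obtain ⟨β, hβ⟩ := hE.exists_comp_diag (h.relB a ha) (isBdd_res μ) (isBdd_mul_res μ)
  have e : B a x = β (A a x + Complex.I • (x : H)) := by
    rw [hβ]
    exact congrArg (B a) (Subtype.ext (hE.res_apply x).symm)
  -- The functional is continuous, so it is enough to test eigenvectors: those in the kernel are
  -- killed by B, the others belong to a different value of μ².
  have h1 : (innerSL ℂ (f i)).comp β = 0 := by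
    refine ContinuousLinearMap.ext_on (s := Set.range f) ?_ ?_
    · rw [Submodule.dense_iff_topologicalClosure_eq_top]; exact f.dense_span
    · rintro _ ⟨j, rfl⟩
      change ⟪f i, β (f j)⟫_ℂ = 0
      have e' : (⟨_, hE.res_mem (f j)⟩ : D) = ((μ j : ℂ) + Complex.I)⁻¹ • ⟨f j, hE.mem j⟩ :=
        Subtype.ext (diag_basis (isBdd_res μ) j)
      rw [hβ, e', map_smul, inner_smul_right]
      by_cases hj : μ j = 0
      · rw [h.apply_ker ha hE j (hE.mem j) hj, inner_zero_right, mul_zero]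
      · rw [hE.inner_eq_zero_of_sq_ne (h.comm a ha), mul_zero]
        rw [hi]; simpa using (pow_ne_zero 2 hj).symm
  rw [e]
  exact congrArg (fun φ : H →L[ℂ] ℂ => φ _) h1

/-- As Bx is orthogonal to ker A, only the component of y orthogonal to ker A matters, and the gap
bounds that component by ‖Ay‖/δ. -/
theorem norm_inner_le_of_gap (h : VarFamily J A A' B B') (ha : a ∈ J) {ι : Type}
    {f : HilbertBasis ι ℂ H} {μ : ι → ℝ} {δ : ℝ} (hE : IsEigenbasis (A a) f μ) (hδ : 0 < δ)
    (hgap : ∀ i, μ i = 0 ∨ δ ≤ |μ i|) (x y : D) :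
    δ * ‖⟪(y : H), B a x⟫_ℂ‖ ≤ ‖A a y‖ * ‖B a x‖ := by
  have hb : IsBdd fun i => if μ i = 0 then (0 : ℂ) else 1 :=
    ⟨1, fun i => by dsimp only; split_ifs <;> simp⟩
  set P := diag f (fun i => if μ i = 0 then (0 : ℂ) else 1) with hP
  have e1 : P (B a x) = B a x := hilbertBasis_ext f fun i => by
    rw [hP, inner_diag hb]
    split_ifs with hi
    · rw [h.inner_ker ha hE i hi, zero_mul]
    · rw [one_mul]
  have e2 : ⟪(y : H), B a x⟫_ℂ = ⟪P y, B a x⟫_ℂ := by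
    rw [hP, inner_diag_left hb]
    have : (fun i => (starRingEnd ℂ) (if μ i = 0 then (0 : ℂ) else 1))
        = fun i => if μ i = 0 then (0 : ℂ) else 1 := by
      funext i; split_ifs <;> simp
    rw [this, ← hP, e1]
  have h3 : δ * ‖P y‖ ≤ ‖A a y‖ := by
    have hPy : P y ∈ D := hE.diag_mem_of_mem hb y
    have hPi : ∀ i, ⟪f i, ((⟨P y, hPy⟩ : D) : H)⟫_ℂ = (if μ i = 0 then 0 else 1) * ⟪f i, (y : H)⟫_ℂ :=
      fun i => inner_diag hb (y : H) i
    have h4 := hE.le_norm_apply_of_gap hδ hgap ⟨P y, hPy⟩ fun i hi => by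
      rw [hPi, if_pos hi, zero_mul]
    refine h4.trans ?_
    have h5 := norm_le_of_coeff_le f zero_le_one (x := A a ⟨P y, hPy⟩) (y := A a y) fun i => by
      rw [hE.inner_apply, hE.inner_apply, hPi, one_mul]
      split_ifs
      · simp; positivity
      · simp
    linarith
  rw [e2]
  calc δ * ‖⟪P y, B a x⟫_ℂ‖ ≤ δ * (‖P y‖ * ‖B a x‖) := by
        gcongr; exact norm_inner_le_norm _ _
    _ = (δ * ‖P y‖) * ‖B a x‖ := by ring
    _ ≤ _ := by gcongr

/-- Local control without the derivative of `B` on the kernel. -/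
theorem exists_local (h : VarFamily J A A' B B') (ha : a ∈ J) (hp : 0 < p)
    (hpa : ResolventMemSchatten p (op (A a))) :
    ∃ ε > 0, ∃ C, 0 ≤ C ∧ ∃ δ > 0, ∃ M, Metric.ball a ε ⊆ J ∧
      (∀ b ∈ Metric.ball a ε, ∀ x : D, ‖A b x - A a x‖ ≤ C * |b - a| * (‖(x : H)‖ + ‖A a x‖) ∧
        ‖B b x - B a x‖ ≤ C * |b - a| * (‖(x : H)‖ + ‖A a x‖)) ∧
      ∀ b ∈ Metric.ball a ε, ∃ (ι : Type) (f : HilbertBasis ι ℂ H) (μ : ι → ℝ),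
        Control A A' B B' b f μ p C δ M := by
  obtain ⟨ι, f, μ, hE⟩ := h.eigen a ha
  obtain ⟨R, hR, hRp⟩ := hpa
  have hsum := hE.summable_of_resolventMemSchatten hp hR hRp
  obtain ⟨δ, hδ, hgap⟩ := exists_gap hp hsum.1
  have hrelA : ∀ b ∈ J, RelBdd (A a) (A b) := fun b hb => by
    obtain ⟨ι₂, f₂, μ₂, hE₂⟩ := h.eigen b hb
    exact hE.relBdd hE₂
  have hrelB : ∀ b ∈ J, RelBdd (A a) (B b) := fun b hb => (hrelA b hb).trans (h.relB b hb)
  obtain ⟨ε₁, hε₁, C₁, hC₁, hJ₁, hb₁⟩ := h.derivA.exists_bound h.isOpen hE hrelA ha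
  obtain ⟨ε₂, hε₂, C₂, hC₂, hJ₂, hb₂⟩ := h.derivB.exists_bound h.isOpen hE hrelB ha
  -- r ≤ 1/2 makes the graph norm of A a at most twice that of A b. The last condition reads δ/2 +
  -- 2r(1+δ/2) ≤ δ, so that the gap δ/2 survives a perturbation of size 2r.
  obtain ⟨r, hr0, hr1, hr2⟩ : ∃ r : ℝ, 0 < r ∧ r ≤ 1 / 2 ∧ 2 * r * (1 + δ / 2) ≤ δ / 2 := by
    refine ⟨min (1 / 2) (δ / 2 / (2 * (1 + δ / 2))), lt_min (by norm_num) (by positivity),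
      min_le_left _ _, ?_⟩
    have := min_le_right (1 / 2) (δ / 2 / (2 * (1 + δ / 2)))
    rw [le_div_iff₀ (by positivity)] at this
    linarith
  -- The radius r/(C₁+1) keeps the increments of A below r. The factor 2 in 2(C₁+C₂) and the inner 2
  -- in (1+2·2)^p come from comparing graph norms.
  refine ⟨min (min ε₁ ε₂) (r / (C₁ + 1)), lt_min (lt_min hε₁ hε₂) (by positivity),
    2 * (C₁ + C₂), by positivity, δ / 2, half_pos hδ,
    (1 + 2 * 2) ^ p * ∑' n, approxNumber R n ^ p, ?_, fun b hb x => ?_, fun b hb => ?_⟩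
  · exact (Metric.ball_subset_ball ((min_le_left _ _).trans (min_le_left _ _))).trans hJ₁
  · have hm1 := Metric.ball_subset_ball ((min_le_left _ _).trans (min_le_left _ _)) hb
    have hm2 := Metric.ball_subset_ball ((min_le_left _ _).trans (min_le_right _ _)) hb
    refine ⟨(hb₁ b hm1 x).2.2.trans ?_, (hb₂ b hm2 x).2.2.trans ?_⟩ <;>
    · gcongr; linarith
  · have hm1 := Metric.ball_subset_ball ((min_le_left _ _).trans (min_le_left _ _)) hb
    have hm2 := Metric.ball_subset_ball ((min_le_left _ _).trans (min_le_right _ _)) hb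
    have hm3 := Metric.ball_subset_ball (min_le_right _ _) hb
    have hbJ := hJ₁ hm1
    have hCb : C₁ * |b - a| ≤ r := by
      rw [Metric.mem_ball, Real.dist_eq, lt_div_iff₀ (by positivity)] at hm3
      nlinarith [abs_nonneg (b - a)]
    have hdist : ∀ x : D, ‖A b x - A a x‖ ≤ r * (‖(x : H)‖ + ‖A a x‖) := fun x =>
      (hb₁ b hm1 x).2.2.trans (mul_le_mul_of_nonneg_right hCb (by positivity))
    have htri : ∀ x : D, ‖A a x‖ ≤ ‖A b x‖ + ‖A b x - A a x‖ := fun x => by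
      have := norm_sub_le (A b x) (A b x - A a x)
      rwa [sub_sub_cancel] at this
    have hgraph : ∀ x : D, ‖(x : H)‖ + ‖A a x‖ ≤ 2 * (‖(x : H)‖ + ‖A b x‖) := fun x => by
      have h1 := hdist x
      have h2 : r * (‖(x : H)‖ + ‖A a x‖) ≤ 1 / 2 * (‖(x : H)‖ + ‖A a x‖) :=
        mul_le_mul_of_nonneg_right hr1 (by positivity)
      linarith [htri x, norm_nonneg (x : H)]
    obtain ⟨ι₂, f₂, μ₂, hE₂⟩ := h.eigen b hbJ
    have hsch := hE.summable_of_perturb hp hR hRp hE₂ zero_le_two fun x =>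
      (le_add_of_nonneg_left (norm_nonneg (x : H))).trans (hgraph x)
    have hgap₂ := hE.gap_of_perturb hδ hgap (h.finite a ha) hE₂ (h.finite b hbJ)
      (h.finrank_ker a ha b hbJ) (r := 2 * r) (by positivity) (fun x => by
        have h1 := hdist x
        have h2 := mul_le_mul_of_nonneg_left (hgraph x) hr0.le
        linarith [htri x]) (δ₂ := δ / 2) (by linarith)
    have hbd : ∀ x : D, ‖A' b x‖ ≤ 2 * (C₁ + C₂) * (‖(x : H)‖ + ‖A b x‖) ∧
        ‖B b x‖ ≤ 2 * (C₁ + C₂) * (‖(x : H)‖ + ‖A b x‖) ∧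
        ‖B' b x‖ ≤ 2 * (C₁ + C₂) * (‖(x : H)‖ + ‖A b x‖) := fun x => by
      have h1 := mul_le_mul_of_nonneg_left (hgraph x) hC₁
      have h2 := mul_le_mul_of_nonneg_left (hgraph x) hC₂
      have h3 : 0 ≤ C₁ * (‖(x : H)‖ + ‖A b x‖) := by positivity
      have h4 : 0 ≤ C₂ * (‖(x : H)‖ + ‖A b x‖) := by positivity
      refine ⟨(hb₁ b hm1 x).1.trans ?_, (hb₂ b hm2 x).2.1.trans ?_, (hb₂ b hm2 x).1.trans ?_⟩ <;>
      linarith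
    refine ⟨ι₂, f₂, μ₂, ⟨hE₂, ⟨2 * (C₁ + C₂), by positivity, fun x => (hbd x).1⟩, ?_, h.relB b hbJ,
      h.comm b hbJ, fun i hm hi => h.apply_ker hbJ hE₂ i hm hi, half_pos hδ, hgap₂⟩, hsch.1,
      hsch.2.1, hsch.2.2, hbd⟩
    exact h.derivA.symm h.isOpen (fun c hc u v => by
      obtain ⟨ι₃, f₃, μ₃, hE₃⟩ := h.eigen c hc
      exact hE₃.inner_symm u v) hbJ

/-- `P₀ B' P₀ = 0`. -/
theorem inner_deriv_ker (h : VarFamily J A A' B B') (ha : a ∈ J) (hp : 0 < p)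
    (hpa : ResolventMemSchatten p (op (A a))) (x y : D) (hx : B a x = 0) (hy : A a y = 0) :
    ⟪(y : H), B' a x⟫_ℂ = 0 := by
  obtain ⟨ε, hε, C, hC, δ, hδ, M, hJ, hbd, hctl⟩ := h.exists_local ha hp hpa
  have h1 := (hasDerivAt_const a (y : H)).inner ℂ ((h.derivB x).1 a ha)
  set K := δ⁻¹ * (C * (‖(y : H)‖ + ‖A a y‖)) * (C * (‖(x : H)‖ + ‖A a x‖)) with hK
  have h2 : HasDerivAt (fun b => ⟪(y : H), B b x⟫_ℂ) 0 a := by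
    rw [hasDerivAt_iff_isLittleO]
    -- Since A a y = 0 and B a x = 0, both ‖A b y‖ and ‖B b x‖ are O(b-a). With the uniform gap,
    -- their product bounds the pairing to second order, so its derivative vanishes.
    have hO : (fun b => ⟪(y : H), B b x⟫_ℂ - ⟪(y : H), B a x⟫_ℂ - (b - a) • (0 : ℂ))
        =O[nhds a] fun b => (b - a) ^ 2 := by
      refine Asymptotics.IsBigO.of_bound K ?_
      filter_upwards [Metric.ball_mem_nhds a hε] with b hb
      obtain ⟨ι, f, μ, hc⟩ := hctl b hb
      have h3 := h.norm_inner_le_of_gap (hJ hb) hc.var.eigen hc.var.pos hc.var.gap x y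
      have h4 := (hbd b hb y).1
      have h5 := (hbd b hb x).2
      rw [hy, sub_zero] at h4
      rw [hx, sub_zero] at h5
      rw [hx, inner_zero_right, smul_zero, sub_zero, sub_zero, Real.norm_eq_abs, abs_pow]
      have h6 := mul_le_mul h4 h5 (norm_nonneg _) (by positivity)
      have h7 := h3.trans h6
      rw [← le_div_iff₀' hδ] at h7
      refine h7.trans (le_of_eq ?_)
      rw [hK, hy]
      field_simp
    refine hO.trans_isLittleO ?_
    have := (Asymptotics.isLittleO_pow_id (𝕜 := ℝ) (n := 2) (by norm_num)).comp_tendsto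
      (show Filter.Tendsto (fun b => b - a) (nhds a) (nhds 0) by
        have : Filter.Tendsto (fun b : ℝ => b - a) (nhds a) (nhds (a - a)) :=
          (continuous_id.sub continuous_const).tendsto a
        rwa [sub_self] at this)
    exact this
  have h3 := h1.unique h2
  simpa using h3

end VarFamily

end EtaVar

namespace EtaVar

variable {H : Type*} [NormedAddCommGroup H] [InnerProductSpace ℂ H] [CompleteSpace H]

/-! ### Limits of traces -/

theorem IsNuclear.trace_sub {X Y : H →L[ℂ] H} {c d : ℝ} (h : IsNuclear (X - Y) c)
    (hY : IsNuclear Y d) : trace (X - Y : H →L[ℂ] H) = trace X - trace Y := by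
  have := h.trace_add hY
  rw [sub_add_cancel] at this
  rw [this, add_sub_cancel_right]

theorem STendsto.pow {α : Type*} {l : Filter α} {X : α → H →L[ℂ] H} {Y : H →L[ℂ] H}
    (h : STendsto X l Y) (n : ℕ) : STendsto (fun b => X b ^ n) l (Y ^ n) := by
  induction n with
  | zero => simpa using STendsto.const (1 : H →L[ℂ] H)
  | succ n ih => simpa only [pow_succ] using ih.mul h

theorem IsNuclear.pow_of_le {K : H →L[ℂ] H} {c : ℝ} {m n : ℕ} (h : IsNuclear (K ^ m) c)
    (hmn : m ≤ n) : ∃ d, IsNuclear (K ^ n) d := by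
  obtain ⟨j, rfl⟩ := Nat.exists_eq_add_of_le hmn
  rw [pow_add]
  exact ⟨_, h.mul_right _⟩

/-! ### Telescoping of traces of powers -/

section Step

variable {α : Type*} {l : Filter α} {R Δ β : α → H →L[ℂ] H} {R₀ R' β₀ : H →L[ℂ] H} {m : ℕ} {c : ℝ}

theorem trace_commute (hn₀ : IsNuclear (R₀ ^ m) c) (hcomm : β₀ * R₀ = R₀ * β₀) {i j : ℕ}
    (hi : m ≤ i) : trace (β₀ * R₀ ^ j * R' * R₀ ^ i : H →L[ℂ] H) =
      trace (R' * β₀ * R₀ ^ (i + j) : H →L[ℂ] H) := by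
  obtain ⟨d, hd⟩ := hn₀.pow_of_le hi
  have hc : ∀ n, β₀ * R₀ ^ n = R₀ ^ n * β₀ := fun n => (Commute.pow_right hcomm n).eq
  rw [mul_assoc (β₀ * R₀ ^ j), (hd.mul_left R').trace_mul_comm]
  congr 2
  rw [mul_assoc, ← mul_assoc (R₀ ^ i), ← hc, mul_assoc β₀, ← pow_add, ← mul_assoc]

/-- The term of a telescoping sum with j factors R_b and i factors R₀. Only R₀ provides a fixed
nuclear operator; if too few of its factors are present, many factors R_b are, and some of these can
be exchanged for R₀. -/
theorem tendsto_trace_step (hR : Filter.Tendsto R l (nhds R₀)) (hΔ : STendsto Δ l R')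
    (hβ : STendsto β l β₀) (hcomm : β₀ * R₀ = R₀ * β₀)
    (hn : ∀ᶠ b in l, IsNuclear (R b ^ m) c) (hn₀ : IsNuclear (R₀ ^ m) c) {i j : ℕ}
    (hij : 3 * m ≤ i + j) :
    Filter.Tendsto (fun b => trace (β b * R b ^ j * Δ b * R₀ ^ i : H →L[ℂ] H)) l
      (nhds (trace (R' * β₀ * R₀ ^ (i + j) : H →L[ℂ] H))) := by
  have hRs := STendsto.of_tendsto hR
  by_cases hi : m ≤ i
  · obtain ⟨d, hd⟩ := hn₀.pow_of_le hi
    have := ((hβ.mul (hRs.pow j)).mul hΔ).tendsto_trace_mul hd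
    rwa [trace_commute hn₀ hcomm hi] at this
  -- Here i < m, hence j > 2m and j' > m. The factor R_b^m has nuclear weight at most c, so
  -- replacing R_b^(j') by R₀^(j') causes an error tending to 0; R₀^(j') is then the fixed nuclear
  -- factor.
  · obtain ⟨j', rfl⟩ := Nat.exists_eq_add_of_le (show m ≤ j by lia)
    obtain ⟨d, hd⟩ := hn₀.pow_of_le (show m ≤ j' by lia)
    have h1 : Filter.Tendsto (fun b => trace (Δ b * R₀ ^ i * β b * R b ^ m * R₀ ^ j' : H →L[ℂ] H)) l
        (nhds (trace (R' * β₀ * R₀ ^ (i + (m + j')) : H →L[ℂ] H))) := by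
      have h2 := (((hΔ.mul (STendsto.const (R₀ ^ i))).mul hβ).mul (hRs.pow m)).tendsto_trace_mul hd
      have e : R' * R₀ ^ i * β₀ * R₀ ^ m * R₀ ^ j' = R' * β₀ * R₀ ^ (i + (m + j')) := by
        rw [mul_assoc R', ← (Commute.pow_right hcomm i).eq, pow_add, pow_add]
        simp only [mul_assoc]
      rwa [e] at h2
    have h2 : Filter.Tendsto (fun b => trace (β b * R b ^ m * ((R b ^ j' - R₀ ^ j') * Δ b * R₀ ^ i)
        : H →L[ℂ] H)) l (nhds 0) := by
      obtain ⟨⟨C₁, hC₁⟩, -⟩ := hΔ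
      obtain ⟨⟨C₂, hC₂⟩, -⟩ := hβ
      have h3 : Filter.Tendsto (fun b => ‖R b ^ j' - R₀ ^ j'‖ * C₁ * ‖R₀ ^ i‖ * (C₂ * c)) l
          (nhds 0) := by
        have := (((hR.pow j').sub_const (R₀ ^ j')).norm.mul_const C₁).mul_const ‖R₀ ^ i‖
          |>.mul_const (C₂ * c)
        simpa using this
      refine squeeze_zero_norm' ?_ h3
      filter_upwards [hC₁, hC₂, hn] with b h₁ h₂ h₃
      refine ((h₃.mul_left (β b)).mul_right _).norm_trace_le.trans ?_
      have hc0 : 0 ≤ c := (norm_nonneg _).trans h₃.norm_trace_le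
      have h4 : ‖(R b ^ j' - R₀ ^ j') * Δ b * R₀ ^ i‖ ≤ ‖R b ^ j' - R₀ ^ j'‖ * C₁ * ‖R₀ ^ i‖ := by
        refine (norm_mul_le _ _).trans (mul_le_mul_of_nonneg_right ?_ (norm_nonneg _))
        exact (norm_mul_le _ _).trans (mul_le_mul_of_nonneg_left h₁ (norm_nonneg _))
      exact mul_le_mul h4 (mul_le_mul_of_nonneg_right h₂ hc0) (by positivity)
        ((norm_nonneg _).trans h4)
    have h3 := h2.add h1
    rw [zero_add] at h3
    refine h3.congr' ?_
    filter_upwards [hn] with b hb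
    have e : trace (Δ b * R₀ ^ i * β b * R b ^ m * R₀ ^ j' : H →L[ℂ] H) =
        trace (β b * R b ^ m * (R₀ ^ j' * Δ b * R₀ ^ i) : H →L[ℂ] H) := by
      rw [hd.trace_mul_comm, ((hd.mul_right (Δ b)).mul_right (R₀ ^ i)).trace_mul_comm]
      simp only [mul_assoc]
    rw [e, ← ((hb.mul_left (β b)).mul_right _).trace_add ((hb.mul_left (β b)).mul_right _)]
    congr 2
    rw [pow_add]
    simp only [mul_assoc, ← mul_add, ← add_mul, sub_add_cancel]

/-- The strong derivative of `tr (β R ^ n)` in the second factor. -/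
theorem tendsto_trace_pow_sub (hR : Filter.Tendsto R l (nhds R₀)) {s : α → ℂ}
    (hΔ : STendsto (fun b => s b • (R b - R₀)) l R')
    (hβ : STendsto β l β₀) (hcomm : β₀ * R₀ = R₀ * β₀)
    (hn : ∀ᶠ b in l, IsNuclear (R b ^ m) c) (hn₀ : IsNuclear (R₀ ^ m) c) {n : ℕ}
    (hmn : 3 * m ≤ n) (j i : ℕ) (hij : j + i = n + 1) :
    Filter.Tendsto (fun b => s b * (trace (β b * R b ^ j * R₀ ^ i : H →L[ℂ] H)
        - trace (β b * R₀ ^ (n + 1) : H →L[ℂ] H))) l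
      (nhds (j * trace (R' * β₀ * R₀ ^ n : H →L[ℂ] H))) := by
  induction j generalizing i with
  | zero =>
    have : i = n + 1 := by lia
    subst this
    simp only [pow_zero, mul_one, sub_self, mul_zero, Nat.cast_zero, zero_mul]
    exact tendsto_const_nhds
  | succ j ih =>
    -- Pass from j to j+1 by exchanging one factor R₀ for R_b; each exchange contributes the same
    -- limit.
    have h1 := ih (i + 1) (by lia)
    have h2 := tendsto_trace_step hR hΔ hβ hcomm hn hn₀ (i := i) (j := j) (by lia)
    rw [show i + j = n by lia] at h2
    have h3 := h1.add h2
    have e0 : (j : ℂ) * trace (R' * β₀ * R₀ ^ n : H →L[ℂ] H) + trace (R' * β₀ * R₀ ^ n : H →L[ℂ] H)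
        = ((j + 1 : ℕ) : ℂ) * trace (R' * β₀ * R₀ ^ n : H →L[ℂ] H) := by push_cast; ring
    rw [e0] at h3
    refine h3.congr' ?_
    filter_upwards [hn] with b hb
    have key : ∀ X : H →L[ℂ] H, ∃ d, IsNuclear (β b * R b ^ j * X * R₀ ^ i) d := fun X => by
      by_cases hi : m ≤ i
      · obtain ⟨d, hd⟩ := hn₀.pow_of_le hi
        exact ⟨_, hd.mul_left _⟩
      · obtain ⟨d, hd⟩ := hb.pow_of_le (show m ≤ j by lia)
        exact ⟨_, ((hd.mul_left _).mul_right _).mul_right _⟩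
    obtain ⟨d, hd⟩ := key (R b - R₀)
    obtain ⟨d', hd'⟩ := key R₀
    have e1 : β b * R b ^ (j + 1) * R₀ ^ i - β b * R b ^ j * R₀ * R₀ ^ i
        = β b * R b ^ j * (R b - R₀) * R₀ ^ i := by
      rw [pow_succ]
      simp only [mul_sub, sub_mul, mul_assoc]
    have e2 : β b * R b ^ j * (s b • (R b - R₀)) * R₀ ^ i
        = s b • (β b * R b ^ j * (R b - R₀) * R₀ ^ i) := by
      rw [mul_smul_comm, smul_mul_assoc]
    have e3 : β b * R b ^ j * R₀ * R₀ ^ i = β b * R b ^ j * R₀ ^ (i + 1) := by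
      rw [pow_succ', mul_assoc]
    rw [← e1] at hd
    rw [e2, IsNuclear.trace_smul, ← e1, hd.trace_sub hd', e3]
    ring

end Step

end EtaVar

namespace EtaVar

variable {H : Type*} [NormedAddCommGroup H] [InnerProductSpace ℂ H] [CompleteSpace H]
variable {D : Submodule ℂ H} {T T' B : D →ₗ[ℂ] H} {ι : Type} {f : HilbertBasis ι ℂ H} {μ : ι → ℝ}
  {p z : ℝ}

/-! ### The resolvent of `A²` -/

theorem IsResolventAt.unique {S : H →ₗ.[ℂ] H} {ζ : ℂ} {R₁ R₂ : H →L[ℂ] H}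
    (h₁ : IsResolventAt S ζ R₁) (h₂ : IsResolventAt S ζ R₂) : R₁ = R₂ := by
  ext y
  obtain ⟨hy, e⟩ := h₁.1 y
  have := h₂.2 ⟨R₁ y, hy⟩
  rw [e] at this
  exact this.symm

open Classical in
/-- `(T² + z)⁻¹`. -/
def sqRes (T : D →ₗ[ℂ] H) (z : ℝ) : H →L[ℂ] H :=
  if h : ∃ R, IsResolventAt (sq (op T)) (-(z : ℂ)) R then h.choose else 0

namespace IsEigenbasis

theorem sqRes_eq (hE : IsEigenbasis T f μ) (hz : 0 < z) :
    sqRes T z = diag f fun i => (((μ i ^ 2 + z)⁻¹ : ℝ) : ℂ) := by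
  have h : ∃ R, IsResolventAt (sq (op T)) (-(z : ℂ)) R := ⟨_, hE.sq_isResolventAt hz⟩
  rw [sqRes, dif_pos h]
  exact h.choose_spec.unique (hE.sq_isResolventAt hz)

theorem inner_sqRes (hE : IsEigenbasis T f μ) (hz : 0 < z) (x : H) (i : ι) :
    ⟪f i, sqRes T z x⟫_ℂ = (((μ i ^ 2 + z)⁻¹ : ℝ) : ℂ) * ⟪f i, x⟫_ℂ := by
  rw [hE.sqRes_eq hz, inner_diag (isBdd_sqRes μ hz)]

theorem sqRes_basis (hE : IsEigenbasis T f μ) (hz : 0 < z) (i : ι) :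
    sqRes T z (f i) = (((μ i ^ 2 + z)⁻¹ : ℝ) : ℂ) • f i := by
  rw [hE.sqRes_eq hz, diag_basis (isBdd_sqRes μ hz)]

theorem mem_sqRes (hE : IsEigenbasis T f μ) (hz : 0 < z) (x : H) : sqRes T z x ∈ D := by
  rw [hE.sqRes_eq hz]; exact hE.sqRes_mem hz x

theorem mem_apply_sqRes (hE : IsEigenbasis T f μ) (hz : 0 < z) (x : H) (hx : sqRes T z x ∈ D) :
    T ⟨sqRes T z x, hx⟩ ∈ D := by
  have h := hE.apply_sqRes_mem hz x
  simpa only [← hE.sqRes_eq hz] using h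

theorem inner_apply_sqRes (hE : IsEigenbasis T f μ) (hz : 0 < z) (x : H) (i : ι)
    (hx : sqRes T z x ∈ D) : ⟪f i, T ⟨sqRes T z x, hx⟩⟫_ℂ =
      (μ i : ℂ) * (((μ i ^ 2 + z)⁻¹ : ℝ) : ℂ) * ⟪f i, x⟫_ℂ := by
  rw [hE.inner_apply, hE.inner_sqRes hz, mul_assoc]

theorem apply_apply_sqRes (hE : IsEigenbasis T f μ) (hz : 0 < z) (x : H) (hx : sqRes T z x ∈ D) :
    T ⟨T ⟨sqRes T z x, hx⟩, hE.mem_apply_sqRes hz x hx⟩ = x - (z : ℂ) • sqRes T z x := by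
  refine hilbertBasis_ext f fun i => ?_
  rw [hE.inner_apply, hE.inner_apply_sqRes hz, inner_sub_right, inner_smul_right,
    hE.inner_sqRes hz]
  have : (μ i : ℂ) ^ 2 + z ≠ 0 := by
    have : μ i ^ 2 + z ≠ 0 := by positivity
    exact_mod_cast this
  push_cast
  field_simp
  ring

theorem sqRes_apply (hE : IsEigenbasis T f μ) (hz : 0 < z) (x : D) (hx : sqRes T z x ∈ D) :
    T ⟨sqRes T z x, hx⟩ = sqRes T z (T x) := by
  refine hilbertBasis_ext f fun i => ?_
  rw [hE.inner_apply_sqRes hz, hE.inner_sqRes hz, hE.inner_apply]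
  ring

theorem sqRes_comm (hE : IsEigenbasis T f μ) (hB : CommutesWithResolvents (op B) (sq (op T)))
    (hz : 0 < z) (x : D) (hx : sqRes T z x ∈ D) : B ⟨sqRes T z x, hx⟩ = sqRes T z (B x) := by
  have h := hE.commute_sqRes hB hz x
  simpa only [← hE.sqRes_eq hz] using h

theorem norm_sqRes_apply_le (hE : IsEigenbasis T f μ) (hz : 0 < z) (x : H) :
    ‖sqRes T z x‖ ≤ z⁻¹ * ‖x‖ := by
  rw [hE.sqRes_eq hz]
  refine norm_diag_apply_le (by positivity) (fun i => ?_) x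
  rw [Complex.norm_real, Real.norm_of_nonneg (by positivity)]
  exact inv_anti₀ hz (by nlinarith [sq_nonneg (μ i)])

theorem norm_apply_sqRes_le (hE : IsEigenbasis T f μ) (hz : 0 < z) (x : H)
    (hx : sqRes T z x ∈ D) : ‖T ⟨sqRes T z x, hx⟩‖ ≤ (1 + z⁻¹) * ‖x‖ := by
  refine norm_le_of_coeff_le f (by positivity) fun i => ?_
  rw [hE.inner_apply_sqRes hz, norm_mul]
  exact mul_le_mul_of_nonneg_right (abs_mul_sqRes_le _ hz) (norm_nonneg _)

theorem sqRes_pow_eq (hE : IsEigenbasis T f μ) (hz : 0 < z) (n : ℕ) :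
    sqRes T z ^ n = diag f fun i => ((((μ i ^ 2 + z)⁻¹) ^ n : ℝ) : ℂ) := by
  have hb := isBdd_sqRes μ hz
  have hbn : ∀ n : ℕ, IsBdd fun i => ((((μ i ^ 2 + z)⁻¹) ^ n : ℝ) : ℂ) := fun n => by
    induction n with
    | zero => exact ⟨1, fun i => by simp⟩
    | succ n ih => simpa only [pow_succ, Complex.ofReal_mul] using ih.mul hb
  refine clm_ext_basis f fun j => ?_
  rw [diag_basis (hbn n)]
  induction n with
  | zero => simp
  | succ n ih =>
    rw [pow_succ', mul_apply_eq_comp, ih, map_smul, hE.sqRes_basis hz, smul_smul,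
      ← Complex.ofReal_mul, ← pow_succ]

theorem isNuclear_sqRes_pow (hE : IsEigenbasis T f μ)
    (hs : Summable fun i => (1 + μ i ^ 2) ^ (-(p / 2))) {m : ℕ} (hm : p / 2 ≤ m) (hz : 0 < z) :
    IsNuclear (sqRes T z ^ m) ((1 + z⁻¹) ^ m * ∑' i, (1 + μ i ^ 2) ^ (-(p / 2))) := by
  have h := summable_sqRes_pow hs hm hz
  rw [hE.sqRes_pow_eq hz]
  exact (isNuclear_diag h.1).mono h.2

theorem exists_comp_sqRes (hE : IsEigenbasis T f μ) (hz : 0 < z) {C : ℝ} (hC : 0 ≤ C)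
    (hB : ∀ x : D, ‖B x‖ ≤ C * (‖(x : H)‖ + ‖T x‖)) :
    ∃ X : H →L[ℂ] H, (∀ x, X x = B ⟨sqRes T z x, hE.mem_sqRes hz x⟩) ∧
      ‖X‖ ≤ C * (1 + 2 * z⁻¹) := by
  refine exists_comp (sqRes T z) (hE.mem_sqRes hz) B (by positivity) fun x => ?_
  refine (hB _).trans ?_
  rw [mul_assoc]
  refine mul_le_mul_of_nonneg_left ?_ hC
  have h1 := hE.norm_sqRes_apply_le hz x
  have h2 := hE.norm_apply_sqRes_le hz x (hE.mem_sqRes hz x)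
  linarith

end IsEigenbasis

/-- `tr (B (T² + z)^{-k})`. -/
def resTrace (T B : D →ₗ[ℂ] H) (k : ℕ) (z : ℝ) : ℂ :=
  trace fun x => app (op B) ((sqRes T z ^ k) x)

theorem IsEigenbasis.resTrace_eq (hE : IsEigenbasis T f μ) (hz : 0 < z) {β : H →L[ℂ] H}
    (hβ : ∀ x, β x = B ⟨sqRes T z x, hE.mem_sqRes hz x⟩) (n : ℕ) :
    resTrace T B (n + 1) z = trace (β * sqRes T z ^ n : H →L[ℂ] H) := by
  rw [resTrace]
  congr 1
  funext x
  rw [pow_succ', mul_apply_eq_comp, app_op B (hE.mem_sqRes hz _), ← hβ]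
  rfl

theorem IsEigenbasis.hasSum_resTrace (hE : IsEigenbasis T f μ) (hz : 0 < z) (hB : RelBdd T B)
    (hs : Summable fun i => (1 + μ i ^ 2) ^ (-(p / 2))) {n : ℕ} (hn : p / 2 ≤ n) :
    HasSum (fun i => ⟪f i, B ⟨f i, hE.mem i⟩⟫_ℂ * ((((μ i ^ 2 + z)⁻¹) ^ (n + 1) : ℝ) : ℂ))
      (resTrace T B (n + 1) z) := by
  obtain ⟨C, hC0, hC⟩ := hB
  obtain ⟨β, hβ, -⟩ := hE.exists_comp_sqRes hz hC0 hC
  rw [hE.resTrace_eq hz hβ, hE.sqRes_pow_eq hz]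
  convert! hasSum_trace_mul_diag (f := f) (summable_sqRes_pow hs hn hz).1 β using 1
  funext i
  have e : (⟨sqRes T z (f i), hE.mem_sqRes hz (f i)⟩ : D)
      = (((μ i ^ 2 + z)⁻¹ : ℝ) : ℂ) • ⟨f i, hE.mem i⟩ := Subtype.ext (hE.sqRes_basis hz i)
  rw [hβ, e, map_smul, inner_smul_right]
  push_cast
  ring

/-- The resolvent identity for `(T² + z)⁻¹`. -/
theorem IsEigenbasis.sqRes_sub (hE : IsEigenbasis T f μ) {T₂ : D →ₗ[ℂ] H} {ι₂ : Type}
    {f₂ : HilbertBasis ι₂ ℂ H} {μ₂ : ι₂ → ℝ} (hE₂ : IsEigenbasis T₂ f₂ μ₂) (hz : 0 < z)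
    {α α₂ X₂ Z Z₂ : H →L[ℂ] H}
    (hα : ∀ x, α x = T ⟨sqRes T z x, hE.mem_sqRes hz x⟩)
    (hα₂ : ∀ x, α₂ x = T₂ ⟨sqRes T₂ z x, hE₂.mem_sqRes hz x⟩)
    (hX₂ : ∀ x, X₂ x = T₂ ⟨sqRes T z x, hE.mem_sqRes hz x⟩)
    (hZ : ∀ x (hx : α x ∈ D), Z x = T ⟨α x, hx⟩)
    (hZ₂ : ∀ x (hx : α x ∈ D), Z₂ x = T₂ ⟨α x, hx⟩) :
    sqRes T₂ z - sqRes T z = -(α₂ * (X₂ - α) + sqRes T₂ z * (Z₂ - Z)) := by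
  ext v
  -- The range of (T²+z)^(-1) need not lie in the domain of T₂², so T₂² - T² is split as T₂(T₂-T) +
  -- (T₂-T)T with T₂(T₂²+z)^(-1) standing for (T₂²+z)^(-1)T₂. Only the common domain D is used.
  have hαm : α v ∈ D := by rw [hα]; exact hE.mem_apply_sqRes hz v _
  set r : D := ⟨sqRes T z v, hE.mem_sqRes hz v⟩ with hr
  -- `T₂ R₂ T₂ r = r - z R₂ r`
  have e1 : α₂ (X₂ v) = (r : H) - (z : ℂ) • sqRes T₂ z (r : H) := by
    rw [hX₂, hα₂, ← hE₂.apply_apply_sqRes hz (r : H) (hE₂.mem_sqRes hz _)]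
    exact congrArg T₂ (Subtype.ext (hE₂.sqRes_apply hz r (hE₂.mem_sqRes hz _)).symm)
  have e2 : α₂ (α v) = sqRes T₂ z (Z₂ v) := by
    rw [hα₂, hZ₂ v hαm]
    exact hE₂.sqRes_apply hz ⟨α v, hαm⟩ _
  have e3 : Z v = v - (z : ℂ) • (r : H) := by
    rw [hZ v hαm, ← hE.apply_apply_sqRes hz v (hE.mem_sqRes hz v)]
    exact congrArg T (Subtype.ext (hα v))
  simp only [sub_apply, neg_apply, add_apply, mul_apply_eq_comp, map_sub]
  rw [e1, e2, e3, map_sub, map_smul]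
  change _ - (r : H) = _
  abel

end EtaVar

namespace EtaVar

variable {H : Type*} [NormedAddCommGroup H] [InnerProductSpace ℂ H] [CompleteSpace H]
variable {D : Submodule ℂ H} {p z : ℝ}

/-! ### The derivative of `tr (B (A² + z)^{-k})` -/

/-- Composition of a strongly differentiable family with a regularizing operator. -/
theorem STendsto.of_hasDerivAt {Y : ℝ → D →ₗ[ℂ] H} {T Y' : D →ₗ[ℂ] H} {a ε C K : ℝ}
    (hY : ∀ x, HasDerivAt (fun b => Y b x) (Y' x) a) (hε : 0 < ε) (hC : 0 ≤ C)
    (hbd : ∀ b ∈ Metric.ball a ε, ∀ x : D,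
      ‖Y b x - Y a x‖ ≤ C * |b - a| * (‖(x : H)‖ + ‖T x‖))
    {S : H →L[ℂ] H} (hS : ∀ x, S x ∈ D) (hK : 0 ≤ K)
    (hSK : ∀ x, ‖S x‖ + ‖T ⟨S x, hS x⟩‖ ≤ K * ‖x‖) {X : ℝ → H →L[ℂ] H}
    (hX : ∀ b ∈ Metric.ball a ε, ∀ x, X b x = Y b ⟨S x, hS x⟩) {X' : H →L[ℂ] H}
    (hX' : ∀ x, X' x = Y' ⟨S x, hS x⟩) :
    STendsto (fun b => (((b - a)⁻¹ : ℝ) : ℂ) • (X b - X a)) (nhdsWithin a {a}ᶜ) X' ∧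
      Filter.Tendsto X (nhdsWithin a {a}ᶜ) (nhds (X a)) := by
  have ha := Metric.mem_ball_self (x := a) hε
  have hev : ∀ᶠ b in nhdsWithin a {a}ᶜ, b ∈ Metric.ball a ε :=
    mem_nhdsWithin_of_mem_nhds (Metric.ball_mem_nhds a hε)
  -- This Lipschitz bound gives both the boundedness of the difference quotients and the norm
  -- continuity of X.
  have hn : ∀ b ∈ Metric.ball a ε, ‖X b - X a‖ ≤ C * K * |b - a| := fun b hb => by
    refine ContinuousLinearMap.opNorm_le_bound _ (by positivity) fun x => ?_
    rw [sub_apply, hX b hb, hX a ha]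
    refine (hbd b hb _).trans ?_
    have := mul_le_mul_of_nonneg_left (hSK x) (mul_nonneg hC (abs_nonneg (b - a)))
    linarith
  have h0 : Filter.Tendsto (fun b => |b - a|) (nhdsWithin a {a}ᶜ) (nhds 0) := by
    have : Filter.Tendsto (fun b => |b - a|) (nhds a) (nhds |a - a|) :=
      (by fun_prop : Continuous fun b => |b - a|).tendsto a
    rw [sub_self, abs_zero] at this
    exact this.mono_left nhdsWithin_le_nhds
  refine ⟨⟨⟨C * K, ?_⟩, fun x => ?_⟩, ?_⟩
  · filter_upwards [hev, self_mem_nhdsWithin] with b hb hne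
    have hpos : 0 < |b - a| := abs_pos.mpr (sub_ne_zero.mpr hne)
    rw [norm_smul, Complex.norm_real, norm_inv, Real.norm_eq_abs, inv_mul_le_iff₀ hpos]
    linarith [hn b hb]
  · rw [hX']
    refine (tendsto_slope_complex (hY ⟨S x, hS x⟩)).congr' ?_
    filter_upwards [hev] with b hb
    rw [smul_apply, sub_apply, hX b hb, hX a ha]
  · rw [tendsto_iff_norm_sub_tendsto_zero]
    have h1 : Filter.Tendsto (fun b => C * K * |b - a|) (nhdsWithin a {a}ᶜ) (nhds 0) := by
      simpa using h0.const_mul (C * K)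
    refine squeeze_zero' (Filter.Eventually.of_forall fun _ => norm_nonneg _) ?_ h1
    filter_upwards [hev] with b hb using hn b hb

theorem tendsto_mul_of_bound {α : Type*} {l : Filter α} {X Y : α → H →L[ℂ] H} {C : ℝ}
    (hX : ∀ᶠ b in l, ‖X b‖ ≤ C) (hY : Filter.Tendsto Y l (nhds 0)) :
    Filter.Tendsto (fun b => X b * Y b) l (nhds 0) := by
  have h1 : Filter.Tendsto (fun b => C * ‖Y b‖) l (nhds 0) := by simpa using hY.norm.const_mul C
  refine squeeze_zero_norm' ?_ h1
  filter_upwards [hX] with b hb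
  exact (norm_mul_le _ _).trans (mul_le_mul_of_nonneg_right hb (norm_nonneg _))

theorem tendsto_clm_apply {α : Type*} {l : Filter α} {X : α → H →L[ℂ] H} {Y : H →L[ℂ] H}
    {v : α → H} {w : H} (hX : Filter.Tendsto X l (nhds Y)) (hv : Filter.Tendsto v l (nhds w)) :
    Filter.Tendsto (fun b => X b (v b)) l (nhds (Y w)) :=
  ((isBoundedBilinearMap_apply (𝕜 := ℂ) (E := H) (F := H)).continuous.tendsto (Y, w)).comp
    (hX.prodMk_nhds hv)

namespace VarData

variable {T T' B : D →ₗ[ℂ] H} {ι : Type} {f : HilbertBasis ι ℂ H} {μ : ι → ℝ} {δ : ℝ}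

/-- Diagonal entries of the derivative of the resolvent. -/
theorem inner_deriv_sqRes (h : VarData T T' B f μ δ) (hz : 0 < z) {α β X' Z' : H →L[ℂ] H}
    (hα : ∀ x, α x = T ⟨sqRes T z x, h.eigen.mem_sqRes hz x⟩)
    (hβ : ∀ x, β x = B ⟨sqRes T z x, h.eigen.mem_sqRes hz x⟩)
    (hX' : ∀ x, X' x = T' ⟨sqRes T z x, h.eigen.mem_sqRes hz x⟩)
    (hZ' : ∀ x (hx : α x ∈ D), Z' x = T' ⟨α x, hx⟩) (i : ι) :
    ⟪f i, (-(α * X' + sqRes T z * Z') * β) (f i)⟫_ℂ =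
      -(h.coef i * ((((μ i ^ 2 + z)⁻¹) ^ 3 : ℝ) : ℂ)) := by
  set ρ : ℂ := (((μ i ^ 2 + z)⁻¹ : ℝ) : ℂ) with hρ
  have hfi : (⟨sqRes T z (f i), h.eigen.mem_sqRes hz (f i)⟩ : D) = ρ • ⟨f i, h.eigen.mem i⟩ :=
    Subtype.ext (h.eigen.sqRes_basis hz i)
  have hβf : β (f i) = ρ • B ⟨f i, h.eigen.mem i⟩ := by rw [hβ, hfi, map_smul]
  have hRB : sqRes T z (B ⟨f i, h.eigen.mem i⟩) = ρ • B ⟨f i, h.eigen.mem i⟩ := by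
    rw [← h.eigen.sqRes_comm h.comm hz ⟨f i, h.eigen.mem i⟩ (h.eigen.mem_sqRes hz _), hfi, map_smul]
  have hRβ : (⟨sqRes T z (β (f i)), h.eigen.mem_sqRes hz _⟩ : D) =
      (ρ ^ 2) • ⟨B ⟨f i, h.eigen.mem i⟩, h.apply_basis_mem i⟩ := Subtype.ext (by
    change sqRes T z (β (f i)) = ρ ^ 2 • B ⟨f i, h.eigen.mem i⟩
    rw [hβf, map_smul, hRB, smul_smul, pow_two])
  have hαβ : α (β (f i)) = ρ ^ 2 • T ⟨B ⟨f i, h.eigen.mem i⟩, h.apply_basis_mem i⟩ := by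
    rw [hα, hRβ, map_smul]
  have hαm : α (β (f i)) ∈ D := by rw [hα]; exact h.eigen.mem_apply_sqRes hz _ _
  have e1 : ⟪f i, α (X' (β (f i)))⟫_ℂ = ρ ^ 3 * ⟪T ⟨f i, h.eigen.mem i⟩,
      T' ⟨B ⟨f i, h.eigen.mem i⟩, h.apply_basis_mem i⟩⟫_ℂ := by
    rw [hα, h.eigen.inner_apply_sqRes hz, hX', hRβ, map_smul, inner_smul_right,
      h.eigen.apply_basis, inner_smul_left, Complex.conj_ofReal, ← hρ]
    ring
  have e2 : ⟪f i, sqRes T z (Z' (β (f i)))⟫_ℂ = ρ ^ 3 * ⟪T' ⟨f i, h.eigen.mem i⟩,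
      T ⟨B ⟨f i, h.eigen.mem i⟩, h.apply_basis_mem i⟩⟫_ℂ := by
    rw [h.eigen.inner_sqRes hz, hZ' _ hαm, ← h.symm ⟨f i, h.eigen.mem i⟩ ⟨_, hαm⟩]
    change ρ * ⟪T' ⟨f i, h.eigen.mem i⟩, α (β (f i))⟫_ℂ = _
    rw [hαβ, inner_smul_right]
    ring
  rw [mul_apply_eq_comp, neg_apply, inner_neg_right, add_apply, inner_add_right,
    mul_apply_eq_comp, mul_apply_eq_comp, e1, e2, coef, Complex.ofReal_pow, ← hρ]
  ring

end VarData

namespace VarFamily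

variable {J : Set ℝ} {A A' B B' : ℝ → D →ₗ[ℂ] H} {a : ℝ}

/-- One resolvent is absorbed into β_b = B_b R_b, leaving β_b R_b^(3m+1). The derivative of R
contributes 3m+2 equal traces by cyclicity and commutation, and B' contributes one more term; both
are evaluated in the eigenbasis at a. -/
theorem hasDerivAt_resTrace (h : VarFamily J A A' B B') (ha : a ∈ J) (hp : 0 < p)
    (hpa : ResolventMemSchatten p (op (A a))) (hz : 0 < z) {m : ℕ} (hm : p / 2 ≤ m) {ι : Type}
    {f : HilbertBasis ι ℂ H} {μ : ι → ℝ} {δ : ℝ} (V : VarData (A a) (A' a) (B a) f μ δ)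
    (hs : Summable fun i => (1 + μ i ^ 2) ^ (-(p / 2))) :
    HasDerivAt (fun b => resTrace (A b) (B b) (3 * m + 2) z)
      (∑' i, ⟪f i, B' a ⟨f i, V.eigen.mem i⟩⟫_ℂ * ((((μ i ^ 2 + z)⁻¹) ^ (3 * m + 2) : ℝ) : ℂ) -
        (3 * m + 2 : ℕ) * ∑' i, V.coef i * ((((μ i ^ 2 + z)⁻¹) ^ (3 * m + 3) : ℝ) : ℂ)) a := by
  obtain ⟨ε, hε, C, hC, δ', hδ', M, hεJ, hbd, hctl⟩ := h.exists_local ha hp hpa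
  have haε := Metric.mem_ball_self (x := a) hε
  set l := nhdsWithin a {a}ᶜ with hl
  have hev : ∀ᶠ b in l, b ∈ Metric.ball a ε :=
    mem_nhdsWithin_of_mem_nhds (Metric.ball_mem_nhds a hε)
  have hrel' : ∀ {Y Y' : ℝ → D →ₗ[ℂ] H}, HasStrongDeriv J Y Y' → (∀ b ∈ J, RelBdd (A b) (Y b)) →
      RelBdd (A a) (Y' a) := fun hY hr => hY.relBdd_deriv h.isOpen V.eigen (fun b hb => by
    obtain ⟨_, _, _, hE₂⟩ := h.eigen b hb
    exact (V.eigen.relBdd hE₂).trans (hr b hb)) ha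
  set R := fun b => sqRes (A b) z with hRdef
  have hRmem : ∀ b ∈ Metric.ball a ε, ∀ x, R b x ∈ D := fun b hb x => by
    obtain ⟨_, _, _, hc⟩ := hctl b hb
    exact hc.var.eigen.mem_sqRes hz x
  -- the regularized operators
  have hα₀ : ∀ b, ∃ X : H →L[ℂ] H, ∀ hb : b ∈ Metric.ball a ε,
      (∀ x, X x = A b ⟨R b x, hRmem b hb x⟩) ∧ ‖X‖ ≤ 1 * (1 + 2 * z⁻¹) := fun b => by
    by_cases hb : b ∈ Metric.ball a ε
    · obtain ⟨_, _, _, hc⟩ := hctl b hb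
      obtain ⟨X, hX⟩ := hc.var.eigen.exists_comp_sqRes hz zero_le_one
        (B := A b) (fun x => by linarith [norm_nonneg (x : H)])
      exact ⟨X, fun _ => hX⟩
    · exact ⟨0, fun h => absurd h hb⟩
  have hβ₀ : ∀ b, ∃ X : H →L[ℂ] H, ∀ hb : b ∈ Metric.ball a ε,
      (∀ x, X x = B b ⟨R b x, hRmem b hb x⟩) ∧ ‖X‖ ≤ C * (1 + 2 * z⁻¹) := fun b => by
    by_cases hb : b ∈ Metric.ball a ε
    · obtain ⟨_, _, _, hc⟩ := hctl b hb
      obtain ⟨X, hX⟩ := hc.var.eigen.exists_comp_sqRes hz hC fun x => (hc.bound x).2.1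
      exact ⟨X, fun _ => hX⟩
    · exact ⟨0, fun h => absurd h hb⟩
  choose α hα using hα₀
  choose β hβ using hβ₀
  have hαm : ∀ x, α a x ∈ D := fun x => by
    rw [(hα a haε).1]; exact V.eigen.mem_apply_sqRes hz _ _
  have hgR : ∀ x, ‖R a x‖ + ‖A a ⟨R a x, hRmem a haε x⟩‖ ≤ (1 + 2 * z⁻¹) * ‖x‖ := fun x => by
    have h1 := V.eigen.norm_sqRes_apply_le hz x
    have h2 := V.eigen.norm_apply_sqRes_le hz x (hRmem a haε x)
    linarith
  have hAα : ∀ x, A a ⟨α a x, hαm x⟩ = x - (z : ℂ) • R a x := fun x => by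
    rw [← V.eigen.apply_apply_sqRes hz x (hRmem a haε x)]
    exact congrArg (A a) (Subtype.ext ((hα a haε).1 x))
  have hgα : ∀ x, ‖α a x‖ + ‖A a ⟨α a x, hαm x⟩‖ ≤ (3 + 2 * z⁻¹) * ‖x‖ := fun x => by
    have h1 := (α a).le_of_opNorm_le (hα a haε).2 x
    have h2 := V.eigen.norm_sqRes_apply_le hz x
    have h3 : ‖(z : ℂ) • R a x‖ ≤ ‖x‖ := by
      rw [norm_smul, Complex.norm_real, Real.norm_of_nonneg hz.le]
      calc z * ‖R a x‖ ≤ z * (z⁻¹ * ‖x‖) := mul_le_mul_of_nonneg_left h2 hz.le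
        _ = ‖x‖ := by field_simp
    rw [hAα]
    linarith [norm_sub_le x ((z : ℂ) • R a x)]
  -- existence of compositions with `R a` and `α a`
  have hcomp : ∀ {S : H →L[ℂ] H} (hS : ∀ x, S x ∈ D) {K : ℝ}, 0 ≤ K →
      (∀ x, ‖S x‖ + ‖A a ⟨S x, hS x⟩‖ ≤ K * ‖x‖) → ∀ Y : D →ₗ[ℂ] H, RelBdd (A a) Y →
      ∃ X : H →L[ℂ] H, ∀ x, X x = Y ⟨S x, hS x⟩ := fun {S} hS {K} hK hSK Y hY => by
    obtain ⟨C₁, hC₁, hY⟩ := hY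
    obtain ⟨X, hX, -⟩ := exists_comp S hS Y (C := C₁ * K) (by positivity) fun x => by
      refine (hY _).trans ?_
      rw [mul_assoc]
      exact mul_le_mul_of_nonneg_left (hSK x) hC₁
    exact ⟨X, hX⟩
  have hKR : 0 ≤ 1 + 2 * z⁻¹ := by positivity
  have hKα : 0 ≤ 3 + 2 * z⁻¹ := by positivity
  have hrelA : ∀ b ∈ Metric.ball a ε, RelBdd (A a) (A b) := fun b hb => by
    obtain ⟨_, _, _, hc⟩ := hctl b hb
    exact V.eigen.relBdd hc.var.eigen
  have hfam : ∀ {S : H →L[ℂ] H} (hS : ∀ x, S x ∈ D) {K : ℝ}, 0 ≤ K →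
      (∀ x, ‖S x‖ + ‖A a ⟨S x, hS x⟩‖ ≤ K * ‖x‖) → ∀ Y : ℝ → D →ₗ[ℂ] H,
      (∀ b ∈ Metric.ball a ε, RelBdd (A a) (Y b)) →
      ∃ X : ℝ → H →L[ℂ] H, ∀ b ∈ Metric.ball a ε, ∀ x, X b x = Y b ⟨S x, hS x⟩ :=
    fun {S} hS {K} hK hSK Y hY => by
      have : ∀ b, ∃ X : H →L[ℂ] H, b ∈ Metric.ball a ε → ∀ x, X x = Y b ⟨S x, hS x⟩ := fun b => by
        by_cases hb : b ∈ Metric.ball a ε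
        · obtain ⟨X, hX⟩ := hcomp hS hK hSK (Y b) (hY b hb)
          exact ⟨X, fun _ => hX⟩
        · exact ⟨0, fun h => absurd h hb⟩
      choose X hX using this
      exact ⟨X, hX⟩
  have hrelB : ∀ b ∈ Metric.ball a ε, RelBdd (A a) (B b) := fun b hb =>
    (hrelA b hb).trans (h.relB b (hεJ hb))
  obtain ⟨X, hX⟩ := hfam (hRmem a haε) hKR hgR A hrelA
  obtain ⟨Z, hZ⟩ := hfam hαm hKα hgα A hrelA
  obtain ⟨γ, hγ⟩ := hfam (hRmem a haε) hKR hgR B hrelB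
  have hrA' := hrel' h.derivA fun b _ => relBdd_self (A b)
  have hrB' := hrel' h.derivB h.relB
  obtain ⟨X', hX'⟩ := hcomp (hRmem a haε) hKR hgR (A' a) hrA'
  obtain ⟨Z', hZ'⟩ := hcomp hαm hKα hgα (A' a) hrA'
  obtain ⟨γ', hγ'⟩ := hcomp (hRmem a haε) hKR hgR (B' a) hrB'
  have limX := STendsto.of_hasDerivAt (fun x => (h.derivA x).1 a ha) hε hC
    (fun b hb x => (hbd b hb x).1) (hRmem a haε) hKR hgR hX hX'
  have limZ := STendsto.of_hasDerivAt (fun x => (h.derivA x).1 a ha) hε hC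
    (fun b hb x => (hbd b hb x).1) hαm hKα hgα hZ hZ'
  have limγ := STendsto.of_hasDerivAt (fun x => (h.derivB x).1 a ha) hε hC
    (fun b hb x => (hbd b hb x).2) (hRmem a haε) hKR hgR hγ hγ'
  have hXa : X a = α a := by ext x; rw [hX a haε, (hα a haε).1]
  have hγa : γ a = β a := by ext x; rw [hγ a haε, (hβ a haε).1]
  -- the resolvent identity
  have hres : ∀ b ∈ Metric.ball a ε, R b - R a = -(α b * (X b - X a) + R b * (Z b - Z a)) :=
    fun b hb => by
      obtain ⟨_, _, _, hc⟩ := hctl b hb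
      rw [hXa]
      exact V.eigen.sqRes_sub hc.var.eigen hz (hα a haε).1 (hα b hb).1 (hX b hb)
        (fun x _ => hZ a haε x) (fun x _ => hZ b hb x)
  have hαb : ∀ᶠ b in l, ‖α b‖ ≤ 1 * (1 + 2 * z⁻¹) := hev.mono fun b hb => (hα b hb).2
  have hRb : ∀ᶠ b in l, ‖R b‖ ≤ z⁻¹ := hev.mono fun b hb => by
    obtain ⟨_, _, _, hc⟩ := hctl b hb
    exact ContinuousLinearMap.opNorm_le_bound _ (by positivity)
      fun x => hc.var.eigen.norm_sqRes_apply_le hz x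
  have limR : Filter.Tendsto R l (nhds (R a)) := by
    rw [tendsto_iff_norm_sub_tendsto_zero]
    have h1 := tendsto_mul_of_bound hαb (tendsto_sub_nhds_zero_iff.mpr limX.2)
    have h2 := tendsto_mul_of_bound hRb (tendsto_sub_nhds_zero_iff.mpr limZ.2)
    have h3 := (h1.add h2).neg.norm
    rw [add_zero, neg_zero, norm_zero] at h3
    refine h3.congr' ?_
    filter_upwards [hev] with b hb
    rw [hres b hb]
  -- On D one has α_b x = R_b A_b x, where R_b converges in norm and A_b x converges; density and
  -- the uniform bound extend this to H.
  have limα : STendsto α l (α a) := by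
    refine STendsto.of_dense V.eigen.dense hαb fun x hx => ?_
    have h1 : Filter.Tendsto (fun b => R b (A b ⟨x, hx⟩)) l (nhds (R a (A a ⟨x, hx⟩))) :=
      tendsto_clm_apply limR (((h.derivA ⟨x, hx⟩).1 a ha).continuousAt.tendsto.mono_left nhdsWithin_le_nhds)
    have h2 : ∀ b ∈ Metric.ball a ε, α b x = R b (A b ⟨x, hx⟩) := fun b hb => by
      obtain ⟨_, _, _, hc⟩ := hctl b hb
      rw [(hα b hb).1]
      exact hc.var.eigen.sqRes_apply hz ⟨x, hx⟩ _
    rw [h2 a haε]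
    refine h1.congr' ?_
    filter_upwards [hev] with b hb
    rw [h2 b hb]
  have hRB : ∀ b ∈ Metric.ball a ε, ∀ x : D, β b x = R b (B b x) := fun b hb x => by
    obtain ⟨_, _, _, hc⟩ := hctl b hb
    rw [(hβ b hb).1]
    exact hc.var.eigen.sqRes_comm hc.var.comm hz x _
  have limβ : STendsto β l (β a) := by
    refine STendsto.of_dense V.eigen.dense (hev.mono fun b hb => (hβ b hb).2) fun x hx => ?_
    have h1 : Filter.Tendsto (fun b => R b (B b ⟨x, hx⟩)) l (nhds (R a (B a ⟨x, hx⟩))) :=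
      tendsto_clm_apply limR (((h.derivB ⟨x, hx⟩).1 a ha).continuousAt.tendsto.mono_left nhdsWithin_le_nhds)
    have h2 := hRB a haε ⟨x, hx⟩
    rw [← h2] at h1
    refine h1.congr' ?_
    filter_upwards [hev] with b hb
    rw [← hRB b hb ⟨x, hx⟩]
  set R' := -(α a * X' + R a * Z') with hR'
  set s : ℝ → ℂ := fun b => (((b - a)⁻¹ : ℝ) : ℂ) with hsdef
  have limΔ : STendsto (fun b => s b • (R b - R a)) l R' := by
    refine ((limα.mul limX.1).add ((STendsto.of_tendsto limR).mul limZ.1)).neg.congr' ?_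
    filter_upwards [hev] with b hb
    rw [hres b hb, smul_neg, smul_add, mul_smul_comm, mul_smul_comm]
  have hcomm : β a * R a = R a * β a := by
    ext x
    rw [mul_apply_eq_comp, mul_apply_eq_comp, hRB a haε ⟨R a x, hRmem a haε x⟩, (hβ a haε).1]
  have hnuc : ∀ b ∈ Metric.ball a ε, IsNuclear (R b ^ m) ((1 + z⁻¹) ^ m * M) := fun b hb => by
    obtain ⟨_, _, _, hc⟩ := hctl b hb
    exact (hc.var.eigen.isNuclear_sqRes_pow hc.summable hm hz).mono
      (mul_le_mul_of_nonneg_left hc.tsum_le (by positivity))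
  have hnuca := hnuc a haε
  -- The increment has three parts: replacing 3m+1 factors R_a by R_b behind β_b, replacing the
  -- factor R inside β, and replacing B. The first two give 3m+1 and 1 copies of tr(R'βR^(3m)), the
  -- third gives the B' term.
  have lim1 := tendsto_trace_pow_sub limR limΔ limβ hcomm (hev.mono hnuc) hnuca
    (n := 3 * m) le_rfl (3 * m + 1) 0 rfl
  obtain ⟨d, hd⟩ := hnuca.pow_of_le (show m ≤ 3 * m by lia)
  have lim2 := (limΔ.mul (STendsto.of_tendsto limγ.2)).tendsto_trace_mul hd
  have lim3 := ((STendsto.const (R a)).mul limγ.1).tendsto_trace_mul hd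
  have lim := (lim1.add lim2).add lim3
  rw [hasDerivAt_iff_tendsto_slope]
  -- evaluation of the limit
  have hτ : HasSum (fun i => -(V.coef i * ((((μ i ^ 2 + z)⁻¹) ^ (3 * m + 3) : ℝ) : ℂ)))
      (trace (R' * β a * R a ^ (3 * m) : H →L[ℂ] H)) := by
    have h3m : p / 2 ≤ ((3 * m : ℕ) : ℝ) := by push_cast; linarith [(Nat.cast_nonneg m : (0 : ℝ) ≤ m)]
    have h1 := hasSum_trace_mul_diag (f := f) (summable_sqRes_pow hs h3m hz).1 (R' * β a)
    rw [← V.eigen.sqRes_pow_eq hz] at h1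
    convert! h1 using 1
    funext i
    rw [V.inner_deriv_sqRes hz (hα a haε).1 (hβ a haε).1 hX' (fun x _ => hZ' x) i]
    push_cast
    ring
  have hσ : HasSum (fun i => ⟪f i, B' a ⟨f i, V.eigen.mem i⟩⟫_ℂ *
      ((((μ i ^ 2 + z)⁻¹) ^ (3 * m + 2) : ℝ) : ℂ))
      (trace (R a * γ' * R a ^ (3 * m) : H →L[ℂ] H)) := by
    have h3m : p / 2 ≤ ((3 * m : ℕ) : ℝ) := by push_cast; linarith [(Nat.cast_nonneg m : (0 : ℝ) ≤ m)]
    have h1 := hasSum_trace_mul_diag (f := f) (summable_sqRes_pow hs h3m hz).1 (R a * γ')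
    rw [← V.eigen.sqRes_pow_eq hz] at h1
    convert! h1 using 1
    funext i
    have e : (⟨R a (f i), hRmem a haε (f i)⟩ : D) = (((μ i ^ 2 + z)⁻¹ : ℝ) : ℂ) •
        ⟨f i, V.eigen.mem i⟩ := Subtype.ext (V.eigen.sqRes_basis hz i)
    rw [mul_apply_eq_comp, V.eigen.inner_sqRes hz, hγ', e, map_smul, inner_smul_right]
    push_cast
    ring
  have hval : ((3 * m + 1 : ℕ) : ℂ) * trace (R' * β a * R a ^ (3 * m) : H →L[ℂ] H) +
      trace (R' * γ a * R a ^ (3 * m) : H →L[ℂ] H) + trace (R a * γ' * R a ^ (3 * m) : H →L[ℂ] H) =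
      ∑' i, ⟪f i, B' a ⟨f i, V.eigen.mem i⟩⟫_ℂ * ((((μ i ^ 2 + z)⁻¹) ^ (3 * m + 2) : ℝ) : ℂ) -
        (3 * m + 2 : ℕ) * ∑' i, V.coef i * ((((μ i ^ 2 + z)⁻¹) ^ (3 * m + 3) : ℝ) : ℂ) := by
    rw [hγa, ← hτ.tsum_eq, ← hσ.tsum_eq, tsum_neg]
    push_cast
    ring
  rw [hval] at lim
  refine lim.congr' ?_
  filter_upwards [hev] with b hb
  obtain ⟨_, _, _, hc⟩ := hctl b hb
  have eG : ∀ c ∈ Metric.ball a ε, resTrace (A c) (B c) (3 * m + 2) z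
      = trace (β c * R c ^ (3 * m + 1) : H →L[ℂ] H) := fun c hc => by
    obtain ⟨_, _, _, hc'⟩ := hctl c hc
    exact hc'.var.eigen.resTrace_eq hz (hβ c hc).1 (3 * m + 1)
  -- B_c commutes with R_c, so R_c can be brought to the left and B_c acts on R_a instead, whose
  -- range does not depend on c.
  have hβR : ∀ c ∈ Metric.ball a ε, β c * R a ^ (3 * m + 1) = R c * γ c * R a ^ (3 * m) :=
    fun c hc => by
      rw [pow_succ', ← mul_assoc]
      congr 1
      ext x
      rw [mul_apply_eq_comp, mul_apply_eq_comp, hRB c hc ⟨R a x, hRmem a haε x⟩, hγ c hc]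
  rw [slope_def_module, ← Complex.coe_smul, smul_eq_mul, eG b hb, eG a haε]
  have e1 : R b * γ b * R a ^ (3 * m) - R a * γ a * R a ^ (3 * m) =
      (R b - R a) * γ b * R a ^ (3 * m) + R a * (γ b - γ a) * R a ^ (3 * m) := by
    simp only [sub_mul, mul_sub]
    abel
  have e2 : trace (β b * R a ^ (3 * m + 1) : H →L[ℂ] H) - trace (β a * R a ^ (3 * m + 1) : H →L[ℂ] H)
      = trace ((R b - R a) * γ b * R a ^ (3 * m) : H →L[ℂ] H) +
        trace (R a * (γ b - γ a) * R a ^ (3 * m) : H →L[ℂ] H) := by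
    rw [hβR b hb, hβR a haε, ← (hd.mul_left _).trace_add (hd.mul_left _), ← e1]
    have h9 := hd.mul_left (R b * γ b - R a * γ a)
    rw [sub_mul] at h9
    exact (h9.trace_sub (hd.mul_left _)).symm
  simp only [smul_mul_assoc, mul_smul_comm, IsNuclear.trace_smul, pow_zero, mul_one]
  rw [add_assoc, ← mul_add, ← e2]
  simp only [hsdef]
  ring

end VarFamily

end EtaVar

namespace EtaVar

variable {H : Type*} [NormedAddCommGroup H] [InnerProductSpace ℂ H] [CompleteSpace H]
variable {D : Submodule ℂ H} {p : ℝ}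

open MeasureTheory

/-! ### Differentiation of the eta function -/

/-- Near 0 the second factor is bounded by δ^v; at infinity the product is dominated by z^(u+v). -/
theorem integrableOn_rpow_mul_rpow {u v δ : ℝ} (hδ : 0 < δ) (hu : -1 < u) (hv : v ≤ 0)
    (huv : u + v < -1) : IntegrableOn (fun z : ℝ => z ^ u * (δ + z) ^ v) (Set.Ioi 0) := by
  have hmeas : ∀ s : Set ℝ, AEStronglyMeasurable (fun z : ℝ => z ^ u * (δ + z) ^ v)
      (volume.restrict s) := fun s => by
    refine Measurable.aestronglyMeasurable ?_
    exact (measurable_id.pow_const u).mul ((measurable_const.add measurable_id).pow_const v)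
  have hpos : ∀ z : ℝ, 0 < z → 0 ≤ z ^ u * (δ + z) ^ v := fun z hz => by positivity
  rw [← Set.Ioc_union_Ioi_eq_Ioi zero_le_one]
  refine IntegrableOn.union ?_ ?_
  · have h1 : IntegrableOn (fun z : ℝ => z ^ u * δ ^ v) (Set.Ioc 0 1) :=
      ((intervalIntegrable_iff_integrableOn_Ioc_of_le zero_le_one).mp
        (intervalIntegral.intervalIntegrable_rpow' hu)).mul_const _
    refine Integrable.mono' h1 (hmeas _) ?_
    filter_upwards [ae_restrict_mem measurableSet_Ioc] with z hz
    rw [Real.norm_of_nonneg (hpos z hz.1)]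
    exact mul_le_mul_of_nonneg_left
      (Real.rpow_le_rpow_of_nonpos hδ (by linarith [hz.1]) hv) (Real.rpow_nonneg hz.1.le _)
  · refine Integrable.mono' (integrableOn_Ioi_rpow_of_lt huv one_pos) (hmeas _) ?_
    filter_upwards [ae_restrict_mem measurableSet_Ioi] with z hz
    have hz0 : (0 : ℝ) < z := one_pos.trans hz
    rw [Real.norm_of_nonneg (hpos z hz0), Real.rpow_add hz0]
    exact mul_le_mul_of_nonneg_left
      (Real.rpow_le_rpow_of_nonpos hz0 (by linarith) hv) (Real.rpow_nonneg hz0.le _)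

theorem jb_pow_three (r : ℝ) : jb r ^ 3 = (1 + r ^ 2) ^ (3 / 2 : ℝ) := by
  rw [jb_eq_rpow, ← Real.rpow_natCast, ← Real.rpow_mul (by positivity)]
  norm_num

theorem betaIntegral_ne_zero {u v : ℂ} (hu : 0 < u.re) (hv : 0 < v.re) :
    Complex.betaIntegral u v ≠ 0 := by
  rw [Complex.betaIntegral_eq_Gamma_mul_div u v hu hv]
  exact div_ne_zero (mul_ne_zero (Complex.Gamma_ne_zero_of_re_pos hu)
    (Complex.Gamma_ne_zero_of_re_pos hv)) (Complex.Gamma_ne_zero_of_re_pos (by simp; linarith))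

/-- With u = k-q and v = q this reads k Β(k-q, q+1) = q Β(k-q, q): the k from differentiating a k-th
power turns into the factor q = (s+1)/2 of the variation formula. -/
theorem add_mul_betaIntegral_add_one {u v : ℂ} (hu : 0 < u.re) (hv : 0 < v.re) :
    (u + v) * Complex.betaIntegral u (v + 1) = v * Complex.betaIntegral u v := by
  have huv : 0 < (u + v).re := by simp; linarith
  have h0 : u + v ≠ 0 := fun h => by rw [h] at huv; simp at huv
  have hv0 : v ≠ 0 := fun h => by rw [h] at hv; simp at hv
  rw [Complex.betaIntegral_eq_Gamma_mul_div u v hu hv,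
    Complex.betaIntegral_eq_Gamma_mul_div u (v + 1) hu (by simp; linarith), ← add_assoc,
    Complex.Gamma_add_one _ h0, Complex.Gamma_add_one _ hv0]
  have := Complex.Gamma_ne_zero_of_re_pos huv
  field_simp

/-! ### Integral representations at a fixed parameter -/

section Fixed

variable {T T' B : D →ₗ[ℂ] H} {ι : Type} {f : HilbertBasis ι ℂ H} {μ : ι → ℝ} {δ : ℝ}

/-- The eta function as an integral over resolvent traces. -/
theorem IsEigenbasis.integral_resTrace (hE : IsEigenbasis T f μ) (hp : 0 < p)
    (hs : Summable fun i => (1 + μ i ^ 2) ^ (-(p / 2))) (hB : RelBdd T B)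
    (h0 : ∀ i, μ i = 0 → ⟪f i, B ⟨f i, hE.mem i⟩⟫_ℂ = 0) {s : ℂ} (hps : p < s.re) {n : ℕ}
    (hn : p / 2 ≤ n) (hk : ((s + 1) / 2).re < (n + 1 : ℕ)) :
    IntegrableOn (fun z : ℝ => (z : ℂ) ^ (((n + 1 : ℕ) : ℂ) - 1 - (s + 1) / 2) *
      resTrace T B (n + 1) z) (Set.Ioi 0) ∧
    ∫ z in Set.Ioi (0 : ℝ), (z : ℂ) ^ (((n + 1 : ℕ) : ℂ) - 1 - (s + 1) / 2) *
      resTrace T B (n + 1) z =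
    Complex.betaIntegral ((n + 1 : ℕ) - (s + 1) / 2) ((s + 1) / 2) * eta (op T) (app (op B)) s := by
  have := countable_of_summable hs
  obtain ⟨δ, hδ, hgap⟩ := exists_gap hp hs
  have hη := (hE.etaDefined_of_relBdd hp hs hB h0 hps).2
  obtain ⟨C, hC0, hC⟩ := id hB
  have hre : ((s + 1) / 2).re = (s.re + 1) / 2 := by simp
  have hc : ∀ i, ⟪f i, B ⟨f i, hE.mem i⟩⟫_ℂ = 0 ∨ μ i ≠ 0 := fun i => by
    by_cases hi : μ i = 0
    · exact Or.inl (h0 i hi)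
    · exact Or.inr hi
  have h := hasSum_integral_resolvent (q := (s + 1) / 2) (by rw [hre]; linarith) hk hc
    (fun z hz => hE.hasSum_resTrace hz hB hs hn)
    (summable_div_rpow hs hδ hgap hc (fun i => hE.norm_inner_basis_le hC0 hC i)
      (by rw [hre]; linarith) (by rw [hre]; linarith))
  exact ⟨h.1, h.2.unique (hη.mul_left _)⟩

/-- The weak eta function as an integral. -/
theorem VarData.integral_coef (h : VarData T T' B f μ δ) (hp : 0 < p)
    (hs : Summable fun i => (1 + μ i ^ 2) ^ (-(p / 2))) {s : ℂ} (hps : p < s.re) {k : ℕ}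
    (hk : ((s + 1) / 2).re < k) :
    IntegrableOn (fun z : ℝ => (z : ℂ) ^ ((k : ℂ) - 1 - (s + 1) / 2) *
      (k * ∑' i, h.coef i * ((((μ i ^ 2 + z)⁻¹) ^ (k + 1) : ℝ) : ℂ))) (Set.Ioi 0) ∧
    ∫ z in Set.Ioi (0 : ℝ), (z : ℂ) ^ ((k : ℂ) - 1 - (s + 1) / 2) *
      (k * ∑' i, h.coef i * ((((μ i ^ 2 + z)⁻¹) ^ (k + 1) : ℝ) : ℂ)) =
    Complex.betaIntegral (k - (s + 1) / 2) ((s + 1) / 2) *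
      ((s + 1) / 2 * etaWeak (op T) (weakForm T T' B) s) := by
  have := countable_of_summable hs
  set q := (s + 1) / 2 with hq
  have hre : q.re = (s.re + 1) / 2 := by simp [hq]
  have hq0 : 0 < q.re := by rw [hre]; linarith
  obtain ⟨C', hC'0, hC'⟩ := h.relT'
  obtain ⟨C, hC0, hC⟩ := h.relB
  have hc : ∀ i, h.coef i = 0 ∨ μ i ≠ 0 := fun i => by
    by_cases hi : μ i = 0
    · exact Or.inl (h.coef_eq_zero i hi)
    · exact Or.inr hi
  have hcb : ∀ i, ‖h.coef i‖ ≤ 8 * C' * C * (1 + μ i ^ 2) ^ (3 / 2 : ℝ) := fun i => by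
    rw [← jb_pow_three]; exact h.norm_coef_le hC'0 hC' hC0 hC i
  have hr1 : (q + 1).re = q.re + 1 := by simp
  -- Used with k+1 and q+1, which leaves the exponent of z and the first beta argument unchanged.
  -- The extra unit in q compensates the order-three growth of the coefficients.
  have hInt := hasSum_integral_resolvent (q := q + 1) (k := k + 1) (c := h.coef) (μ := μ)
    (F := fun z => ∑' i, h.coef i * ((((μ i ^ 2 + z)⁻¹) ^ (k + 1) : ℝ) : ℂ))
    (by rw [hr1]; linarith) (by rw [hr1]; push_cast; linarith) hc
    (fun z hz => (tsum_mul_sqRes_pow_le hs h.pos h.gap hc (C := 8 * C' * C) (r := 3 / 2)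
      (by positivity) hp.le (by norm_num) hcb
      (by push_cast; linarith) hz).1.of_norm.hasSum)
    (summable_div_rpow hs h.pos h.gap hc hcb (by rw [hr1]; linarith) (by rw [hr1]; linarith))
  have e1 : ((k + 1 : ℕ) : ℂ) - 1 - (q + 1) = (k : ℂ) - 1 - q := by push_cast; ring
  have e2 : ((k + 1 : ℕ) : ℂ) - (q + 1) = (k : ℂ) - q := by push_cast; ring
  rw [e1, e2] at hInt
  have e3 : ∀ z : ℝ, (z : ℂ) ^ ((k : ℂ) - 1 - q) *
      (k * ∑' i, h.coef i * ((((μ i ^ 2 + z)⁻¹) ^ (k + 1) : ℝ) : ℂ)) =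
      k * ((z : ℂ) ^ ((k : ℂ) - 1 - q) *
        ∑' i, h.coef i * ((((μ i ^ 2 + z)⁻¹) ^ (k + 1) : ℝ) : ℂ)) := fun z => by ring
  simp only [e3]
  refine ⟨hInt.1.const_mul _, ?_⟩
  rw [integral_const_mul]
  have hw := ((h.etaWeakDefined hp hs hps).2.mul_left q).mul_left (Complex.betaIntegral (k - q) q)
  refine (hInt.2.mul_left (k : ℂ)).unique ?_
  convert! hw using 1
  funext i
  by_cases hi : μ i = 0
  · rw [h.coef_eq_zero i hi]; simp
  have hb := add_mul_betaIntegral_add_one (u := k - q) (v := q) (by simp; linarith) hq0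
  rw [sub_add_cancel] at hb
  have hμ : ((μ i ^ 2 : ℝ) : ℂ) ≠ 0 := by exact_mod_cast pow_ne_zero 2 hi
  have ht : (tinv (μ i) : ℂ) * ((μ i ^ 2 : ℝ) : ℂ) = 1 := by
    rw [← Complex.ofReal_mul, mul_comm, sq_mul_tinv hi, Complex.ofReal_one]
  have ht' : (tinv (μ i) : ℂ) = (((μ i ^ 2 : ℝ) : ℂ))⁻¹ := eq_inv_of_mul_eq_one_left ht
  rw [ht', Complex.cpow_add _ _ hμ, Complex.cpow_one]
  calc (k : ℂ) * (Complex.betaIntegral (k - q) (q + 1) *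
        (h.coef i / (((μ i ^ 2 : ℝ) : ℂ) ^ q * ((μ i ^ 2 : ℝ) : ℂ))))
      = ((k : ℂ) * Complex.betaIntegral (k - q) (q + 1)) *
        (h.coef i / (((μ i ^ 2 : ℝ) : ℂ) ^ q * ((μ i ^ 2 : ℝ) : ℂ))) := by ring
    _ = _ := by
      rw [hb, ← hq]
      field_simp

end Fixed

namespace VarFamily

variable {J : Set ℝ} {A A' B B' : ℝ → D →ₗ[ℂ] H} {a : ℝ}

theorem relBdd_derivB (h : VarFamily J A A' B B') (ha : a ∈ J) : RelBdd (A a) (B' a) := by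
  obtain ⟨_, _, _, hE⟩ := h.eigen a ha
  exact h.derivB.relBdd_deriv h.isOpen hE (fun b hb => by
    obtain ⟨_, _, _, hE₂⟩ := h.eigen b hb
    exact (hE.relBdd hE₂).trans (h.relB b hb)) ha

theorem inner_deriv_basis (h : VarFamily J A A' B B') (ha : a ∈ J) (hp : 0 < p)
    (hpa : ResolventMemSchatten p (op (A a))) {ι : Type} {f : HilbertBasis ι ℂ H} {μ : ι → ℝ}
    (hE : IsEigenbasis (A a) f μ) (i : ι) (hi : μ i = 0) :
    ⟪f i, B' a ⟨f i, hE.mem i⟩⟫_ℂ = 0 := by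
  refine h.inner_deriv_ker ha hp hpa ⟨f i, hE.mem i⟩ ⟨f i, hE.mem i⟩
    (h.apply_ker ha hE i (hE.mem i) hi) ?_
  rw [hE.apply_basis, hi, Complex.ofReal_zero, zero_smul]

/-- Differentiate the resolvent integral under the integral sign and divide by the beta constant,
which is nonzero and independent of b. -/
theorem hasDerivAt_eta (h : VarFamily J A A' B B') (ha : a ∈ J) (hp : 0 < p)
    (hpa : ResolventMemSchatten p (op (A a))) {s : ℂ} (hps : p < s.re) :
    HasDerivAt (fun b => eta (op (A b)) (app (op (B b))) s)
      (eta (op (A a)) (app (op (B' a))) s -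
        (s + 1) / 2 * etaWeak (op (A a)) (weakForm (A a) (A' a) (B a)) s) a := by
  obtain ⟨ε, hε, C, hC, δ, hδ, M, hεJ, -, hctl⟩ := h.exists_local ha hp hpa
  have haε := Metric.mem_ball_self (x := a) hε
  set q := (s + 1) / 2 with hq
  have hre : q.re = (s.re + 1) / 2 := by simp [hq]
  have hq0 : 0 < q.re := by rw [hre]; linarith
  -- m ≥ p/2 makes the m-th resolvent power nuclear, and m ≥ Re q makes the total power 3m+2 exceed
  -- Re q.
  obtain ⟨m, hm⟩ := exists_nat_ge (max (p / 2) q.re)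
  have hm1 : p / 2 ≤ m := (le_max_left _ _).trans hm
  have hm2 : q.re ≤ m := (le_max_right _ _).trans hm
  have hm0 : (0 : ℝ) ≤ m := Nat.cast_nonneg m
  have hkq : q.re < ((3 * m + 1 + 1 : ℕ) : ℝ) := by push_cast; linarith
  have hn : p / 2 ≤ ((3 * m + 1 : ℕ) : ℝ) := by push_cast; linarith
  set F : ℝ → ℝ → ℂ := fun b z => (z : ℂ) ^ (((3 * m + 1 + 1 : ℕ) : ℂ) - 1 - q) *
    resTrace (A b) (B b) (3 * m + 1 + 1) z with hF
  set F' : ℝ → ℝ → ℂ := fun b z => (z : ℂ) ^ (((3 * m + 1 + 1 : ℕ) : ℂ) - 1 - q) *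
    deriv (fun b => resTrace (A b) (B b) (3 * m + 1 + 1) z) b with hF'
  set c := Complex.betaIntegral ((3 * m + 1 + 1 : ℕ) - q) q with hcdef
  have hc0 : c ≠ 0 := betaIntegral_ne_zero (by
    rw [Complex.sub_re, Complex.natCast_re]; linarith) hq0
  have hInt : ∀ b ∈ Metric.ball a ε, IntegrableOn (F b) (Set.Ioi 0) ∧
      ∫ z in Set.Ioi (0 : ℝ), F b z = c * eta (op (A b)) (app (op (B b))) s := fun b hb => by
    obtain ⟨ι, f, μ, hc⟩ := hctl b hb
    exact hc.var.eigen.integral_resTrace hp hc.summable hc.var.relB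
      (fun i hi => by rw [hc.var.ker i (hc.var.eigen.mem i) hi, inner_zero_right]) hps hn hkq
  obtain ⟨ι, f, μ, hca⟩ := hctl a haε
  have hE := hca.var.eigen
  have hB' := hE.integral_resTrace hp hca.summable (h.relBdd_derivB ha)
    (h.inner_deriv_basis ha hp hpa hE) hps hn hkq
  have hW := hca.var.integral_coef hp hca.summable hps hkq
  have hF'a : ∀ z ∈ Set.Ioi (0 : ℝ), F' a z =
      (z : ℂ) ^ (((3 * m + 1 + 1 : ℕ) : ℂ) - 1 - q) * resTrace (A a) (B' a) (3 * m + 1 + 1) z -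
      (z : ℂ) ^ (((3 * m + 1 + 1 : ℕ) : ℂ) - 1 - q) * ((3 * m + 1 + 1 : ℕ) *
        ∑' i, hca.var.coef i * ((((μ i ^ 2 + z)⁻¹) ^ (3 * m + 1 + 1 + 1) : ℝ) : ℂ)) := fun z hz => by
    have h1 := (h.hasDerivAt_resTrace ha hp hpa hz hm1 hca.var hca.summable).deriv
    have h2 := (hE.hasSum_resTrace hz (h.relBdd_derivB ha) hca.summable hn).tsum_eq
    simp only [hF']
    rw [h1, ← h2, mul_sub]
  -- The first summand dominates the B' term, of order one; the second dominates the `coef` term, of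
  -- order three; M bounds the spectral sums for all b in the ball.
  set K := (2 * C * (1 + (δ ^ 2)⁻¹) ^ (p / 2 + 1 / 2) + (3 * m + 1 + 1 : ℕ) *
    (8 * C * C * (1 + (δ ^ 2)⁻¹) ^ (p / 2 + 3 / 2))) * M with hK
  have hbound : ∀ z ∈ Set.Ioi (0 : ℝ), ∀ b ∈ Metric.ball a ε,
      HasDerivAt (fun b => F b z) (F' b z) b ∧
      ‖F' b z‖ ≤ K * (z ^ (((3 * m + 1 + 1 : ℕ) : ℝ) - 1 - q.re) *
        (δ ^ 2 + z) ^ (p / 2 + 1 / 2 - ((3 * m + 1 + 1 : ℕ) : ℝ))) := fun z hz b hb => by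
    obtain ⟨ι, f, μ, hc⟩ := hctl b hb
    have hz0 : (0 : ℝ) < z := hz
    have hd := h.hasDerivAt_resTrace (hεJ hb) hp hc.schatten hz hm1 hc.var hc.summable
    refine ⟨?_, ?_⟩
    · have := hd.differentiableAt.hasDerivAt.const_mul
        ((z : ℂ) ^ (((3 * m + 1 + 1 : ℕ) : ℂ) - 1 - q))
      exact this
    have hk1 : p / 2 + 1 / 2 ≤ ((3 * m + 1 + 1 : ℕ) : ℝ) := by rw [hre] at hkq; linarith
    have hk2 : p / 2 + 3 / 2 ≤ ((3 * m + 1 + 1 + 1 : ℕ) : ℝ) := by push_cast at hk1 ⊢; linarith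
    have b1 := tsum_mul_sqRes_pow_le hc.summable hδ hc.var.gap (C := 2 * C) (r := 1 / 2)
      (c := fun i => ⟪f i, B' b ⟨f i, hc.var.eigen.mem i⟩⟫_ℂ) (fun i => by
        by_cases hi : μ i = 0
        · exact Or.inl (h.inner_deriv_basis (hεJ hb) hp hc.schatten hc.var.eigen i hi)
        · exact Or.inr hi) (by positivity) hp.le (by norm_num)
      (fun i => hc.var.eigen.norm_inner_basis_le hC (fun x => (hc.bound x).2.2) i) hk1 hz
    have b2 := tsum_mul_sqRes_pow_le hc.summable hδ hc.var.gap (C := 8 * C * C) (r := 3 / 2)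
      (c := hc.var.coef) (fun i => by
        by_cases hi : μ i = 0
        · exact Or.inl (hc.var.coef_eq_zero i hi)
        · exact Or.inr hi) (by positivity) hp.le (by norm_num)
      (fun i => by
        rw [← jb_pow_three]
        exact hc.var.norm_coef_le hC (fun x => (hc.bound x).1) hC (fun x => (hc.bound x).2.1) i)
      hk2 hz
    -- The `coef` term grows one order more in 1+μ² but carries one more resolvent, so both terms
    -- decay alike in z.
    have e : p / 2 + 3 / 2 - ((3 * m + 1 + 1 + 1 : ℕ) : ℝ) =
        p / 2 + 1 / 2 - ((3 * m + 1 + 1 : ℕ) : ℝ) := by push_cast; ring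
    rw [e] at b2
    set E := (δ ^ 2 + z) ^ (p / 2 + 1 / 2 - ((3 * m + 1 + 1 : ℕ) : ℝ)) with hEdef
    have hE0 : 0 ≤ E := by positivity
    have b1' := (norm_tsum_le_tsum_norm b1.1).trans (b1.2.trans
      (mul_le_mul_of_nonneg_left hc.tsum_le (by positivity)))
    have b2' := (norm_tsum_le_tsum_norm b2.1).trans (b2.2.trans
      (mul_le_mul_of_nonneg_left hc.tsum_le (by positivity)))
    have hdv : deriv (fun b => resTrace (A b) (B b) (3 * m + 1 + 1) z) b = _ := hd.deriv
    simp only [hF']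
    rw [hdv, norm_mul, Complex.norm_cpow_eq_rpow_re_of_pos hz0]
    have e4 : (((3 * m + 1 + 1 : ℕ) : ℂ) - 1 - q).re = ((3 * m + 1 + 1 : ℕ) : ℝ) - 1 - q.re := by
      rw [Complex.sub_re, Complex.sub_re, Complex.natCast_re, Complex.one_re]
    rw [e4, mul_left_comm K]
    refine mul_le_mul_of_nonneg_left ((norm_sub_le _ _).trans ?_) (by positivity)
    rw [norm_mul, Complex.norm_natCast]
    calc _ ≤ 2 * C * (1 + (δ ^ 2)⁻¹) ^ (p / 2 + 1 / 2) * E * M + ((3 * m + 2 : ℕ) : ℝ) *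
          (8 * C * C * (1 + (δ ^ 2)⁻¹) ^ (p / 2 + 3 / 2) * E * M) :=
        add_le_add b1' (mul_le_mul_of_nonneg_left b2' (Nat.cast_nonneg _))
      _ = K * E := by rw [hK]; push_cast; ring
  have hmeas : ∀ᶠ b in nhds a, AEStronglyMeasurable (F b) (volume.restrict (Set.Ioi 0)) := by
    filter_upwards [Metric.ball_mem_nhds a hε] with b hb
    exact (hInt b hb).1.aestronglyMeasurable
  have hF'int : IntegrableOn (F' a) (Set.Ioi 0) :=
    (integrableOn_congr_fun hF'a measurableSet_Ioi).mpr (hB'.1.sub hW.1)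
  -- The majorant is integrable at 0 because Re q < 3m+2, and at infinity because p/2 + 1/2 < Re q,
  -- which is the condition p < Re s.
  have key := hasDerivAt_integral_of_dominated_loc_of_deriv_le
    (μ := volume.restrict (Set.Ioi 0)) (Metric.ball_mem_nhds a hε) hmeas (hInt a haε).1
    (F' := F') hF'int.aestronglyMeasurable
    (by filter_upwards [ae_restrict_mem measurableSet_Ioi] with z hz b hb using (hbound z hz b hb).2)
    ((integrableOn_rpow_mul_rpow (by positivity) (by linarith) (by linarith)
      (by rw [hre]; linarith)).const_mul K)
    (by filter_upwards [ae_restrict_mem measurableSet_Ioi] with z hz b hb using (hbound z hz b hb).1)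
  have hval : ∫ z in Set.Ioi (0 : ℝ), F' a z = c * (eta (op (A a)) (app (op (B' a))) s -
        q * etaWeak (op (A a)) (weakForm (A a) (A' a) (B a)) s) := by
    rw [setIntegral_congr_fun measurableSet_Ioi hF'a, integral_sub hB'.1 hW.1, hB'.2, hW.2, mul_sub]
  have hder := key.2.const_mul c⁻¹
  rw [hval, inv_mul_cancel_left₀ hc0] at hder
  refine hder.congr_of_eventuallyEq ?_
  filter_upwards [Metric.ball_mem_nhds a hε] with b hb
  rw [(hInt b hb).2, inv_mul_cancel_left₀ hc0]

end VarFamily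

end EtaVar

namespace EtaVar

variable {H : Type*} [NormedAddCommGroup H] [InnerProductSpace ℂ H] [CompleteSpace H]
variable {D : Submodule ℂ H} {p : ℝ}

/-! ### The variation formulas -/

theorem HasStrongDeriv.sqDeriv_eq {J : Set ℝ} {A A' : ℝ → D →ₗ[ℂ] H} (hA' : HasStrongDeriv J A A')
    {a : ℝ} (ha : a ∈ J) (u w : D) :
    sqDeriv A a u w = ⟪A' a u, A a w⟫_ℂ + ⟪A a u, A' a w⟫_ℂ := by
  have := (((hA' u).1 a ha).inner ℂ ((hA' w).1 a ha)).deriv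
  rw [sqDeriv, this, add_comm]

theorem HasStrongDeriv.variationForm_eq {J : Set ℝ} {A A' : ℝ → D →ₗ[ℂ] H}
    (hA' : HasStrongDeriv J A A') (B : ℝ → D →ₗ[ℂ] H) {a : ℝ} (ha : a ∈ J) :
    variationForm A B a = weakForm (A a) (A' a) (B a) := by
  funext y x
  rw [variationForm, weakForm]
  by_cases h : app (op (B a))† y ∈ D
  · rw [dif_pos h, dif_pos h]
    exact hA'.sqDeriv_eq ha _ _
  · rw [dif_neg h, dif_neg h]

theorem exists_eigenbasis_of_schatten {T : D →ₗ[ℂ] H} (hT : IsSelfAdjoint (op T)) (hp : 0 < p)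
    (hTp : ResolventMemSchatten p (op T)) :
    ∃ (ι : Type) (f : HilbertBasis ι ℂ H) (μ : ι → ℝ), IsEigenbasis T f μ := by
  obtain ⟨R, hR, hRp⟩ := hTp
  exact exists_eigenbasis hT hR (hRp.isCompactOperator hp)

/-- A diagonalizable operator commutes with the resolvents of its square. -/
theorem IsEigenbasis.commutesWithResolvents_sq {T : D →ₗ[ℂ] H} {ι : Type} {f : HilbertBasis ι ℂ H}
    {μ : ι → ℝ} (hE : IsEigenbasis T f μ) : CommutesWithResolvents (op T) (sq (op T)) := by
  intro ζ R hR (x : D)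
  have hTf : ∀ i, T ⟨f i, hE.mem i⟩ ∈ D := fun i => by
    rw [hE.apply_basis]; exact D.smul_mem _ (hE.mem i)
  have hTTf : ∀ i, T ⟨T ⟨f i, hE.mem i⟩, hTf i⟩ = (μ i : ℂ) ^ 2 • f i := fun i => by
    have e : (⟨T ⟨f i, hE.mem i⟩, hTf i⟩ : D) = (μ i : ℂ) • ⟨f i, hE.mem i⟩ :=
      Subtype.ext (hE.apply_basis i)
    rw [e, map_smul, hE.apply_basis, smul_smul, pow_two]
  -- Otherwise T² - ζ would annihilate the unit vector f_i, contradicting the existence of the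
  -- inverse R.
  have hne : ∀ i, (μ i : ℂ) ^ 2 - ζ ≠ 0 := fun i h0 => by
    have h1 := hR.2 ⟨f i, ⟨⟨f i, hE.mem i⟩, hTf i, rfl⟩⟩
    have h2 : sq (op T) ⟨f i, ⟨⟨f i, hE.mem i⟩, hTf i, rfl⟩⟩ = (μ i : ℂ) ^ 2 • f i := hTTf i
    rw [h2] at h1
    change R ((μ i : ℂ) ^ 2 • f i - ζ • f i) = f i at h1
    rw [← sub_smul, h0, zero_smul, map_zero] at h1
    have := f.orthonormal.1 i
    rw [← h1, norm_zero] at this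
    exact zero_ne_one this
  have hc : ∀ y, ∃ h : R y ∈ D, ∀ i, ((μ i : ℂ) ^ 2 - ζ) * ⟪f i, R y⟫_ℂ = ⟪f i, y⟫_ℂ := fun y => by
    obtain ⟨hy, e⟩ := hR.1 y
    obtain ⟨v, hv, hvy⟩ := id hy
    have hm : R y ∈ D := hvy ▸ v.2
    refine ⟨hm, fun i => ?_⟩
    have hm2 : T ⟨R y, hm⟩ ∈ D := by
      have : (⟨R y, hm⟩ : D) = v := Subtype.ext hvy.symm
      rw [this]; exact hv
    have e' : T ⟨T ⟨R y, hm⟩, hm2⟩ - ζ • R y = y := e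
    conv_rhs => rw [← e']
    rw [inner_sub_right, inner_smul_right, hE.inner_apply, hE.inner_apply]
    ring
  obtain ⟨hm, h1⟩ := hc x
  refine ⟨hm, ?_⟩
  change T ⟨R x, hm⟩ = R (T x)
  refine hilbertBasis_ext f fun i => mul_left_cancel₀ (hne i) ?_
  rw [(hc (T x)).choose_spec, hE.inner_apply, hE.inner_apply, ← h1 i]
  ring

theorem IsEigenbasis.eigenproj_apply_eigenproj {T : D →ₗ[ℂ] H} {ι : Type} {f : HilbertBasis ι ℂ H}
    {μ : ι → ℝ} (hE : IsEigenbasis T f μ) (x : H) :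
    eigenproj (op T) 0 (app (op T) (eigenproj (op T) 0 x)) = 0 := by
  have hb : IsBdd fun i => if μ i = 0 then (1 : ℂ) else 0 :=
    ⟨1, fun i => by dsimp only; split_ifs <;> simp⟩
  have hb' : IsBdd fun i => (μ i : ℂ) * if μ i = 0 then (1 : ℂ) else 0 :=
    ⟨0, fun i => by dsimp only; split_ifs with h <;> simp [h]⟩
  rw [hE.eigenproj_eq, hE.eigenproj_eq, app_op _ (hE.diag_mem hb hb' x), hE.apply_diag hb hb']
  refine hilbertBasis_ext f fun i => ?_
  rw [inner_diag hb, inner_diag hb', inner_zero_right]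
  split_ifs with h <;> simp [h]

namespace VarFamily

variable {J : Set ℝ} {A A' B B' : ℝ → D →ₗ[ℂ] H} {a : ℝ}

theorem of_selfAdjoint (hJ : IsOpen J) (hA : ∀ a ∈ J, IsSelfAdjoint (op (A a)))
    (hAp : ∀ a ∈ J, ∃ p : ℝ, 0 < p ∧ ResolventMemSchatten p (op (A a)))
    (hker : ∀ a ∈ J, ∀ b ∈ J, Module.finrank ℂ (eigenspace (op (A a)) 0) =
      Module.finrank ℂ (eigenspace (op (A b)) 0))
    (hA' : HasStrongDeriv J A A') (hB : ∀ a ∈ J, IsRelBounded (op (A a)) (op (B a)))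
    (hB0 : ∀ a ∈ J, ∀ x : H,
      eigenproj (op (A a)) 0 (app (op (B a)) (eigenproj (op (A a)) 0 x)) = 0)
    (hBc : ∀ a ∈ J, CommutesWithResolvents (op (B a)) (sq (op (A a))))
    (hB' : HasStrongDeriv J B B') : VarFamily J A A' B B' where
  isOpen := hJ
  eigen a ha := by
    obtain ⟨p, hp, hpa⟩ := hAp a ha
    exact exists_eigenbasis_of_schatten (hA a ha) hp hpa
  finite a ha := by
    obtain ⟨p, hp, hpa⟩ := hAp a ha
    obtain ⟨ι, f, μ, hE⟩ := exists_eigenbasis_of_schatten (hA a ha) hp hpa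
    obtain ⟨R, hR, hRp⟩ := hpa
    exact hE.finiteDimensional_ker hp (hE.summable_of_resolventMemSchatten hp hR hRp).1
  finrank_ker := hker
  derivA := hA'
  relB a ha := isRelBounded_iff.mp (hB a ha)
  ker := hB0
  comm := hBc
  derivB := hB'

theorem self (hJ : IsOpen J) (hA : ∀ a ∈ J, IsSelfAdjoint (op (A a)))
    (hAp : ∀ a ∈ J, ∃ p : ℝ, 0 < p ∧ ResolventMemSchatten p (op (A a)))
    (hker : ∀ a ∈ J, ∀ b ∈ J, Module.finrank ℂ (eigenspace (op (A a)) 0) =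
      Module.finrank ℂ (eigenspace (op (A b)) 0))
    (hA' : HasStrongDeriv J A A') : VarFamily J A A' A A' := by
  have hE : ∀ a ∈ J, ∃ (ι : Type) (f : HilbertBasis ι ℂ H) (μ : ι → ℝ), IsEigenbasis (A a) f μ :=
    fun a ha => by
      obtain ⟨p, hp, hpa⟩ := hAp a ha
      exact exists_eigenbasis_of_schatten (hA a ha) hp hpa
  refine of_selfAdjoint hJ hA hAp hker hA' (fun a _ => isRelBounded_iff.mpr (relBdd_self (A a)))
    (fun a ha x => ?_) (fun a ha => ?_) hA'
  · obtain ⟨_, _, _, hE⟩ := hE a ha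
    exact hE.eigenproj_apply_eigenproj x
  · obtain ⟨_, _, _, hE⟩ := hE a ha
    exact hE.commutesWithResolvents_sq

theorem exists_varData (h : VarFamily J A A' B B') (ha : a ∈ J) (hp : 0 < p)
    (hpa : ResolventMemSchatten p (op (A a))) :
    ∃ (ι : Type) (f : HilbertBasis ι ℂ H) (μ : ι → ℝ) (δ : ℝ),
      VarData (A a) (A' a) (B a) f μ δ ∧ Summable fun i => (1 + μ i ^ 2) ^ (-(p / 2)) := by
  obtain ⟨ε, hε, C, -, δ, -, M, -, -, hctl⟩ := h.exists_local ha hp hpa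
  obtain ⟨ι, f, μ, hc⟩ := hctl a (Metric.mem_ball_self hε)
  exact ⟨ι, f, μ, δ, hc.var, hc.summable⟩

theorem etaDefined (h : VarFamily J A A' B B') (ha : a ∈ J) (hp : 0 < p)
    (hpa : ResolventMemSchatten p (op (A a))) {s : ℂ} (hps : p < s.re) :
    EtaDefined (op (A a)) (app (op (B a))) s ∧ EtaDefined (op (A a)) (app (op (B' a))) s := by
  obtain ⟨ι, f, μ, δ, V, hs⟩ := h.exists_varData ha hp hpa
  exact ⟨(V.eigen.etaDefined_of_relBdd hp hs V.relB (fun i hi => by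
      rw [V.ker i (V.eigen.mem i) hi, inner_zero_right]) hps).1,
    (V.eigen.etaDefined_of_relBdd hp hs (h.relBdd_derivB ha)
      (h.inner_deriv_basis ha hp hpa V.eigen) hps).1⟩

theorem etaWeakDefined (h : VarFamily J A A' B B') (ha : a ∈ J) (hp : 0 < p)
    (hpa : ResolventMemSchatten p (op (A a))) {s : ℂ} (hps : p < s.re) :
    EtaWeakDefined (op (A a)) (weakForm (A a) (A' a) (B a)) s := by
  obtain ⟨ι, f, μ, δ, V, hs⟩ := h.exists_varData ha hp hpa
  exact (V.etaWeakDefined hp hs hps).1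

/-- If `B` commutes with the resolvents of `A`, the weak operator has twice the `η`-function of
`A' B A Ã⁻²`. -/
theorem etaWeak_of_commute (h : VarFamily J A A' B B') (ha : a ∈ J) (hp : 0 < p)
    (hpa : ResolventMemSchatten p (op (A a))) {s : ℂ} (hps : p < s.re)
    (hc : CommutesWithResolvents (op (B a)) (op (A a))) :
    EtaDefined (op (A a)) (fun x => app (op (A' a)) (app (op (B a)) (app (op (A a))
      (tildeInvSq (op (A a)) x)))) s ∧
    etaWeak (op (A a)) (weakForm (A a) (A' a) (B a)) s =
      2 * eta (op (A a)) (fun x => app (op (A' a)) (app (op (B a)) (app (op (A a))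
        (tildeInvSq (op (A a)) x)))) s := by
  obtain ⟨ι, f, μ, δ, V, hs⟩ := h.exists_varData ha hp hpa
  have h1 := V.etaDefined_simplified hp hs hps
  refine ⟨h1.1, (V.etaWeakDefined hp hs hps).2.unique ?_⟩
  convert! h1.2.mul_left 2 using 1
  funext i
  rw [V.coef_eq_of_commute hc]
  ring

/-- For `B = A` the weak operator has twice the `η`-function of `A'`. -/
theorem etaWeak_self (h : VarFamily J A A' A A') (ha : a ∈ J) (hp : 0 < p)
    (hpa : ResolventMemSchatten p (op (A a))) {s : ℂ} (hps : p < s.re) :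
    etaWeak (op (A a)) (weakForm (A a) (A' a) (A a)) s =
      2 * eta (op (A a)) (app (op (A' a))) s := by
  obtain ⟨ι, f, μ, δ, V, hs⟩ := h.exists_varData ha hp hpa
  have h1 := V.eigen.etaDefined_of_relBdd hp hs (h.relBdd_derivB ha)
    (h.inner_deriv_basis ha hp hpa V.eigen) hps
  refine (V.etaWeakDefined hp hs hps).2.unique ?_
  convert! h1.2.mul_left 2 using 1
  funext i
  by_cases hi : μ i = 0
  · rw [V.coef_eq_zero i hi, h.inner_deriv_basis ha hp hpa V.eigen i hi]; simp
  have e : (⟨A a ⟨f i, V.eigen.mem i⟩, V.apply_basis_mem i⟩ : D)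
      = (μ i : ℂ) • ⟨f i, V.eigen.mem i⟩ := Subtype.ext (V.eigen.apply_basis i)
  -- With A f_i = μ_i f_i each pairing yields μ_i² ⟨f_i, A' f_i⟩; the μ_i² then cancels against
  -- T̃⁻².
  have ec : V.coef i = 2 * (μ i : ℂ) ^ 2 * ⟪f i, A' a ⟨f i, V.eigen.mem i⟩⟫_ℂ := by
    rw [VarData.coef, e, map_smul, map_smul, V.eigen.apply_basis, inner_smul_right,
      inner_smul_right, inner_smul_right, inner_smul_left, Complex.conj_ofReal,
      V.symm ⟨f i, V.eigen.mem i⟩ ⟨f i, V.eigen.mem i⟩]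
    ring
  have ht : (μ i : ℂ) ^ 2 * (tinv (μ i) : ℂ) = 1 := by exact_mod_cast sq_mul_tinv hi
  rw [ec]
  calc 2 * (μ i : ℂ) ^ 2 * ⟪f i, A' a ⟨f i, V.eigen.mem i⟩⟫_ℂ * (tinv (μ i) : ℂ) /
        ((μ i ^ 2 : ℝ) : ℂ) ^ ((s + 1) / 2)
      = ((μ i : ℂ) ^ 2 * (tinv (μ i) : ℂ)) * (2 * ⟪f i, A' a ⟨f i, V.eigen.mem i⟩⟫_ℂ) /
        ((μ i ^ 2 : ℝ) : ℂ) ^ ((s + 1) / 2) := by ring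
    _ = _ := by rw [ht, one_mul, mul_div_assoc]

end VarFamily

end EtaVar

end

/-! ### The main theorem -/

theorem mainTheorem2 {H : Type*} [NormedAddCommGroup H] [InnerProductSpace ℂ H] [CompleteSpace H]
    (D : Submodule ℂ H) (J : Set ℝ) (hJ : IsOpen J) (hJc : IsConnected J)
    (A A' : ℝ → D →ₗ[ℂ] H)
    -- self-adjoint family with fixed domain, `(A + i)⁻¹` in some Schatten class
    (hA : ∀ a ∈ J, IsSelfAdjoint (EtaVar.op (A a)))
    (hAp : ∀ a ∈ J, ∃ p : ℝ, 0 < p ∧ EtaVar.ResolventMemSchatten p (EtaVar.op (A a)))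
    -- kernel of constant rank
    (hker : ∀ a ∈ J, ∀ b ∈ J,
      Module.finrank ℂ (EtaVar.eigenspace (EtaVar.op (A a)) 0) =
        Module.finrank ℂ (EtaVar.eigenspace (EtaVar.op (A b)) 0))
    (hA' : EtaVar.HasStrongDeriv J A A') :
    -- the variation formula for `η(A, B; s)`
    (∀ B B' : ℝ → D →ₗ[ℂ] H,
      (∀ a ∈ J, EtaVar.IsRelBounded (EtaVar.op (A a)) (EtaVar.op (B a))) →
      (∀ a ∈ J, ∀ x : H, EtaVar.eigenproj (EtaVar.op (A a)) 0
        (EtaVar.app (EtaVar.op (B a)) (EtaVar.eigenproj (EtaVar.op (A a)) 0 x)) = 0) →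
      (∀ a ∈ J, EtaVar.CommutesWithResolvents (EtaVar.op (B a)) (EtaVar.sq (EtaVar.op (A a)))) →
      EtaVar.HasStrongDeriv J B B' →
      ∀ a ∈ J, ∀ p : ℝ, 0 < p → EtaVar.ResolventMemSchatten p (EtaVar.op (A a)) →
      ∀ s : ℂ, p < s.re →
        EtaVar.EtaDefined (EtaVar.op (A a)) (EtaVar.app (EtaVar.op (B a))) s ∧
        EtaVar.EtaDefined (EtaVar.op (A a)) (EtaVar.app (EtaVar.op (B' a))) s ∧
        EtaVar.EtaWeakDefined (EtaVar.op (A a)) (EtaVar.variationForm A B a) s ∧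
        HasDerivAt (fun b : ℝ => EtaVar.eta (EtaVar.op (A b)) (EtaVar.app (EtaVar.op (B b))) s)
          (EtaVar.eta (EtaVar.op (A a)) (EtaVar.app (EtaVar.op (B' a))) s
            - (s + 1) / 2 * EtaVar.etaWeak (EtaVar.op (A a)) (EtaVar.variationForm A B a) s) a ∧
        -- where `B (A' A + A A') Ã⁻²` is literally defined on `D`, the last term is its `η`
        ((∀ x : D,
            (A' a (EtaVar.tildeInvSq (EtaVar.op (A a)) x)) ∈ D ∧
            EtaVar.app (EtaVar.op (A' a)) (EtaVar.app (EtaVar.op (A a))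
                (EtaVar.tildeInvSq (EtaVar.op (A a)) x))
              + EtaVar.app (EtaVar.op (A a)) (EtaVar.app (EtaVar.op (A' a))
                (EtaVar.tildeInvSq (EtaVar.op (A a)) x)) ∈ D) →
          EtaVar.EtaDefined (EtaVar.op (A a)) (fun x => EtaVar.app (EtaVar.op (B a))
            (EtaVar.app (EtaVar.op (A' a)) (EtaVar.app (EtaVar.op (A a))
                (EtaVar.tildeInvSq (EtaVar.op (A a)) x))
              + EtaVar.app (EtaVar.op (A a)) (EtaVar.app (EtaVar.op (A' a))
                (EtaVar.tildeInvSq (EtaVar.op (A a)) x)))) s ∧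
          EtaVar.etaWeak (EtaVar.op (A a)) (EtaVar.variationForm A B a) s =
            EtaVar.eta (EtaVar.op (A a)) (fun x => EtaVar.app (EtaVar.op (B a))
              (EtaVar.app (EtaVar.op (A' a)) (EtaVar.app (EtaVar.op (A a))
                  (EtaVar.tildeInvSq (EtaVar.op (A a)) x))
                + EtaVar.app (EtaVar.op (A a)) (EtaVar.app (EtaVar.op (A' a))
                  (EtaVar.tildeInvSq (EtaVar.op (A a)) x)))) s) ∧
        -- the simplified formula when `B` commutes with the resolvent of `A`
        ((∀ b ∈ J, EtaVar.CommutesWithResolvents (EtaVar.op (B b)) (EtaVar.op (A b))) →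
          EtaVar.EtaDefined (EtaVar.op (A a)) (fun x => EtaVar.app (EtaVar.op (A' a))
            (EtaVar.app (EtaVar.op (B a)) (EtaVar.app (EtaVar.op (A a))
              (EtaVar.tildeInvSq (EtaVar.op (A a)) x)))) s ∧
          HasDerivAt (fun b : ℝ => EtaVar.eta (EtaVar.op (A b)) (EtaVar.app (EtaVar.op (B b))) s)
            (EtaVar.eta (EtaVar.op (A a)) (EtaVar.app (EtaVar.op (B' a))) s
              - (s + 1) * EtaVar.eta (EtaVar.op (A a)) (fun x => EtaVar.app (EtaVar.op (A' a))
                (EtaVar.app (EtaVar.op (B a)) (EtaVar.app (EtaVar.op (A a))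
                  (EtaVar.tildeInvSq (EtaVar.op (A a)) x)))) s) a)) ∧
    -- the variation formula for `η(A; s)`
    (∀ a ∈ J, ∀ p : ℝ, 0 < p → EtaVar.ResolventMemSchatten p (EtaVar.op (A a)) →
      ∀ s : ℂ, p < s.re →
        EtaVar.EtaDefined (EtaVar.op (A a)) (EtaVar.app (EtaVar.op (A a))) s ∧
        EtaVar.EtaDefined (EtaVar.op (A a)) (EtaVar.app (EtaVar.op (A' a))) s ∧
        HasDerivAt (fun b : ℝ => EtaVar.etaSelf (EtaVar.op (A b)) s)
          (-s * EtaVar.eta (EtaVar.op (A a)) (EtaVar.app (EtaVar.op (A' a))) s) a) := by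
  refine ⟨fun B B' hB hB0 hBc hB' a ha p hp hpa s hps => ?_, fun a ha p hp hpa s hps => ?_⟩
  · have h := EtaVar.VarFamily.of_selfAdjoint hJ hA hAp hker hA' hB hB0 hBc hB'
    have hd := h.hasDerivAt_eta ha hp hpa hps
    rw [hA'.variationForm_eq B ha]
    refine ⟨(h.etaDefined ha hp hpa hps).1, (h.etaDefined ha hp hpa hps).2,
      h.etaWeakDefined ha hp hpa hps, hd, fun hl => ?_, fun hc => ?_⟩
    · obtain ⟨ι, f, μ, δ, V, hs⟩ := h.exists_varData ha hp hpa
      exact V.literal hp hs hps hl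
    · obtain ⟨h1, h2⟩ := h.etaWeak_of_commute ha hp hpa hps (hc a ha)
      refine ⟨h1, ?_⟩
      rw [h2] at hd
      convert! hd using 1
      ring
  · have h := EtaVar.VarFamily.self hJ hA hAp hker hA'
    have hd := h.hasDerivAt_eta ha hp hpa hps
    rw [h.etaWeak_self ha hp hpa hps] at hd
    refine ⟨(h.etaDefined ha hp hpa hps).1, (h.etaDefined ha hp hpa hps).2, ?_⟩
    -- For B = A the weak term is 2η(A,A';s), so the total factor is 1 - (s+1) = -s.
    have e : -s * EtaVar.eta (EtaVar.op (A a)) (EtaVar.app (EtaVar.op (A' a))) s =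
        EtaVar.eta (EtaVar.op (A a)) (EtaVar.app (EtaVar.op (A' a))) s - (s + 1) / 2 *
          (2 * EtaVar.eta (EtaVar.op (A a)) (EtaVar.app (EtaVar.op (A' a))) s) := by ring
    rw [e]
    exact hd
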